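/- Let $k$ be an algebraically closed field and let $A$ be a nonzero finite-dimensional weak bialgebra over $k$ which is hereditary as an algebra. Let $\mathcal A=A\text{-mod}$ be the category of finite-dimensional left $A$-modules with the exact tensor product $M\otimes N=\Delta(1)(M\otimes_k N)$, and let $D^b(\mathcal A)$ be its bounded derived category, with the induced monoidal triangulated structure. Conventions. A *t-structure* $(\mathcal T^{\le 0},\mathcal T^{\ge 0})$ on a triangulated category $\mathcal T$ is a t-structure in the usual sense, with both subcategories closed under isomorphism; $\mathcal T^{\le n}=\mathcal T^{\le 0}[-n]$, $\mathcal T^{\ge n}=\mathcal T^{\ge 0}[-n]$, and the heart is $\mathcal T^{\le 0}\cap\mathcal T^{\ge 0}$. It is *hereditary* if every object lies in $\mathcal T^{\le n}\cap\mathcal T^{\ge m}$ for some $m\le n$, and $\operatorname{Hom}(X,Y[n])=0$ for all $X,Y$ in the heart and all $n\ge 2$. If $\mathcal T$ is monoidal triangulated, the t-structure is an *mtt-structure* if (a) $\mathcal T^{\le 0}\otimes\mathcal T^{\le 0}\subseteq\mathcal T^{\le 0}$ and $\mathcal T^{\le 0}\otimes\mathcal T^{\le 0}\not\subseteq\mathcal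 T^{\le -1}$; (b) $\mathcal T^{\le 0}$ and $\mathcal T^{\ge 0}$ are closed under direct summands; (c) there is an integer $D\ge 0$ with $\mathcal T^{\ge D}\otimes\mathcal T^{\ge D}\subseteq\mathcal T^{\ge D}$. The least such $D$ is its *deviation*. The category $\mathcal A$ is *discrete* if it is Hom-finite, all its objects have finite length, it has finitely many simple objects up to isomorphism, and for simple objects $S,S'$ one has $S\otimes S'\cong S$ if $S\cong S'$ and $S\otimes S'=0$ otherwise. A finite *brick set* is a finite family $X_1,\dots,X_r$ of objects with $\operatorname{End}(X_i)=k$ and $\operatorname{Hom}(X_i,X_j)=0$ for $i\ne j$. For $M\in\mathcal A$ put $$\operatorname{fpv}(M)=\sup_{\{X_1,\dots,X_r\}}\ \limsup_{n\to\infty}\ \rho\Big(\big(\dim_k\operatorname{Hom}(X_i,(M\otimes-)^n X_j)\big)_{i,j}\Big)^{1/n},$$ the supremum being over all finite brick sets and $\rho$ denoting the spectral radius. The category $\mathcal A$ is *fpv-positive* if it is Hom-finite, all its objects have finite length, it has finitely many simple objects up to isomorphism, and $\operatorname{fpv}(M)>0$ for every $M\neq 0$. Suppose that $\mathcal A$ is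 discrete or fpv-positive. Then: 1. There is a unique hereditary mtt-structure of deviation zero on $D^b(\mathcal A)$, and it is the canonical t-structure of $D^b(\mathcal A)$. 2. The heart of any hereditary mtt-structure of deviation zero on $D^b(\mathcal A)$ is $\mathcal A$, that is, it consists of the objects isomorphic to a module placed in degree $0$. 3. $\mathcal A$ is determined by the monoidal triangulated category $D^b(\mathcal A)$: if $B$ is a finite-dimensional weak bialgebra over $k$ that is hereditary as an algebra and $F:D^b(A\text{-mod})\to D^b(B\text{-mod})$ is a $k$-linear monoidal triangulated equivalence, then there is a $k$-linear monoidal equivalence $\Phi:A\text{-mod}\to B\text{-mod}$ which is isomorphic to the restriction of $F$ to modules placed in degree $0$. -/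

import Mathlib

open CategoryTheory MonoidalCategory Limits
open scoped TensorProduct ModuleCat

universe u

set_option linter.unusedSectionVars false
set_option linter.unusedVariables false

noncomputable section

/-- A weak bialgebra over `k`: an associative unital algebra and a coassociative counital
coalgebra such that the comultiplication is multiplicative (but need not preserve `1`), with the
usual weakened compatibility axioms for the unit and the counit. -/
class WeakBialgebra (k : Type u) (A : Type u) [Field k] [Ring A] [Algebra k A] extends
    Coalgebra k A where
  comul_mul (a b : A) : comul (a * b) = comul a * comul b
  /-- `(Δ(1) ⊗ 1) (1 ⊗ Δ(1)) = (Δ ⊗ id) Δ(1)` -/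
  comul_one_left : TensorProduct.assoc k A A A (comul 1 ⊗ₜ[k] 1) * ((1 : A) ⊗ₜ[k] comul 1) =
    TensorProduct.assoc k A A A (comul.rTensor A (comul 1))
  /-- `(1 ⊗ Δ(1)) (Δ(1) ⊗ 1) = (Δ ⊗ id) Δ(1)` -/
  comul_one_right : ((1 : A) ⊗ₜ[k] comul 1) * TensorProduct.assoc k A A A (comul 1 ⊗ₜ[k] 1) =
    TensorProduct.assoc k A A A (comul.rTensor A (comul 1))
  /-- `ε(x y z) = ∑ ε(x y₁) ε(y₂ z)` -/
  counit_mul_left (x y z : A) : counit (x * y * z) = LinearMap.mul' k k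
    (TensorProduct.map (counit ∘ₗ LinearMap.mulLeft k x) (counit ∘ₗ LinearMap.mulRight k z)
      (comul y))
  /-- `ε(x y z) = ∑ ε(x y₂) ε(y₁ z)` -/
  counit_mul_right (x y z : A) : counit (x * y * z) = LinearMap.mul' k k
    (TensorProduct.map (counit ∘ₗ LinearMap.mulRight k z) (counit ∘ₗ LinearMap.mulLeft k x)
      (comul y))

namespace WeakBialgebra

variable (k A : Type u) [Field k] [Ring A] [Algebra k A]

local notation "Δ" => (CoalgebraStruct.comul (R := k) (A := A))
local notation "εε" => (CoalgebraStruct.counit (R := k) (A := A))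

/-- The category of all left modules over the `k`-algebra `A`. -/
def AMod (k A : Type u) [Field k] [Ring A] [Algebra k A] : Type (u + 1) := ModuleCat.{u} A

instance : Category (AMod k A) := inferInstanceAs (Category (ModuleCat.{u} A))
instance : Abelian (AMod k A) := inferInstanceAs (Abelian (ModuleCat.{u} A))
instance : Linear k (AMod k A) := inferInstanceAs (Linear k (ModuleCat.{u} A))
instance : HasColimitsOfSize.{u, u} (AMod k A) :=
  inferInstanceAs (HasColimitsOfSize.{u, u} (ModuleCat.{u} A))

end WeakBialgebra

section act

variable {k A : Type u} [Field k] [Ring A] [Algebra k A]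
variable {M N P : Type u} [AddCommGroup M] [AddCommGroup N] [Module k M] [Module k N]
  [Module A M] [Module A N] [IsScalarTower k A M] [IsScalarTower k A N]

variable (k A M N) in
/-- The action of `A ⊗ A` on `M ⊗ N` for two `A`-modules `M` and `N`. -/
def act₂ : A ⊗[k] A →ₐ[k] Module.End k (M ⊗[k] N) :=
  (Module.endTensorEndAlgHom (R := k) (S := k) (A := k) (M := M) (N := N)).comp
    (Algebra.TensorProduct.map (Algebra.lsmul k k M) (Algebra.lsmul k k N))

theorem act₂_tmul (a b : A) (m : M) (n : N) :
    act₂ k A M N (a ⊗ₜ b) (m ⊗ₜ n) = (a • m) ⊗ₜ (b • n) := rfl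

end act
namespace WeakBialgebra
variable {k A : Type u} [Field k] [Ring A] [Algebra k A] [WeakBialgebra k A]

local notation "Δ" => (CoalgebraStruct.comul (R := k) (A := A))
local notation "εε" => (CoalgebraStruct.counit (R := k) (A := A))

theorem comul_one_mul (a : A) : Δ 1 * Δ a = Δ a := by rw [← comul_mul, one_mul]
theorem comul_mul_one (a : A) : Δ a * Δ 1 = Δ a := by rw [← comul_mul, mul_one]

section tens
variable (M N : ModuleCat.{u} A)

variable (k) in
/-- `Δ(1) (M ⊗ N)`, as a subgroup of `M ⊗ N`. -/
def tensSub : AddSubgroup (M ⊗[k] N) :=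
  (LinearMap.range (act₂ k A M N (Δ 1))).toAddSubgroup

variable {M N} in
theorem mem_tensSub_iff (x : M ⊗[k] N) : x ∈ tensSub k M N ↔ act₂ k A M N (Δ 1) x = x := by
  constructor
  · rintro ⟨y, rfl⟩
    rw [← Module.End.mul_apply, ← map_mul, comul_one_mul]
  · intro h
    exact ⟨x, h⟩

instance : SMul A (tensSub k M N) where
  smul a x := ⟨act₂ k A M N (Δ a) x, ⟨act₂ k A M N (Δ a) x, by
    rw [← Module.End.mul_apply, ← map_mul, comul_one_mul]⟩⟩

theorem tens_smul_val (a : A) (x : tensSub k M N) :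
    ((a • x : tensSub k M N) : M ⊗[k] N) = act₂ k A M N (Δ a) x := rfl

instance : Module A (tensSub k M N) where
  one_smul x := Subtype.ext ((mem_tensSub_iff _).1 x.2)
  mul_smul a b x := Subtype.ext (by
    simp only [tens_smul_val, comul_mul, map_mul, Module.End.mul_apply])
  smul_zero a := Subtype.ext (by simp [tens_smul_val])
  smul_add a x y := Subtype.ext (by simp [tens_smul_val])
  add_smul a b x := Subtype.ext (by simp [tens_smul_val])
  zero_smul x := Subtype.ext (by simp [tens_smul_val])

variable (k) in
/-- The tensor product `Δ(1) (M ⊗ N)` of two left modules over a weak bialgebra. -/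
def tens : ModuleCat.{u} A := ModuleCat.of A (tensSub k M N)

variable (k) in
/-- The inclusion of `Δ(1) (M ⊗ N)` in `M ⊗ N`. -/
def inc : tens k M N →ₗ[k] M ⊗[k] N where
  toFun x := x.1
  map_add' _ _ := rfl
  map_smul' c x := by
    change act₂ k A M N (Δ (algebraMap k A c)) x.1 = c • x.1
    rw [Algebra.algebraMap_eq_smul_one, map_smul, map_smul, LinearMap.smul_apply,
      (mem_tensSub_iff _).1 x.2]

variable {M N}

theorem inc_injective : Function.Injective (inc k M N) := fun _ _ h => Subtype.ext h

theorem inc_smul (a : A) (x : tens k M N) :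
    inc k M N (a • x) = act₂ k A M N (Δ a) (inc k M N x) := rfl

variable (k M N) in
/-- The projection of `M ⊗ N` onto `Δ(1) (M ⊗ N)`. -/
def pr : M ⊗[k] N →ₗ[k] tens k M N where
  toFun x := (⟨act₂ k A M N (Δ 1) x, ⟨x, rfl⟩⟩ : tensSub k M N)
  map_add' _ _ := Subtype.ext (map_add _ _ _)
  map_smul' c x := inc_injective (k := k) (by
    refine Eq.trans ?_ (map_smul (inc k M N) c _).symm
    exact map_smul (act₂ k A M N (Δ 1)) c x)

theorem inc_pr (x : M ⊗[k] N) : inc k M N (pr k M N x) = act₂ k A M N (Δ 1) x := rfl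

theorem act₂_inc (x : tens k M N) : act₂ k A M N (Δ 1) (inc k M N x) = inc k M N x :=
  (mem_tensSub_iff _).1 x.2

theorem pr_inc (x : tens k M N) : pr k M N (inc k M N x) = x := Subtype.ext (act₂_inc x)

theorem pr_act₂ (a : A) (x : M ⊗[k] N) : pr k M N (act₂ k A M N (Δ a) x) = a • pr k M N x :=
  inc_injective (by
    rw [inc_smul, inc_pr, inc_pr, ← Module.End.mul_apply, ← Module.End.mul_apply,
      ← map_mul (act₂ k A M N), ← map_mul (act₂ k A M N), comul_one_mul, comul_mul_one])

end tens

/-- The underlying `k`-linear map of an `A`-linear map. -/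
def res {k A : Type u} [Field k] [Ring A] [Algebra k A] {M N : ModuleCat.{u} A} (f : M ⟶ N) : M →ₗ[k] N := f.hom.restrictScalars k

theorem res_apply {k A : Type u} [Field k] [Ring A] [Algebra k A] {M N : ModuleCat.{u} A} (f : M ⟶ N) (x : M) : res (k := k) f x = f x := rfl

theorem act₂_map {k A : Type u} [Field k] [Ring A] [Algebra k A] {M N M' N' : ModuleCat.{u} A} (f : M ⟶ M') (g : N ⟶ N') (z : A ⊗[k] A)
    (x : M ⊗[k] N) : act₂ k A M' N' z (TensorProduct.map (res f) (res g) x) =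
      TensorProduct.map (res f) (res g) (act₂ k A M N z x) := by
  induction z with
  | zero => simp
  | add z w hz hw => simp [hz, hw]
  | tmul a b =>
    induction x with
    | zero => simp
    | add x y hx hy => simp [hx, hy]
    | tmul m n => simp [act₂_tmul, res_apply]

/-- A `k`-linear map which commutes with the action of `A`, as a morphism of `A`-modules. -/
def homOfRes {k A : Type u} [Field k] [Ring A] [Algebra k A] {M N : ModuleCat.{u} A}
    (f : M →ₗ[k] N) (h : ∀ (a : A) (x : M), f (a • x) = a • f x) : M ⟶ N :=
  ModuleCat.ofHom { f with map_smul' := h }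

theorem res_homOfRes {k A : Type u} [Field k] [Ring A] [Algebra k A] {M N : ModuleCat.{u} A}
    (f : M →ₗ[k] N) (h : ∀ (a : A) (x : M), f (a • x) = a • f x) :
    res (homOfRes f h) = f := rfl

theorem res_comp {k A : Type u} [Field k] [Ring A] [Algebra k A] {M N P : ModuleCat.{u} A}
    (f : M ⟶ N) (g : N ⟶ P) : res (k := k) (f ≫ g) = res g ∘ₗ res f := rfl

theorem res_id {k A : Type u} [Field k] [Ring A] [Algebra k A] (M : ModuleCat.{u} A) :
    res (k := k) (𝟙 M) = LinearMap.id := rfl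

theorem res_injective {k A : Type u} [Field k] [Ring A] [Algebra k A] {M N : ModuleCat.{u} A}
    {f g : M ⟶ N} (h : res (k := k) f = res g) : f = g :=
  ModuleCat.hom_ext (LinearMap.ext fun x => LinearMap.congr_fun h x)

variable (k) in
/-- Functoriality of the tensor product of modules over a weak bialgebra. -/
def tensMap {M N M' N' : ModuleCat.{u} A} (f : M ⟶ M') (g : N ⟶ N') :
    tens k M N ⟶ tens k M' N' :=
  homOfRes (pr k M' N' ∘ₗ TensorProduct.map (res f) (res g) ∘ₗ inc k M N) (fun a x => by
    simp only [LinearMap.comp_apply]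
    rw [inc_smul, ← act₂_map, pr_act₂])

theorem inc_pr_comp {M N : ModuleCat.{u} A} :
    inc k M N ∘ₗ pr k M N = act₂ k A M N (Δ 1) := rfl

theorem pr_inc_comp {M N : ModuleCat.{u} A} : pr k M N ∘ₗ inc k M N = LinearMap.id :=
  LinearMap.ext pr_inc

theorem inc_tensMap {M N M' N' : ModuleCat.{u} A} (f : M ⟶ M') (g : N ⟶ N') :
    inc k M' N' ∘ₗ res (tensMap k f g) = TensorProduct.map (res f) (res g) ∘ₗ inc k M N := by
  ext x
  change act₂ k A _ _ (Δ 1) (TensorProduct.map (res f) (res g) (inc k M N x)) = _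
  rw [act₂_map, act₂_inc]
  rfl

theorem tensMap_pr {M N M' N' : ModuleCat.{u} A} (f : M ⟶ M') (g : N ⟶ N') :
    res (tensMap k f g) ∘ₗ pr k M N = pr k M' N' ∘ₗ TensorProduct.map (res f) (res g) := by
  refine LinearMap.ext fun x => inc_injective (k := k) ?_
  change act₂ k A _ _ (Δ 1) (TensorProduct.map (res f) (res g) (act₂ k A _ _ (Δ 1) x)) =
    act₂ k A _ _ (Δ 1) _
  rw [act₂_map, ← Module.End.mul_apply, ← map_mul, comul_one_mul]
  exact (act₂_map f g _ x).symm

/-- Cancellation of the inclusion `Δ(1) (M ⊗ N) → M ⊗ N`. -/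
theorem inc_cancel {M N : ModuleCat.{u} A} {V : Type*} [AddCommGroup V] [Module k V]
    {f g : V →ₗ[k] tens k M N} (h : inc k M N ∘ₗ f = inc k M N ∘ₗ g) : f = g :=
  LinearMap.ext fun x => inc_injective (LinearMap.congr_fun h x)

/-- `M ⊗ -` preserves cancellability of split inclusions. -/
theorem lTensor_inc_cancel {M N : ModuleCat.{u} A} {V W : Type*} [AddCommGroup V] [Module k V]
    [AddCommGroup W] [Module k W] {f g : V →ₗ[k] W ⊗[k] tens k M N}
    (h : (inc k M N).lTensor W ∘ₗ f = (inc k M N).lTensor W ∘ₗ g) : f = g := by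
  have := congrArg (fun φ => (pr k M N).lTensor W ∘ₗ φ) h
  simpa only [← LinearMap.comp_assoc, ← LinearMap.lTensor_comp, pr_inc_comp,
    LinearMap.lTensor_id, LinearMap.id_comp] using this

section assoc
variable (M N P : ModuleCat.{u} A)

variable (k) in
/-- The inclusion of `(M ⊗ N) ⊗ P` in the tensor product over `k`. -/
def incL : tens k (tens k M N) P →ₗ[k] (M ⊗[k] N) ⊗[k] P :=
  (inc k M N).rTensor P ∘ₗ inc k (tens k M N) P

variable (k) in
/-- The inclusion of `M ⊗ (N ⊗ P)` in the tensor product over `k`. -/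
def incR : tens k M (tens k N P) →ₗ[k] M ⊗[k] (N ⊗[k] P) :=
  (inc k N P).lTensor M ∘ₗ inc k M (tens k N P)

variable (k) in
/-- The projection onto `(M ⊗ N) ⊗ P` from the tensor product over `k`. -/
def prL : (M ⊗[k] N) ⊗[k] P →ₗ[k] tens k (tens k M N) P :=
  pr k (tens k M N) P ∘ₗ (pr k M N).rTensor P

variable (k) in
/-- The projection onto `M ⊗ (N ⊗ P)` from the tensor product over `k`. -/
def prR : M ⊗[k] (N ⊗[k] P) →ₗ[k] tens k M (tens k N P) :=
  pr k M (tens k N P) ∘ₗ (pr k N P).lTensor M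

variable (k) in
/-- The action of `(A ⊗ A) ⊗ A` on `(M ⊗ N) ⊗ P`. -/
def actL : (A ⊗[k] A) ⊗[k] A →ₐ[k] Module.End k ((M ⊗[k] N) ⊗[k] P) :=
  (Module.endTensorEndAlgHom (R := k) (S := k) (A := k) (M := M ⊗[k] N) (N := P)).comp
    (Algebra.TensorProduct.map (act₂ k A M N) (Algebra.lsmul k k P))

variable (k) in
/-- The action of `A ⊗ (A ⊗ A)` on `M ⊗ (N ⊗ P)`. -/
def actR : A ⊗[k] (A ⊗[k] A) →ₐ[k] Module.End k (M ⊗[k] (N ⊗[k] P)) :=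
  (Module.endTensorEndAlgHom (R := k) (S := k) (A := k) (M := M) (N := N ⊗[k] P)).comp
    (Algebra.TensorProduct.map (Algebra.lsmul k k M) (act₂ k A N P))

variable {M N P}

theorem actR_assoc (z : (A ⊗[k] A) ⊗[k] A) (x : (M ⊗[k] N) ⊗[k] P) :
    actR k M N P (TensorProduct.assoc k A A A z) (TensorProduct.assoc k M N P x) =
      TensorProduct.assoc k M N P (actL k M N P z x) := by
  suffices h : LinearMap.compl₁₂ (actR k M N P).toLinearMap
      (TensorProduct.assoc k A A A).toLinearMap (TensorProduct.assoc k M N P).toLinearMap =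
      (actL k M N P).toLinearMap.compr₂ (TensorProduct.assoc k M N P).toLinearMap from
    LinearMap.congr_fun₂ h z x
  ext
  rfl

theorem rTensor_inc_act₂ (z : A ⊗[k] A) (x : tens k M N ⊗[k] P) :
    (inc k M N).rTensor P (act₂ k A _ _ z x) =
      actL k M N P (CoalgebraStruct.comul.rTensor A z) ((inc k M N).rTensor P x) := by
  suffices h : (act₂ k A (tens k M N) P).toLinearMap.compr₂ ((inc k M N).rTensor P) =
      LinearMap.compl₁₂ (actL k M N P).toLinearMap (CoalgebraStruct.comul.rTensor A)
        ((inc k M N).rTensor P) from LinearMap.congr_fun₂ h z x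
  ext
  rfl

theorem lTensor_inc_act₂ (z : A ⊗[k] A) (x : M ⊗[k] tens k N P) :
    (inc k N P).lTensor M (act₂ k A _ _ z x) =
      actR k M N P (CoalgebraStruct.comul.lTensor A z) ((inc k N P).lTensor M x) := by
  suffices h : (act₂ k A M (tens k N P)).toLinearMap.compr₂ ((inc k N P).lTensor M) =
      LinearMap.compl₁₂ (actR k M N P).toLinearMap (CoalgebraStruct.comul.lTensor A)
        ((inc k N P).lTensor M) from LinearMap.congr_fun₂ h z x
  ext
  rfl

theorem incL_smul (a : A) (x : tens k (tens k M N) P) : incL k M N P (a • x) =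
    actL k M N P (CoalgebraStruct.comul.rTensor A (Δ a)) (incL k M N P x) := by
  simp only [incL, LinearMap.comp_apply]
  rw [inc_smul, rTensor_inc_act₂]

theorem incR_smul (a : A) (x : tens k M (tens k N P)) : incR k M N P (a • x) =
    actR k M N P (CoalgebraStruct.comul.lTensor A (Δ a)) (incR k M N P x) := by
  simp only [incR, LinearMap.comp_apply]
  rw [inc_smul, lTensor_inc_act₂]

theorem prL_incL (x : tens k (tens k M N) P) : prL k M N P (incL k M N P x) = x := by
  have : (pr k M N).rTensor P ∘ₗ (inc k M N).rTensor P = LinearMap.id := by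
    rw [← LinearMap.rTensor_comp, pr_inc_comp, LinearMap.rTensor_id]
  exact (congrArg (pr k _ _) (LinearMap.congr_fun this _)).trans (pr_inc x)

theorem prR_incR (x : tens k M (tens k N P)) : prR k M N P (incR k M N P x) = x := by
  have : (pr k N P).lTensor M ∘ₗ (inc k N P).lTensor M = LinearMap.id := by
    rw [← LinearMap.lTensor_comp, pr_inc_comp, LinearMap.lTensor_id]
  exact (congrArg (pr k _ _) (LinearMap.congr_fun this _)).trans (pr_inc x)

theorem incL_injective : Function.Injective (incL k M N P) :=
  Function.LeftInverse.injective prL_incL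

theorem incR_injective : Function.Injective (incR k M N P) :=
  Function.LeftInverse.injective prR_incR

theorem comul_one_left' : CoalgebraStruct.comul.rTensor A (Δ 1) * (Δ 1 ⊗ₜ[k] (1 : A)) =
    CoalgebraStruct.comul.rTensor A (Δ 1) := by
  suffices h : ∀ z : A ⊗[k] A, CoalgebraStruct.comul.rTensor A z * (Δ 1 ⊗ₜ[k] (1 : A)) =
    CoalgebraStruct.comul.rTensor A z from h _
  intro z
  induction z with
  | zero => simp
  | add x y hx hy => rw [map_add, add_mul, hx, hy]
  | tmul a b => simp [Algebra.TensorProduct.tmul_mul_tmul, comul_mul_one]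

theorem comul_one_right' : CoalgebraStruct.comul.lTensor A (Δ 1) * ((1 : A) ⊗ₜ[k] Δ 1) =
    CoalgebraStruct.comul.lTensor A (Δ 1) := by
  suffices h : ∀ z : A ⊗[k] A, CoalgebraStruct.comul.lTensor A z * ((1 : A) ⊗ₜ[k] Δ 1) =
    CoalgebraStruct.comul.lTensor A z from h _
  intro z
  induction z with
  | zero => simp
  | add x y hx hy => rw [map_add, add_mul, hx, hy]
  | tmul a b => simp [Algebra.TensorProduct.tmul_mul_tmul, comul_mul_one]

theorem incL_prL (x : (M ⊗[k] N) ⊗[k] P) : incL k M N P (prL k M N P x) =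
    actL k M N P (CoalgebraStruct.comul.rTensor A (Δ 1)) x := by
  have h : (inc k M N).rTensor P ((pr k M N).rTensor P x) =
      actL k M N P (Δ 1 ⊗ₜ[k] (1 : A)) x := by
    rw [← LinearMap.rTensor_comp_apply, inc_pr_comp]
    suffices h : (act₂ k A M N (Δ 1)).rTensor P = actL k M N P (Δ 1 ⊗ₜ[k] (1 : A)) from
      LinearMap.congr_fun h x
    ext m n p
    change _ = (act₂ k A M N (Δ 1) (m ⊗ₜ n)) ⊗ₜ ((1 : A) • p)
    rw [one_smul]
    rfl
  simp only [incL, prL, LinearMap.comp_apply]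
  rw [inc_pr, rTensor_inc_act₂, h, ← Module.End.mul_apply, ← map_mul, comul_one_left']

theorem incR_prR (x : M ⊗[k] (N ⊗[k] P)) : incR k M N P (prR k M N P x) =
    actR k M N P (CoalgebraStruct.comul.lTensor A (Δ 1)) x := by
  have h : (inc k N P).lTensor M ((pr k N P).lTensor M x) =
      actR k M N P ((1 : A) ⊗ₜ[k] Δ 1) x := by
    rw [← LinearMap.lTensor_comp_apply, inc_pr_comp]
    suffices h : (act₂ k A N P (Δ 1)).lTensor M = actR k M N P ((1 : A) ⊗ₜ[k] Δ 1) from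
      LinearMap.congr_fun h x
    ext m n p
    change _ = ((1 : A) • m) ⊗ₜ (act₂ k A N P (Δ 1) (n ⊗ₜ p))
    rw [one_smul]
    rfl
  simp only [incR, prR, LinearMap.comp_apply]
  rw [inc_pr, lTensor_inc_act₂, h, ← Module.End.mul_apply, ← map_mul, comul_one_right']

variable (M N P)

variable (k) in
/-- The underlying linear map of the associator. -/
def assocHom : tens k (tens k M N) P →ₗ[k] tens k M (tens k N P) :=
  prR k M N P ∘ₗ (TensorProduct.assoc k M N P).toLinearMap ∘ₗ incL k M N P

variable (k) in
/-- The underlying linear map of the inverse of the associator. -/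
def assocInv : tens k M (tens k N P) →ₗ[k] tens k (tens k M N) P :=
  prL k M N P ∘ₗ (TensorProduct.assoc k M N P).symm.toLinearMap ∘ₗ incR k M N P

variable {M N P}

theorem incR_assocHom (x : tens k (tens k M N) P) : incR k M N P (assocHom k M N P x) =
    TensorProduct.assoc k M N P (incL k M N P x) := by
  simp only [assocHom, LinearMap.comp_apply, LinearEquiv.coe_coe]
  rw [incR_prR, ← Coalgebra.coassoc_apply, actR_assoc, ← incL_smul, one_smul]

theorem incL_assocInv (x : tens k M (tens k N P)) : TensorProduct.assoc k M N P
    (incL k M N P (assocInv k M N P x)) = incR k M N P x := by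
  simp only [assocInv, LinearMap.comp_apply, LinearEquiv.coe_coe]
  rw [incL_prL, ← actR_assoc, Coalgebra.coassoc_apply, LinearEquiv.apply_symm_apply,
    ← incR_smul, one_smul]

variable (M N P)

variable (k) in
/-- The associator of the tensor product of modules over a weak bialgebra. -/
def tensAssoc : tens k (tens k M N) P ≅ tens k M (tens k N P) where
  hom := homOfRes (assocHom k M N P) (fun a x => incR_injective (k := k) (by
    rw [incR_assocHom, incL_smul, incR_smul, incR_assocHom, ← actR_assoc,
      Coalgebra.coassoc_apply]))
  inv := homOfRes (assocInv k M N P) (fun a x => incL_injective (k := k)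
    ((TensorProduct.assoc k M N P).injective (by
    rw [incL_assocInv, incL_smul, incR_smul, ← actR_assoc, incL_assocInv,
      Coalgebra.coassoc_apply])))
  hom_inv_id := res_injective (k := k) (LinearMap.ext fun x => incL_injective (k := k)
    ((TensorProduct.assoc k M N P).injective (by
      rw [res_comp, res_homOfRes, res_homOfRes, LinearMap.comp_apply, incL_assocInv,
        incR_assocHom]
      rfl)))
  inv_hom_id := res_injective (k := k) (LinearMap.ext fun x => incR_injective (k := k) (by
      rw [res_comp, res_homOfRes, res_homOfRes, LinearMap.comp_apply, incR_assocHom,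
        incL_assocInv]
      rfl))

variable {M N P}

theorem inc_tensAssoc : (inc k N P).lTensor M ∘ₗ inc k M (tens k N P) ∘ₗ
    res (tensAssoc k M N P).hom = (TensorProduct.assoc k M N P).toLinearMap ∘ₗ
      (inc k M N).rTensor P ∘ₗ inc k (tens k M N) P :=
  LinearMap.ext incR_assocHom

end assoc

end WeakBialgebra

namespace WeakBialgebra

variable {k A : Type u} [Field k] [Ring A] [Algebra k A] [WeakBialgebra k A]

local notation "Δ" => (CoalgebraStruct.comul (R := k) (A := A))
local notation "εε" => (CoalgebraStruct.counit (R := k) (A := A))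

section unit

variable (k) in
/-- `a ⊗ b ↦ ε(x a) b` -/
def contrL (x : A) : A ⊗[k] A →ₗ[k] A :=
  (TensorProduct.lid k A).toLinearMap ∘ₗ (εε ∘ₗ LinearMap.mulLeft k x).rTensor A

variable (k) in
/-- `a ⊗ b ↦ ε(x b) a` -/
def contrR (x : A) : A ⊗[k] A →ₗ[k] A :=
  (TensorProduct.rid k A).toLinearMap ∘ₗ (εε ∘ₗ LinearMap.mulLeft k x).lTensor A

theorem contrL_tmul (x a b : A) : contrL k x (a ⊗ₜ b) = εε (x * a) • b := by simp [contrL]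
theorem contrR_tmul (x a b : A) : contrR k x (a ⊗ₜ b) = εε (x * b) • a := by simp [contrR]

theorem contrL_one_comul (a : A) : contrL k 1 (Δ a) = a := by
  have h : contrL k (1 : A) = (TensorProduct.lid k A).toLinearMap ∘ₗ LinearMap.rTensor A εε := by
    ext; simp [contrL_tmul]
  rw [h, LinearMap.comp_apply, Coalgebra.rTensor_counit_comul]
  simp

theorem contrR_one_comul (a : A) : contrR k 1 (Δ a) = a := by
  have h : contrR k (1 : A) = (TensorProduct.rid k A).toLinearMap ∘ₗ LinearMap.lTensor A εε := by
    ext; simp [contrR_tmul]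
  rw [h, LinearMap.comp_apply, Coalgebra.lTensor_counit_comul]
  simp

theorem contrL_comul (x a : A) : contrL k x (Δ a) = contrL k x (Δ 1) * a := by
  let Ψ (w : A ⊗[k] A) : A ⊗[k] (A ⊗[k] A) →ₗ[k] A :=
    (TensorProduct.lid k A).toLinearMap ∘ₗ TensorProduct.map (εε ∘ₗ LinearMap.mulLeft k x)
      (contrL k 1 ∘ₗ LinearMap.mulRight k w)
  have hΨ (w : A ⊗[k] A) (a : A) (y : A ⊗[k] A) :
      Ψ w (a ⊗ₜ y) = εε (x * a) • contrL k 1 (y * w) := by simp [Ψ]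
  have hadd (w w' : A ⊗[k] A) : Ψ (w + w') = Ψ w + Ψ w' := by
    ext; simp [hΨ, mul_add]
  have h₁ (z : A ⊗[k] A) : Ψ (Δ a) (LinearMap.lTensor A Δ z) = contrL k x z * a := by
    induction z with
    | zero => simp
    | add z z' hz hz' => simp only [map_add, hz, hz', add_mul]
    | tmul u v => rw [LinearMap.lTensor_tmul, hΨ, ← comul_mul, contrL_one_comul, contrL_tmul,
        smul_mul_assoc]
  have h₂ (t : A ⊗[k] A) (v p q : A) : Ψ (p ⊗ₜ q) (TensorProduct.assoc k A A A (t ⊗ₜ v)) =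
      LinearMap.mul' k k (TensorProduct.map (εε ∘ₗ LinearMap.mulLeft k x)
        (εε ∘ₗ LinearMap.mulRight k p) t) • (v * q) := by
    induction t with
    | zero => simp
    | add z z' hz hz' => simp only [TensorProduct.add_tmul, map_add, hz, hz', add_smul]
    | tmul u v => simp [hΨ, contrL_tmul, smul_smul]
  have h₃ (z w : A ⊗[k] A) : Ψ w (TensorProduct.assoc k A A A (LinearMap.rTensor A Δ z)) =
      contrL k x (z * w) := by
    induction z with
    | zero => simp
    | add z z' hz hz' => simp only [map_add, hz, hz', add_mul]
    | tmul u v =>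
      induction w with
      | zero => simp [Ψ]
      | add z z' hz hz' => simp only [map_add, hz, hz', mul_add, hadd, LinearMap.add_apply]
      | tmul p q => rw [LinearMap.rTensor_tmul, h₂, ← counit_mul_left,
          Algebra.TensorProduct.tmul_mul_tmul, contrL_tmul, mul_assoc]
  rw [← h₁, ← Coalgebra.coassoc_apply, h₃, comul_one_mul]

theorem contrR_comul (x a : A) : contrR k x (Δ a) = contrR k x (Δ 1) * a := by
  let Ψ (w : A ⊗[k] A) : (A ⊗[k] A) ⊗[k] A →ₗ[k] A :=
    (TensorProduct.rid k A).toLinearMap ∘ₗ TensorProduct.map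
      (contrR k 1 ∘ₗ LinearMap.mulRight k w) (εε ∘ₗ LinearMap.mulLeft k x)
  have hΨ (w : A ⊗[k] A) (a : A) (y : A ⊗[k] A) :
      Ψ w (y ⊗ₜ a) = εε (x * a) • contrR k 1 (y * w) := by simp [Ψ]
  have hadd (w w' : A ⊗[k] A) : Ψ (w + w') = Ψ w + Ψ w' := by
    ext; simp [hΨ, mul_add]
  have h₁ (z : A ⊗[k] A) : Ψ (Δ a) (LinearMap.rTensor A Δ z) = contrR k x z * a := by
    induction z with
    | zero => simp
    | add z z' hz hz' => simp only [map_add, hz, hz', add_mul]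
    | tmul u v => rw [LinearMap.rTensor_tmul, hΨ, ← comul_mul, contrR_one_comul, contrR_tmul,
        smul_mul_assoc]
  have h₂ (t : A ⊗[k] A) (v p q : A) :
      Ψ (p ⊗ₜ q) ((TensorProduct.assoc k A A A).symm (v ⊗ₜ t)) =
      LinearMap.mul' k k (TensorProduct.map (εε ∘ₗ LinearMap.mulRight k q)
        (εε ∘ₗ LinearMap.mulLeft k x) t) • (v * p) := by
    induction t with
    | zero => simp
    | add z z' hz hz' => simp only [TensorProduct.tmul_add, map_add, hz, hz', add_smul]
    | tmul u v => simp [hΨ, contrR_tmul, smul_smul, mul_comm]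
  have h₃ (z w : A ⊗[k] A) : Ψ w ((TensorProduct.assoc k A A A).symm (LinearMap.lTensor A Δ z)) =
      contrR k x (z * w) := by
    induction z with
    | zero => simp
    | add z z' hz hz' => simp only [map_add, hz, hz', add_mul]
    | tmul u v =>
      induction w with
      | zero => simp [Ψ]
      | add z z' hz hz' => simp only [map_add, hz, hz', mul_add, hadd, LinearMap.add_apply]
      | tmul p q => rw [LinearMap.lTensor_tmul, h₂, ← counit_mul_right,
          Algebra.TensorProduct.tmul_mul_tmul, contrR_tmul, mul_assoc]
  rw [← h₁, ← Coalgebra.coassoc_symm_apply, h₃, comul_one_mul]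

variable (k) in
/-- The functional `x ↦ ε(x a)` attached to `a`. -/
def counitFun : A →ₗ[k] Module.Dual k A := (LinearMap.mul k A).flip.compr₂ εε

theorem counitFun_apply (a x : A) : counitFun k a x = εε (x * a) := rfl

variable (k A) in
/-- The left ideal of all `a` such that `ε(x a) = 0` for all `x`. -/
def unitIdeal : Submodule A A where
  carrier := {a | counitFun k a = 0}
  zero_mem' := map_zero _
  add_mem' {a b} ha hb := by
    simp only [Set.mem_ofPred_eq] at *
    rw [map_add, ha, hb, add_zero]
  smul_mem' c x hx := LinearMap.ext fun y => by
    have := LinearMap.congr_fun hx (y * c)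
    rwa [counitFun_apply, mul_assoc] at this

variable (k A) in
/-- The unit object of the category of modules over a weak bialgebra `A`: the quotient of `A` by the
left ideal of all `a` such that `ε(x a) = 0` for all `x`. This ideal is the kernel of the target
counital map `a ↦ ε(1₁ a) 1₂`, so this is the target counital subalgebra with
`a` acting by `z ↦ ε(1₁ a z) 1₂`. -/
def unitObj : ModuleCat.{u} A := ModuleCat.of A (A ⧸ unitIdeal k A)

variable (k A) in
/-- The projection of `A` onto the unit object. -/
def unitProj : A →ₗ[k] unitObj k A where
  toFun a := (unitIdeal k A).mkQ a
  map_add' _ _ := map_add _ _ _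
  map_smul' c a := by
    rw [Algebra.smul_def]
    exact map_smul (unitIdeal k A).mkQ (algebraMap k A c) a

theorem unitProj_mul (a b : A) : unitProj k A (a * b) = a • unitProj k A b := rfl

theorem unitProj_surjective : Function.Surjective (unitProj k A) :=
  (unitIdeal k A).mkQ_surjective

theorem unitProj_eq {a b : A} (h : counitFun k a = counitFun k b) :
    unitProj k A a = unitProj k A b :=
  (Submodule.Quotient.eq _).2 (show counitFun k (a - b) = 0 by rw [map_sub, h, sub_self])

variable (k A) in
/-- The functional on `A` given by an element of the unit object. -/
def unitFun : unitObj k A →ₗ[k] Module.Dual k A where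
  toFun := (QuotientAddGroup.lift (unitIdeal k A).toAddSubgroup (counitFun k).toAddMonoidHom
    (fun _ h => h))
  map_add' := map_add _
  map_smul' c z := by
    obtain ⟨a, rfl⟩ := unitProj_surjective z
    rw [← map_smul]
    exact map_smul (counitFun k) c a

theorem unitFun_unitProj (a : A) : unitFun k A (unitProj k A a) = counitFun k a := rfl

variable (k A) in
/-- The target counital map, as a map on the unit object. -/
def unitT : unitObj k A →ₗ[k] A where
  toFun z := TensorProduct.lid k A ((unitFun k A z).rTensor A (Δ 1))
  map_add' z w := by simp [LinearMap.rTensor_add]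
  map_smul' c z := by
    rw [map_smul, LinearMap.rTensor_smul, LinearMap.smul_apply, map_smul, RingHom.id_apply]

variable (k A) in
/-- The map `a ↦ 1₁ ε(1₂ a)`, as a map on the unit object. -/
def unitS : unitObj k A →ₗ[k] A where
  toFun z := TensorProduct.rid k A ((unitFun k A z).lTensor A (Δ 1))
  map_add' z w := by simp [LinearMap.lTensor_add]
  map_smul' c z := by
    rw [map_smul, LinearMap.lTensor_smul, LinearMap.smul_apply, map_smul, RingHom.id_apply]

theorem unitT_unitProj (a : A) : unitT k A (unitProj k A a) =
    TensorProduct.lid k A ((counitFun k a).rTensor A (Δ 1)) := rfl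

theorem unitS_unitProj (a : A) : unitS k A (unitProj k A a) =
    TensorProduct.rid k A ((counitFun k a).lTensor A (Δ 1)) := rfl

theorem counit_mul_unitT (x a : A) : εε (x * unitT k A (unitProj k A a)) = εε (x * a) := by
  have h (t : A ⊗[k] A) : LinearMap.mul' k k (TensorProduct.map (εε ∘ₗ LinearMap.mulRight k a)
      (εε ∘ₗ LinearMap.mulLeft k x) t) =
        εε (x * TensorProduct.lid k A ((counitFun k a).rTensor A t)) := by
    induction t with
    | zero => simp
    | add z z' hz hz' => simp only [map_add, hz, hz', mul_add]
    | tmul u v => simp [counitFun_apply]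
  rw [unitT_unitProj, ← h, ← counit_mul_right, mul_one]

theorem counit_mul_unitS (x a : A) : εε (x * unitS k A (unitProj k A a)) = εε (x * a) := by
  have h (t : A ⊗[k] A) : LinearMap.mul' k k (TensorProduct.map (εε ∘ₗ LinearMap.mulLeft k x)
      (εε ∘ₗ LinearMap.mulRight k a) t) =
        εε (x * TensorProduct.rid k A ((counitFun k a).lTensor A t)) := by
    induction t with
    | zero => simp
    | add z z' hz hz' => simp only [map_add, hz, hz', mul_add]
    | tmul u v => simp [counitFun_apply, mul_comm]
  rw [unitS_unitProj, ← h, ← counit_mul_left, mul_one]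

theorem unitProj_unitT (a : A) :
    unitProj k A (unitT k A (unitProj k A a)) = unitProj k A a :=
  unitProj_eq (LinearMap.ext fun x => counit_mul_unitT x a)

theorem comul_unitT (a : A) : Δ (unitT k A (unitProj k A a)) =
    Δ 1 * (unitT k A (unitProj k A a) ⊗ₜ 1) := by
  have h₁ (t : A ⊗[k] A) : Δ (TensorProduct.lid k A ((counitFun k a).rTensor A t)) =
      TensorProduct.lid k (A ⊗[k] A) ((counitFun k a).rTensor _ (LinearMap.lTensor A Δ t)) := by
    induction t with
    | zero => simp
    | add z z' hz hz' => simp only [map_add, hz, hz']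
    | tmul u v => simp
  have h₂ (w t : A ⊗[k] A) : TensorProduct.lid k (A ⊗[k] A) ((counitFun k a).rTensor _
      (((1 : A) ⊗ₜ[k] w) * TensorProduct.assoc k A A A (t ⊗ₜ[k] 1))) =
      w * (TensorProduct.lid k A ((counitFun k a).rTensor A t) ⊗ₜ 1) := by
    induction t with
    | zero => simp
    | add z z' hz hz' => simp only [map_add, hz, hz', mul_add, TensorProduct.add_tmul]
    | tmul u v => simp [← TensorProduct.smul_tmul']
  rw [unitT_unitProj, h₁, ← Coalgebra.coassoc_apply, ← comul_one_right, h₂]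

theorem comul_unitS (a : A) : Δ (unitS k A (unitProj k A a)) =
    Δ 1 * (1 ⊗ₜ unitS k A (unitProj k A a)) := by
  have h₁ (t : A ⊗[k] A) : Δ (TensorProduct.rid k A ((counitFun k a).lTensor A t)) =
      TensorProduct.rid k (A ⊗[k] A) ((counitFun k a).lTensor _ (LinearMap.rTensor A Δ t)) := by
    induction t with
    | zero => simp
    | add z z' hz hz' => simp only [map_add, hz, hz']
    | tmul u v => simp
  have h₂ (w t : A ⊗[k] A) : TensorProduct.rid k (A ⊗[k] A) ((counitFun k a).lTensor _
      ((TensorProduct.assoc k A A A).symm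
        (TensorProduct.assoc k A A A (w ⊗ₜ[k] 1) * ((1 : A) ⊗ₜ[k] t)))) =
      w * (1 ⊗ₜ TensorProduct.rid k A ((counitFun k a).lTensor A t)) := by
    induction t with
    | zero => simp
    | add z z' hz hz' => simp only [map_add, hz, hz', mul_add, TensorProduct.tmul_add]
    | tmul u v =>
      induction w with
      | zero => simp
      | add z z' hz hz' => simp only [map_add, hz, hz', add_mul, TensorProduct.add_tmul]
      | tmul p q => simp
  rw [unitS_unitProj, h₁, ← h₂, comul_one_left, LinearEquiv.symm_apply_apply]

/-- Two elements of `A ⊗ A` agree modulo the ideal in the first factor if all contractions agree. -/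
theorem unitProj_rTensor_eq {w w' : A ⊗[k] A} (h : ∀ x, contrL k x w = contrL k x w') :
    (unitProj k A).rTensor A w = (unitProj k A).rTensor A w' := by
  obtain ⟨s, hs⟩ := TensorProduct.exists_finset (Δ 1)
  have key (w : A ⊗[k] A) : (unitProj k A).rTensor A w =
      ∑ i ∈ s, unitProj k A i.2 ⊗ₜ contrL k i.1 w := by
    induction w with
    | zero => simp
    | add z z' hz hz' => simp only [map_add, hz, hz', TensorProduct.tmul_add,
        Finset.sum_add_distrib]
    | tmul a b =>
      rw [LinearMap.rTensor_tmul, ← unitProj_unitT, unitT_unitProj, hs]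
      simp [contrL_tmul, TensorProduct.sum_tmul, counitFun_apply, TensorProduct.smul_tmul]
  simp only [key, h]

/-- Two elements of `A ⊗ A` agree modulo the ideal in the second factor if all contractions
agree. -/
theorem unitProj_lTensor_eq {w w' : A ⊗[k] A} (h : ∀ x, contrR k x w = contrR k x w') :
    (unitProj k A).lTensor A w = (unitProj k A).lTensor A w' := by
  obtain ⟨s, hs⟩ := TensorProduct.exists_finset (Δ 1)
  have key (w : A ⊗[k] A) : (unitProj k A).lTensor A w =
      ∑ i ∈ s, contrR k i.1 w ⊗ₜ unitProj k A i.2 := by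
    induction w with
    | zero => simp
    | add z z' hz hz' => simp only [map_add, hz, hz', TensorProduct.add_tmul,
        Finset.sum_add_distrib]
    | tmul a b =>
      rw [LinearMap.lTensor_tmul, ← unitProj_unitT, unitT_unitProj, hs]
      simp [contrR_tmul, TensorProduct.tmul_sum, counitFun_apply, TensorProduct.smul_tmul]
  simp only [key, h]

theorem contrL_mul_right (x a : A) (w : A ⊗[k] A) :
    contrL k x (w * (1 ⊗ₜ a)) = contrL k x w * a := by
  induction w with
  | zero => simp
  | add z z' hz hz' => simp only [map_add, hz, hz', add_mul]
  | tmul u v => simp [contrL_tmul]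

theorem contrR_mul_left (x a : A) (w : A ⊗[k] A) :
    contrR k x (w * (a ⊗ₜ 1)) = contrR k x w * a := by
  induction w with
  | zero => simp
  | add z z' hz hz' => simp only [map_add, hz, hz', add_mul]
  | tmul u v => simp [contrR_tmul]

theorem contrL_mul_left (x a : A) (w : A ⊗[k] A) :
    contrL k x (w * (unitT k A (unitProj k A a) ⊗ₜ 1)) = contrL k x (w * (a ⊗ₜ 1)) := by
  induction w with
  | zero => simp
  | add z z' hz hz' => simp only [map_add, hz, hz', add_mul]
  | tmul u v => simp [contrL_tmul, ← mul_assoc, counit_mul_unitT]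

theorem contrR_mul_right (x a : A) (w : A ⊗[k] A) :
    contrR k x (w * (1 ⊗ₜ unitS k A (unitProj k A a))) = contrR k x (w * (1 ⊗ₜ a)) := by
  induction w with
  | zero => simp
  | add z z' hz hz' => simp only [map_add, hz, hz', add_mul]
  | tmul u v => simp [contrR_tmul, ← mul_assoc, counit_mul_unitS]

theorem rTensor_comul (a : A) : (unitProj k A).rTensor A (Δ 1 * (1 ⊗ₜ a)) =
    (unitProj k A).rTensor A (Δ a) :=
  unitProj_rTensor_eq fun x => by rw [contrL_mul_right, contrL_comul x a]

theorem lTensor_comul (a : A) : (unitProj k A).lTensor A (Δ 1 * (a ⊗ₜ 1)) =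
    (unitProj k A).lTensor A (Δ a) :=
  unitProj_lTensor_eq fun x => by rw [contrR_mul_left, contrR_comul x a]

theorem rTensor_unitT (a : A) : (unitProj k A).rTensor A (Δ 1 * (a ⊗ₜ 1)) =
    (unitProj k A).rTensor A (Δ 1 * (1 ⊗ₜ unitT k A (unitProj k A a))) :=
  unitProj_rTensor_eq fun x => by
    rw [contrL_mul_right, ← contrL_comul, comul_unitT, contrL_mul_left]

theorem lTensor_unitS (a : A) : (unitProj k A).lTensor A (Δ 1 * (1 ⊗ₜ a)) =
    (unitProj k A).lTensor A (Δ 1 * (unitS k A (unitProj k A a) ⊗ₜ 1)) :=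
  unitProj_lTensor_eq fun x => by
    rw [contrR_mul_left, ← contrR_comul, comul_unitS, contrR_mul_right]

variable (M : ModuleCat.{u} A)

theorem act₂_unit_left (w : A ⊗[k] A) (a : A) (m : M) :
    act₂ k A (unitObj k A) M w (unitProj k A a ⊗ₜ m) =
      LinearMap.lTensor _ ((LinearMap.toSpanSingleton A M m).restrictScalars k)
        ((unitProj k A).rTensor A (w * (a ⊗ₜ 1))) := by
  induction w with
  | zero => simp
  | add z z' hz hz' => simp only [map_add, hz, hz', add_mul, LinearMap.add_apply]
  | tmul u v => simp [act₂_tmul, unitProj_mul]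

theorem act₂_unit_right (w : A ⊗[k] A) (a : A) (m : M) :
    act₂ k A M (unitObj k A) w (m ⊗ₜ unitProj k A a) =
      LinearMap.rTensor _ ((LinearMap.toSpanSingleton A M m).restrictScalars k)
        ((unitProj k A).lTensor A (w * (1 ⊗ₜ a))) := by
  induction w with
  | zero => simp
  | add z z' hz hz' => simp only [map_add, hz, hz', add_mul, LinearMap.add_apply]
  | tmul u v => simp [act₂_tmul, unitProj_mul]

theorem act₂_unit_left_smul (w : A ⊗[k] A) (b : A) (m : M) :
    act₂ k A (unitObj k A) M w (unitProj k A 1 ⊗ₜ (b • m)) =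
      act₂ k A (unitObj k A) M (w * (1 ⊗ₜ b)) (unitProj k A 1 ⊗ₜ m) := by
  rw [map_mul, Module.End.mul_apply, act₂_tmul, one_smul]

theorem act₂_unit_right_smul (w : A ⊗[k] A) (b : A) (m : M) :
    act₂ k A M (unitObj k A) w ((b • m) ⊗ₜ unitProj k A 1) =
      act₂ k A M (unitObj k A) (w * (b ⊗ₜ 1)) (m ⊗ₜ unitProj k A 1) := by
  rw [map_mul, Module.End.mul_apply, act₂_tmul, one_smul]

theorem act₂_unit_left_comul (b : A) (m : M) :
    act₂ k A (unitObj k A) M (Δ 1) (unitProj k A 1 ⊗ₜ (b • m)) =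
      act₂ k A (unitObj k A) M (Δ b) (unitProj k A 1 ⊗ₜ m) := by
  rw [act₂_unit_left_smul, act₂_unit_left, act₂_unit_left, ← Algebra.TensorProduct.one_def,
    mul_one, mul_one, rTensor_comul]

theorem act₂_unit_right_comul (b : A) (m : M) :
    act₂ k A M (unitObj k A) (Δ 1) ((b • m) ⊗ₜ unitProj k A 1) =
      act₂ k A M (unitObj k A) (Δ b) (m ⊗ₜ unitProj k A 1) := by
  rw [act₂_unit_right_smul, act₂_unit_right, act₂_unit_right, ← Algebra.TensorProduct.one_def,
    mul_one, mul_one, lTensor_comul]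

variable (k) in
/-- The inverse of the left unitor. -/
def leftUnitInv : M ⟶ tens k (unitObj k A) M :=
  homOfRes (pr k (unitObj k A) M ∘ₗ TensorProduct.mk k _ _ (unitProj k A 1)) (fun a m => by
    simp only [LinearMap.comp_apply, TensorProduct.mk_apply]
    rw [← pr_act₂, ← act₂_unit_left_comul]
    exact inc_injective (k := k) (act₂_inc _).symm)

variable (k) in
/-- The inverse of the right unitor. -/
def rightUnitInv : M ⟶ tens k M (unitObj k A) :=
  homOfRes (pr k M (unitObj k A) ∘ₗ (TensorProduct.mk k _ _).flip (unitProj k A 1)) (fun a m => by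
    simp only [LinearMap.comp_apply, TensorProduct.mk_apply, LinearMap.flip_apply]
    rw [← pr_act₂, ← act₂_unit_right_comul]
    exact inc_injective (k := k) (act₂_inc _).symm)

variable (k) in
/-- `[a] ⊗ m ↦ ε(1₁ a) 1₂ m` -/
def leftUnitAux : unitObj k A ⊗[k] M →ₗ[k] M :=
  TensorProduct.lift ((Algebra.lsmul k k M).toLinearMap ∘ₗ unitT k A)

variable (k) in
/-- `m ⊗ [a] ↦ ε(1₂ a) 1₁ m` -/
def rightUnitAux : M ⊗[k] unitObj k A →ₗ[k] M :=
  TensorProduct.lift ((Algebra.lsmul k k M).toLinearMap ∘ₗ unitS k A).flip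

theorem leftUnitAux_act₂ (w : A ⊗[k] A) (m : M) :
    leftUnitAux k M (act₂ k A (unitObj k A) M w (unitProj k A 1 ⊗ₜ m)) =
      contrL k 1 (Δ 1 * w) • m := by
  have h (t : A ⊗[k] A) (a b : A) : TensorProduct.lid k A ((counitFun k a).rTensor A t) * b =
      contrL k 1 (t * (a ⊗ₜ b)) := by
    induction t with
    | zero => simp
    | add z z' hz hz' => simp only [map_add, hz, hz', add_mul]
    | tmul p q => simp [contrL_tmul, counitFun_apply]
  induction w with
  | zero => simp
  | add z z' hz hz' => simp only [map_add, hz, hz', mul_add, LinearMap.add_apply, add_smul]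
  | tmul a b =>
    rw [act₂_tmul, ← unitProj_mul, mul_one, ← h, ← unitT_unitProj, mul_smul]
    rfl

theorem rightUnitAux_act₂ (w : A ⊗[k] A) (m : M) :
    rightUnitAux k M (act₂ k A M (unitObj k A) w (m ⊗ₜ unitProj k A 1)) =
      contrR k 1 (Δ 1 * w) • m := by
  have h (t : A ⊗[k] A) (a b : A) : TensorProduct.rid k A ((counitFun k b).lTensor A t) * a =
      contrR k 1 (t * (a ⊗ₜ b)) := by
    induction t with
    | zero => simp
    | add z z' hz hz' => simp only [map_add, hz, hz', add_mul]
    | tmul p q => simp [contrR_tmul, counitFun_apply]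
  induction w with
  | zero => simp
  | add z z' hz hz' => simp only [map_add, hz, hz', mul_add, LinearMap.add_apply, add_smul]
  | tmul a b =>
    rw [act₂_tmul, ← unitProj_mul, mul_one, ← h, ← unitS_unitProj, mul_smul]
    rfl

theorem leftUnitInv_bijective : Function.Bijective (leftUnitInv k M) := by
  have h : Function.LeftInverse (leftUnitAux k M ∘ inc k _ _) (leftUnitInv k M) := fun m => by
    change leftUnitAux k M (act₂ k A (unitObj k A) M (Δ 1) (unitProj k A 1 ⊗ₜ m)) = m
    rw [leftUnitAux_act₂, comul_one_mul, contrL_one_comul, one_smul]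
  refine ⟨h.injective, fun x => ?_⟩
  rw [← pr_inc x]
  induction inc k _ _ x with
  | zero => exact ⟨0, (map_zero (leftUnitInv k M).hom).trans (map_zero (pr k _ _)).symm⟩
  | add y z hy hz =>
    obtain ⟨m, hm⟩ := hy
    obtain ⟨n, hn⟩ := hz
    exact ⟨m + n, (map_add (leftUnitInv k M).hom m n).trans
      ((congrArg₂ (· + ·) hm hn).trans (map_add (pr k _ _) y z).symm)⟩
  | tmul z m =>
    obtain ⟨a, rfl⟩ := unitProj_surjective z
    refine ⟨unitT k A (unitProj k A a) • m, inc_injective (k := k) ?_⟩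
    change act₂ k A _ _ (Δ 1) (unitProj k A 1 ⊗ₜ (unitT k A (unitProj k A a) • m)) = act₂ k A _ _ (Δ 1) (unitProj k A a ⊗ₜ m)
    rw [act₂_unit_left_smul, act₂_unit_left, act₂_unit_left, ← Algebra.TensorProduct.one_def,
      mul_one, rTensor_unitT]

theorem rightUnitInv_bijective : Function.Bijective (rightUnitInv k M) := by
  have h : Function.LeftInverse (rightUnitAux k M ∘ inc k _ _) (rightUnitInv k M) := fun m => by
    change rightUnitAux k M (act₂ k A M (unitObj k A) (Δ 1) (m ⊗ₜ unitProj k A 1)) = m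
    rw [rightUnitAux_act₂, comul_one_mul, contrR_one_comul, one_smul]
  refine ⟨h.injective, fun x => ?_⟩
  rw [← pr_inc x]
  induction inc k _ _ x with
  | zero => exact ⟨0, (map_zero (rightUnitInv k M).hom).trans (map_zero (pr k _ _)).symm⟩
  | add y z hy hz =>
    obtain ⟨m, hm⟩ := hy
    obtain ⟨n, hn⟩ := hz
    exact ⟨m + n, (map_add (rightUnitInv k M).hom m n).trans
      ((congrArg₂ (· + ·) hm hn).trans (map_add (pr k _ _) y z).symm)⟩
  | tmul m z =>
    obtain ⟨a, rfl⟩ := unitProj_surjective z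
    refine ⟨unitS k A (unitProj k A a) • m, inc_injective (k := k) ?_⟩
    change act₂ k A _ _ (Δ 1) ((unitS k A (unitProj k A a) • m) ⊗ₜ unitProj k A 1) = act₂ k A _ _ (Δ 1) (m ⊗ₜ unitProj k A a)
    rw [act₂_unit_right_smul, act₂_unit_right, act₂_unit_right, ← Algebra.TensorProduct.one_def,
      mul_one, lTensor_unitS]

variable (k) in
/-- The left unitor. -/
def leftUnit : tens k (unitObj k A) M ≅ M :=
  (LinearEquiv.ofBijective (leftUnitInv k M).hom (leftUnitInv_bijective M)).toModuleIso.symm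

variable (k) in
/-- The right unitor. -/
def rightUnit : tens k M (unitObj k A) ≅ M :=
  (LinearEquiv.ofBijective (rightUnitInv k M).hom (rightUnitInv_bijective M)).toModuleIso.symm

theorem leftUnit_inv : (leftUnit k M).inv = leftUnitInv k M := rfl

theorem rightUnit_inv : (rightUnit k M).inv = rightUnitInv k M := rfl

end unit

end WeakBialgebra

namespace WeakBialgebra

variable {k A : Type u} [Field k] [Ring A] [Algebra k A] [WeakBialgebra k A]

local notation "Δ" => (CoalgebraStruct.comul (R := k) (A := A))
local notation "εε" => (CoalgebraStruct.counit (R := k) (A := A))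

section monoidal

variable {M N P Q M' N' P' : ModuleCat.{u} A}

theorem inc_tensMap_apply (f : M ⟶ M') (g : N ⟶ N') (x : tens k M N) :
    inc k M' N' (tensMap k f g x) = TensorProduct.map (res f) (res g) (inc k M N x) :=
  LinearMap.congr_fun (inc_tensMap f g) x

theorem incL_tensMap (f : M ⟶ M') (g : N ⟶ N') (h : P ⟶ P') (x : tens k (tens k M N) P) :
    incL k M' N' P' (tensMap k (tensMap k f g) h x) =
      TensorProduct.map (TensorProduct.map (res f) (res g)) (res h) (incL k M N P x) := by
  simp only [incL, LinearMap.comp_apply]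
  have h₁ := LinearMap.rTensor_comp_map _ (inc k M' N') (res (tensMap k f g)) (res (k := k) h)
  rw [inc_tensMap, ← LinearMap.map_comp_rTensor] at h₁
  rw [inc_tensMap_apply]
  exact LinearMap.congr_fun h₁ _

theorem incR_tensMap (f : M ⟶ M') (g : N ⟶ N') (h : P ⟶ P') (x : tens k M (tens k N P)) :
    incR k M' N' P' (tensMap k f (tensMap k g h) x) =
      TensorProduct.map (res f) (TensorProduct.map (res g) (res h)) (incR k M N P x) := by
  simp only [incR, LinearMap.comp_apply]
  have h₁ := LinearMap.lTensor_comp_map _ (inc k N' P') (res (k := k) f) (res (tensMap k g h))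
  rw [inc_tensMap, ← LinearMap.map_comp_lTensor] at h₁
  rw [inc_tensMap_apply]
  exact LinearMap.congr_fun h₁ _

theorem incR_tensAssoc (x : tens k (tens k M N) P) : incR k M N P ((tensAssoc k M N P).hom x) =
    TensorProduct.assoc k M N P (incL k M N P x) := incR_assocHom x

theorem hom_ext_apply {X Y : ModuleCat.{u} A} {f g : X ⟶ Y} (h : ∀ x, f x = g x) : f = g :=
  ModuleCat.hom_ext (LinearMap.ext h)

theorem tensMap_id : tensMap k (𝟙 M) (𝟙 N) = 𝟙 (tens k M N) :=
  hom_ext_apply fun x => inc_injective (k := k) (by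
    rw [inc_tensMap_apply, res_id, res_id, TensorProduct.map_id]; rfl)

theorem tensMap_comp {M'' N'' : ModuleCat.{u} A} (f : M ⟶ M') (g : N ⟶ N') (f' : M' ⟶ M'')
    (g' : N' ⟶ N'') : tensMap k f g ≫ tensMap k f' g' = tensMap k (f ≫ f') (g ≫ g') :=
  hom_ext_apply fun x => inc_injective (k := k) (by
    rw [inc_tensMap_apply, res_comp, res_comp, TensorProduct.map_comp, ModuleCat.comp_apply,
      inc_tensMap_apply, inc_tensMap_apply, LinearMap.comp_apply])

theorem tensAssoc_naturality (f : M ⟶ M') (g : N ⟶ N') (h : P ⟶ P') :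
    tensMap k (tensMap k f g) h ≫ (tensAssoc k M' N' P').hom =
      (tensAssoc k M N P).hom ≫ tensMap k f (tensMap k g h) :=
  hom_ext_apply fun x => incR_injective (k := k) (by
    rw [ModuleCat.comp_apply, ModuleCat.comp_apply, incR_tensAssoc, incL_tensMap, incR_tensMap,
      incR_tensAssoc, TensorProduct.map_map_assoc])

theorem inc_leftUnitInv (m : M) : inc k _ _ (leftUnitInv k M m) =
    act₂ k A (unitObj k A) M (Δ 1) (unitProj k A 1 ⊗ₜ m) := rfl

theorem inc_rightUnitInv (m : M) : inc k _ _ (rightUnitInv k M m) =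
    act₂ k A M (unitObj k A) (Δ 1) (m ⊗ₜ unitProj k A 1) := rfl

theorem leftUnitInv_naturality (f : M ⟶ M') :
    f ≫ leftUnitInv k M' = leftUnitInv k M ≫ tensMap k (𝟙 _) f :=
  hom_ext_apply fun x => inc_injective (k := k) (by
    rw [ModuleCat.comp_apply, ModuleCat.comp_apply, inc_tensMap_apply, inc_leftUnitInv,
      inc_leftUnitInv, ← act₂_map]
    rfl)

theorem rightUnitInv_naturality (f : M ⟶ M') :
    f ≫ rightUnitInv k M' = rightUnitInv k M ≫ tensMap k f (𝟙 _) :=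
  hom_ext_apply fun x => inc_injective (k := k) (by
    rw [ModuleCat.comp_apply, ModuleCat.comp_apply, inc_tensMap_apply, inc_rightUnitInv,
      inc_rightUnitInv, ← act₂_map]
    rfl)

theorem leftUnit_naturality (f : M ⟶ M') :
    tensMap k (𝟙 _) f ≫ (leftUnit k M').hom = (leftUnit k M).hom ≫ f := by
  rw [← Iso.inv_comp_eq, ← Category.assoc, ← Iso.eq_comp_inv, leftUnit_inv, leftUnit_inv,
    leftUnitInv_naturality]

theorem rightUnit_naturality (f : M ⟶ M') :
    tensMap k f (𝟙 _) ≫ (rightUnit k M').hom = (rightUnit k M).hom ≫ f := by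
  rw [← Iso.inv_comp_eq, ← Category.assoc, ← Iso.eq_comp_inv, rightUnit_inv, rightUnit_inv,
    rightUnitInv_naturality]

theorem triangle_aux₁ (z : A ⊗[k] A) (y : M ⊗[k] N) :
    (inc k _ _ ∘ₗ res (rightUnitInv k M)).rTensor N (act₂ k A M N z y) =
      actL k M (unitObj k A) N (LinearMap.rTensor A Δ z)
        (((TensorProduct.mk k _ _).flip (unitProj k A 1)).rTensor N y) := by
  induction y with
  | zero => simp
  | add y y' h h' => simp only [map_add, h, h']
  | tmul m n =>
    induction z with
    | zero => simp
    | add y y' h h' => simp only [map_add, h, h', LinearMap.add_apply]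
    | tmul a b =>
      change (act₂ k A M (unitObj k A) (Δ 1) ((a • m) ⊗ₜ unitProj k A 1)) ⊗ₜ (b • n) =
        (act₂ k A M (unitObj k A) (Δ a) (m ⊗ₜ unitProj k A 1)) ⊗ₜ (b • n)
      rw [act₂_unit_right_comul]

theorem triangle_aux₂ (z : A ⊗[k] A) (y : M ⊗[k] N) :
    (inc k _ _ ∘ₗ res (leftUnitInv k N)).lTensor M (act₂ k A M N z y) =
      actR k M (unitObj k A) N (LinearMap.lTensor A Δ z)
        ((TensorProduct.mk k _ _ (unitProj k A 1)).lTensor M y) := by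
  induction y with
  | zero => simp
  | add y y' h h' => simp only [map_add, h, h']
  | tmul m n =>
    induction z with
    | zero => simp
    | add y y' h h' => simp only [map_add, h, h', LinearMap.add_apply]
    | tmul a b =>
      change (a • m) ⊗ₜ (act₂ k A (unitObj k A) N (Δ 1) (unitProj k A 1 ⊗ₜ (b • n))) =
        (a • m) ⊗ₜ (act₂ k A (unitObj k A) N (Δ b) (unitProj k A 1 ⊗ₜ n))
      rw [act₂_unit_left_comul]

theorem triangle_aux : tensMap k (rightUnitInv k M) (𝟙 N) ≫ (tensAssoc k M (unitObj k A) N).hom =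
    tensMap k (𝟙 M) (leftUnitInv k N) :=
  hom_ext_apply fun x => incR_injective (k := k) (by
    rw [ModuleCat.comp_apply, incR_tensAssoc]
    simp only [incL, incR, LinearMap.comp_apply]
    rw [inc_tensMap_apply, inc_tensMap_apply, res_id, res_id]
    change TensorProduct.assoc k M (unitObj k A) N ((inc k _ _).rTensor N
      ((res (rightUnitInv k M)).rTensor N _)) = (inc k _ _).lTensor M
      ((res (leftUnitInv k N)).lTensor M _)
    rw [← LinearMap.rTensor_comp_apply, ← LinearMap.lTensor_comp_apply, ← act₂_inc, triangle_aux₁, triangle_aux₂, ← actR_assoc,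
      Coalgebra.coassoc_apply]
    congr 1
    induction inc k _ _ x with
    | zero => simp
    | add y y' h h' => simp only [map_add, h, h']
    | tmul m n => rfl)

theorem triangle' : (tensAssoc k M (unitObj k A) N).hom ≫ tensMap k (𝟙 M) (leftUnit k N).hom =
    tensMap k (rightUnit k M).hom (𝟙 N) := by
  have h : tensMap k (rightUnit k M).hom (𝟙 N) ≫ tensMap k (rightUnitInv k M) (𝟙 N) = 𝟙 _ := by
    rw [tensMap_comp, ← rightUnit_inv, Iso.hom_inv_id, Category.comp_id, tensMap_id]
  rw [← Category.id_comp (_ ≫ _), ← h, Category.assoc, ← Category.assoc _ (tensAssoc _ _ _ _).hom _,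
    triangle_aux, tensMap_comp, ← leftUnit_inv, Iso.inv_hom_id, Category.comp_id, tensMap_id,
    Category.comp_id]

variable (M N P Q)

variable (k) in
/-- The inclusion of `M ⊗ (N ⊗ (P ⊗ Q))` in the tensor product over `k`. -/
def inc₄ : tens k M (tens k N (tens k P Q)) →ₗ[k] M ⊗[k] (N ⊗[k] (P ⊗[k] Q)) :=
  ((inc k P Q).lTensor N).lTensor M ∘ₗ incR k M N (tens k P Q)

variable {M N P Q}

theorem inc₄_injective : Function.Injective (inc₄ k M N P Q) := by
  have : Function.LeftInverse (((pr k P Q).lTensor N).lTensor M) (((inc k P Q).lTensor N).lTensor M)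
      := fun x => by
    rw [← LinearMap.comp_apply, ← LinearMap.lTensor_comp, ← LinearMap.lTensor_comp, pr_inc_comp,
      LinearMap.lTensor_id, LinearMap.lTensor_id, LinearMap.id_apply]
  exact this.injective.comp incR_injective

theorem assoc_lTensor {V W X Y : Type u} [AddCommGroup V] [AddCommGroup W] [AddCommGroup X]
    [AddCommGroup Y] [Module k V] [Module k W] [Module k X] [Module k Y] (f : X →ₗ[k] Y)
    (x : (V ⊗[k] W) ⊗[k] X) : (f.lTensor W).lTensor V (TensorProduct.assoc k V W X x) =
      TensorProduct.assoc k V W Y (f.lTensor _ x) := by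
  suffices h : (f.lTensor W).lTensor V ∘ₗ (TensorProduct.assoc k V W X).toLinearMap =
    (TensorProduct.assoc k V W Y).toLinearMap ∘ₗ f.lTensor _ from LinearMap.congr_fun h x
  ext; rfl

theorem assoc_rTensor {V W X Y : Type u} [AddCommGroup V] [AddCommGroup W] [AddCommGroup X]
    [AddCommGroup Y] [Module k V] [Module k W] [Module k X] [Module k Y] (f : X →ₗ[k] Y)
    (x : (X ⊗[k] V) ⊗[k] W) : f.rTensor _ (TensorProduct.assoc k X V W x) =
      TensorProduct.assoc k Y V W ((f.rTensor V).rTensor W x) := by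
  suffices h : f.rTensor _ ∘ₗ (TensorProduct.assoc k X V W).toLinearMap =
    (TensorProduct.assoc k Y V W).toLinearMap ∘ₗ (f.rTensor V).rTensor W from LinearMap.congr_fun h x
  ext; rfl

theorem assoc_mTensor {V W X Y : Type u} [AddCommGroup V] [AddCommGroup W] [AddCommGroup X]
    [AddCommGroup Y] [Module k V] [Module k W] [Module k X] [Module k Y] (f : X →ₗ[k] Y)
    (x : (V ⊗[k] X) ⊗[k] W) : (f.rTensor W).lTensor V (TensorProduct.assoc k V X W x) =
      TensorProduct.assoc k V Y W ((f.lTensor V).rTensor W x) := by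
  suffices h : (f.rTensor W).lTensor V ∘ₗ (TensorProduct.assoc k V X W).toLinearMap =
    (TensorProduct.assoc k V Y W).toLinearMap ∘ₗ (f.lTensor V).rTensor W from LinearMap.congr_fun h x
  ext; rfl

theorem pentagon_k {V W X Y : Type u} [AddCommGroup V] [AddCommGroup W] [AddCommGroup X]
    [AddCommGroup Y] [Module k V] [Module k W] [Module k X] [Module k Y]
    (x : ((V ⊗[k] W) ⊗[k] X) ⊗[k] Y) :
    (TensorProduct.assoc k W X Y).toLinearMap.lTensor V (TensorProduct.assoc k V (W ⊗[k] X) Y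
      ((TensorProduct.assoc k V W X).toLinearMap.rTensor Y x)) =
      TensorProduct.assoc k V W (X ⊗[k] Y) (TensorProduct.assoc k (V ⊗[k] W) X Y x) := by
  suffices h : (TensorProduct.assoc k W X Y).toLinearMap.lTensor V ∘ₗ
      (TensorProduct.assoc k V (W ⊗[k] X) Y).toLinearMap ∘ₗ
      (TensorProduct.assoc k V W X).toLinearMap.rTensor Y =
      (TensorProduct.assoc k V W (X ⊗[k] Y)).toLinearMap ∘ₗ
        (TensorProduct.assoc k (V ⊗[k] W) X Y).toLinearMap from LinearMap.congr_fun h x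
  ext; rfl

theorem inc₄_rhs (x : tens k (tens k (tens k M N) P) Q) :
    inc₄ k M N P Q ((tensAssoc k M N (tens k P Q)).hom ((tensAssoc k (tens k M N) P Q).hom x)) =
      TensorProduct.assoc k M N (P ⊗[k] Q) (TensorProduct.assoc k (M ⊗[k] N) P Q
        ((incL k M N P).rTensor Q (inc k _ _ x))) := by
  simp only [inc₄, LinearMap.comp_apply]
  rw [incR_tensAssoc, assoc_lTensor]
  simp only [incL, LinearMap.comp_apply]
  rw [← LinearMap.comp_apply, LinearMap.lTensor_comp_rTensor, ← LinearMap.rTensor_comp_lTensor,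
    LinearMap.comp_apply]
  have := incR_tensAssoc x
  simp only [incR, LinearMap.comp_apply] at this
  rw [this, assoc_rTensor]
  simp only [incL, LinearMap.comp_apply, LinearMap.rTensor_comp]

theorem inc₄_lhs (x : tens k (tens k (tens k M N) P) Q) :
    inc₄ k M N P Q (tensMap k (𝟙 M) (tensAssoc k N P Q).hom ((tensAssoc k M (tens k N P) Q).hom
      (tensMap k (tensAssoc k M N P).hom (𝟙 Q) x))) =
    (TensorProduct.assoc k N P Q).toLinearMap.lTensor M (TensorProduct.assoc k M (N ⊗[k] P) Q
      ((TensorProduct.assoc k M N P).toLinearMap.rTensor Q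
        ((incL k M N P).rTensor Q (inc k _ _ x)))) := by
  simp only [inc₄, incR, LinearMap.comp_apply]
  rw [inc_tensMap_apply, res_id]
  change ((inc k P Q).lTensor N).lTensor M ((inc k N _).lTensor M
    ((res (tensAssoc k N P Q).hom).lTensor M _)) = _
  have h₁ : (inc k P Q).lTensor N ∘ₗ inc k N _ ∘ₗ res (tensAssoc k N P Q).hom =
      (TensorProduct.assoc k N P Q).toLinearMap ∘ₗ (inc k N P).rTensor Q ∘ₗ inc k _ _ :=
    LinearMap.ext incR_tensAssoc
  rw [← LinearMap.comp_apply, ← LinearMap.comp_apply, ← LinearMap.lTensor_comp,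
    ← LinearMap.lTensor_comp, LinearMap.comp_assoc, h₁, LinearMap.lTensor_comp,
    LinearMap.lTensor_comp, LinearMap.comp_apply, LinearMap.comp_apply]
  have h₂ := incR_tensAssoc (k := k) (M := M) (N := tens k N P) (P := Q)
  simp only [incR, incL, LinearMap.comp_apply] at h₂
  rw [h₂, assoc_mTensor, inc_tensMap_apply, res_id]
  change _ = (TensorProduct.assoc k N P Q).toLinearMap.lTensor M
    (TensorProduct.assoc k M (N ⊗[k] P) Q _)
  congr 2
  change (LinearMap.lTensor M (inc k N P)).rTensor Q ((inc k M _).rTensor Q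
    ((res (tensAssoc k M N P).hom).rTensor Q _)) = _
  have h₃ : (inc k N P).lTensor M ∘ₗ inc k M _ ∘ₗ res (tensAssoc k M N P).hom =
      (TensorProduct.assoc k M N P).toLinearMap ∘ₗ incL k M N P :=
    LinearMap.ext incR_tensAssoc
  rw [← LinearMap.comp_apply, ← LinearMap.comp_apply, ← LinearMap.rTensor_comp,
    ← LinearMap.rTensor_comp, LinearMap.comp_assoc, h₃, LinearMap.rTensor_comp,
    LinearMap.comp_apply]

variable (M N P Q) in
theorem pentagon' : tensMap k (tensAssoc k M N P).hom (𝟙 Q) ≫ (tensAssoc k M (tens k N P) Q).hom ≫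
    tensMap k (𝟙 M) (tensAssoc k N P Q).hom =
    (tensAssoc k (tens k M N) P Q).hom ≫ (tensAssoc k M N (tens k P Q)).hom :=
  hom_ext_apply fun x => inc₄_injective (k := k) (by
    simp only [ModuleCat.comp_apply]
    rw [inc₄_lhs, inc₄_rhs, pentagon_k])

variable (k A) in
/-- The monoidal structure on the category of modules over a weak bialgebra. -/
@[reducible] def moduleMonoidal : MonoidalCategory (ModuleCat.{u} A) where
  tensorObj := tens k
  tensorHom := tensMap k
  whiskerLeft M _ _ f := tensMap k (𝟙 M) f
  whiskerRight f N := tensMap k f (𝟙 N)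
  tensorUnit := unitObj k A
  associator := tensAssoc k
  leftUnitor := leftUnit k
  rightUnitor := rightUnit k
  tensorHom_def f g := by rw [tensMap_comp, Category.comp_id, Category.id_comp]
  id_tensorHom_id _ _ := tensMap_id
  tensorHom_comp_tensorHom := tensMap_comp
  whiskerLeft_id _ _ := tensMap_id
  id_whiskerRight _ _ := tensMap_id
  associator_naturality := tensAssoc_naturality
  leftUnitor_naturality := leftUnit_naturality
  rightUnitor_naturality := rightUnit_naturality
  pentagon := pentagon'
  triangle _ _ := triangle'

instance : MonoidalCategory (AMod k A) := moduleMonoidal k A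

end monoidal

end WeakBialgebra

namespace WeakBialgebra

variable {k A : Type u} [Field k] [Ring A] [Algebra k A] [WeakBialgebra k A]

section forget

/-- The forgetful functor from `A`-modules to vector spaces over `k`. -/
def U (k A : Type u) [Field k] [Ring A] [Algebra k A] : AMod k A ⥤ ModuleCat.{u} k :=
  ModuleCat.restrictScalars.{u} (algebraMap k A)

section
variable (k A : Type u) [Field k] [Ring A] [Algebra k A]

instance : (U k A).Additive :=
  inferInstanceAs (ModuleCat.restrictScalars.{u} (algebraMap k A)).Additive
instance : (U k A).Faithful :=
  inferInstanceAs (ModuleCat.restrictScalars.{u} (algebraMap k A)).Faithful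
instance : (U k A).ReflectsIsomorphisms :=
  inferInstanceAs (ModuleCat.restrictScalars.{u} (algebraMap k A)).ReflectsIsomorphisms
instance : PreservesLimitsOfSize.{u, u} (U k A) where
  preservesLimitsOfShape := { preservesLimit := fun {F} =>
    ModuleCat.preservesLimit_restrictScalars (algebraMap k A) (show _ ⥤ ModuleCat.{u} A from F) }
instance : PreservesColimitsOfSize.{u, u} (U k A) where
  preservesColimitsOfShape := { preservesColimit := fun {F} =>
    ModuleCat.preservesColimit_restrictScalars (algebraMap k A) (show _ ⥤ ModuleCat.{u} A from F) }
instance : PreservesFiniteLimits (U k A) := PreservesLimitsOfSize.preservesFiniteLimits _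
instance : PreservesColimitsOfSize.{0, 0} (U k A) := preservesColimitsOfSize_shrink.{0, u, 0, u} _
instance : PreservesFiniteColimits (U k A) := PreservesColimitsOfSize.preservesFiniteColimits _
instance : HasColimitsOfSize.{0, 0} (AMod k A) :=
  inferInstanceAs (HasColimitsOfSize.{0, 0} (ModuleCat.{u} A))
instance : ReflectsColimitsOfSize.{0, 0} (U k A) :=
  reflectsColimits_of_reflectsIsomorphisms

end

/-- A cocone for `F ⋙ K` gives a cocone for a functor mapping to it. -/
@[simps]
def coconeOfMap {C D J : Type*} [Category* C] [Category* D] [Category* J] {F G : C ⥤ D}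
    (r : G ⟶ F) (K : J ⥤ C) (s : Cocone (K ⋙ F)) : Cocone (K ⋙ G) where
  pt := s.pt
  ι := { app := fun j => r.app _ ≫ s.ι.app j
         naturality := fun j j' f => by
          have := s.ι.naturality f
          dsimp at this ⊢
          rw [r.naturality_assoc, this, Category.comp_id, Category.comp_id] }

theorem preservesColimits_of_retract {C D : Type*} [Category* C] [Category* D] {F G : C ⥤ D}
    (i : F ⟶ G) (r : G ⟶ F) (h : i ≫ r = 𝟙 F) [PreservesColimitsOfSize.{0, 0} G] :
    PreservesColimitsOfSize.{0, 0} F where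
  preservesColimitsOfShape := { preservesColimit := fun {K} => { preserves := fun {c} hc => ⟨
    { desc := fun s => i.app _ ≫ (isColimitOfPreserves G hc).desc (coconeOfMap r K s)
      fac := fun s j => by
        have := congr_app h (K.obj j)
        have h' := (isColimitOfPreserves G hc).fac (coconeOfMap r K s) j
        dsimp at this h' ⊢
        exact (i.naturality_assoc _ _).trans ((congrArg (fun t => i.app (K.obj j) ≫ t) h').trans
          ((Category.assoc _ _ _).symm.trans
            ((congrArg (fun t => t ≫ s.ι.app j) this).trans (Category.id_comp _))))
      uniq := fun s m hm => by
        have := congr_app h c.pt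
        dsimp at this
        have h' : r.app c.pt ≫ m = (isColimitOfPreserves G hc).desc (coconeOfMap r K s) :=
          (isColimitOfPreserves G hc).uniq (coconeOfMap r K s) _ fun j => by
            have h₁ := hm j
            exact (r.naturality_assoc _ _).trans (congrArg (fun t => r.app (K.obj j) ≫ t) h₁)
        rw [← h', reassoc_of% this] }⟩ } }

/-- The inclusion of the tensor product of modules in the tensor product of vector spaces. -/
def incHom₀ (M N : ModuleCat.{u} A) :
    ModuleCat.of k (tens k M N) ⟶ ModuleCat.of k (M ⊗[k] N) :=
  ModuleCat.ofHom (inc k M N)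

/-- The projection from the tensor product of vector spaces to the tensor product of modules. -/
def prHom₀ (M N : ModuleCat.{u} A) :
    ModuleCat.of k (M ⊗[k] N) ⟶ ModuleCat.of k (tens k M N) :=
  ModuleCat.ofHom (pr k M N)

/-- `incHom₀` in terms of the forgetful functor. -/
def incHom (M N : AMod k A) : (U k A).obj (M ⊗ N) ⟶ (U k A).obj M ⊗ (U k A).obj N :=
  incHom₀ (k := k) (A := A) M N

/-- `prHom₀` in terms of the forgetful functor. -/
def prHom (M N : AMod k A) : (U k A).obj M ⊗ (U k A).obj N ⟶ (U k A).obj (M ⊗ N) :=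
  prHom₀ (k := k) (A := A) M N

theorem inc_pr_hom (M N : AMod k A) : incHom M N ≫ prHom M N = 𝟙 _ :=
  ModuleCat.hom_ext (pr_inc_comp (k := k) (A := A) (M := M) (N := N))

theorem incHom_naturality {M N M' N' : AMod k A} (f : M ⟶ M') (g : N ⟶ N') :
    (U k A).map (f ⊗ₘ g) ≫ incHom M' N' =
      incHom M N ≫ ((U k A).map f ⊗ₘ (U k A).map g) :=
  ModuleCat.hom_ext (inc_tensMap (k := k) (A := A) (M := M) (N := N) (M' := M') (N' := N') f g)

theorem prHom_naturality {M N M' N' : AMod k A} (f : M ⟶ M') (g : N ⟶ N') :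
    prHom M N ≫ (U k A).map (f ⊗ₘ g) =
      ((U k A).map f ⊗ₘ (U k A).map g) ≫ prHom M' N' :=
  ModuleCat.hom_ext (tensMap_pr (k := k) (A := A) (M := M) (N := N) (M' := M') (N' := N') f g)

instance (M : AMod k A) : PreservesColimitsOfSize.{0, 0} (tensorLeft M) := by
  have : PreservesColimitsOfSize.{0, 0} (tensorLeft M ⋙ U k A) :=
    preservesColimits_of_retract (G := U k A ⋙ tensorLeft ((U k A).obj M))
      { app := fun N => incHom M N
        naturality := fun N N' f => by
          have := incHom_naturality (𝟙 M) f
          rwa [(U k A).map_id, id_tensorHom, id_tensorHom] at this }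
      { app := fun N => prHom M N
        naturality := fun N N' f => by
          have := prHom_naturality (𝟙 M) f
          rw [(U k A).map_id, id_tensorHom, id_tensorHom] at this
          exact this.symm } (by ext1; ext1 N; exact inc_pr_hom M N)
  exact preservesColimits_of_reflects_of_preserves _ (U k A)

instance (M : AMod k A) : PreservesColimitsOfSize.{0, 0} (tensorRight M) := by
  have : PreservesColimitsOfSize.{0, 0} (tensorRight M ⋙ U k A) :=
    preservesColimits_of_retract (G := U k A ⋙ tensorRight ((U k A).obj M))
      { app := fun N => incHom N M
        naturality := fun N N' f => by
          have := incHom_naturality f (𝟙 M)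
          rwa [(U k A).map_id, tensorHom_id, tensorHom_id] at this }
      { app := fun N => prHom N M
        naturality := fun N N' f => by
          have := prHom_naturality f (𝟙 M)
          rw [(U k A).map_id, tensorHom_id, tensorHom_id] at this
          exact this.symm } (by ext1; ext1 N; exact inc_pr_hom N M)
  exact preservesColimits_of_reflects_of_preserves _ (U k A)

instance (M : AMod k A) : PreservesColimitsOfSize.{0, 0} ((curriedTensor (AMod k A)).obj M) :=
  inferInstanceAs (PreservesColimitsOfSize.{0, 0} (tensorLeft M))

instance (M : AMod k A) : PreservesColimitsOfSize.{0, 0} ((curriedTensor (AMod k A)).flip.obj M) :=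
  inferInstanceAs (PreservesColimitsOfSize.{0, 0} (tensorRight M))

theorem U_whiskerLeft (M : AMod k A) {N N' : AMod k A} (f : N ⟶ N') :
    (U k A).map (M ◁ f) ≫ incHom M N' = incHom M N ≫ ((U k A).obj M ◁ (U k A).map f) := by
  have := incHom_naturality (𝟙 M) f
  rwa [(U k A).map_id, id_tensorHom, id_tensorHom] at this

theorem U_whiskerRight (M : AMod k A) {N N' : AMod k A} (f : N ⟶ N') :
    (U k A).map (f ▷ M) ≫ incHom N' M = incHom N M ≫ ((U k A).map f ▷ (U k A).obj M) := by
  have := incHom_naturality f (𝟙 M)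
  rwa [(U k A).map_id, tensorHom_id, tensorHom_id] at this

theorem incHom_cancel {X : AMod k A} {M N : AMod k A} {f g : X ⟶ M ⊗ N}
    (h : (U k A).map f ≫ incHom M N = (U k A).map g ≫ incHom M N) : f = g :=
  (U k A).map_injective (by
    have := congrArg (fun φ => φ ≫ prHom M N) h
    simpa only [Category.assoc, inc_pr_hom, Category.comp_id] using this)

instance : MonoidalPreadditive (AMod k A) where
  whiskerLeft_zero := incHom_cancel (by
    rw [U_whiskerLeft, Functor.map_zero, Functor.map_zero, MonoidalPreadditive.whiskerLeft_zero,
      comp_zero, zero_comp])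
  zero_whiskerRight := incHom_cancel (by
    rw [U_whiskerRight, Functor.map_zero, Functor.map_zero, MonoidalPreadditive.zero_whiskerRight,
      comp_zero, zero_comp])
  whiskerLeft_add f g := incHom_cancel (by
    rw [U_whiskerLeft, Functor.map_add, Functor.map_add, Preadditive.add_comp, U_whiskerLeft,
      U_whiskerLeft, MonoidalPreadditive.whiskerLeft_add, Preadditive.comp_add])
  add_whiskerRight f g := incHom_cancel (by
    rw [U_whiskerRight, Functor.map_add, Functor.map_add, Preadditive.add_comp, U_whiskerRight,
      U_whiskerRight, MonoidalPreadditive.add_whiskerRight, Preadditive.comp_add])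

instance (X₁ X₂ : GradedObject ℤ (AMod k A)) : GradedObject.HasTensor X₁ X₂ :=
  fun _ => inferInstance
instance (X₁ X₂ X₃ : GradedObject ℤ (AMod k A)) : GradedObject.HasGoodTensor₁₂Tensor X₁ X₂ X₃ :=
  fun _ _ => inferInstance
instance (X₁ X₂ X₃ : GradedObject ℤ (AMod k A)) : GradedObject.HasGoodTensorTensor₂₃ X₁ X₂ X₃ :=
  fun _ _ => inferInstance
instance (X₁ X₂ X₃ X₄ : GradedObject ℤ (AMod k A)) : GradedObject.HasTensor₄ObjExt X₁ X₂ X₃ X₄ :=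
  fun _ _ => inferInstance

end forget

end WeakBialgebra

namespace WeakBialgebra

variable {k A : Type u} [Field k] [Ring A] [Algebra k A] [WeakBialgebra k A]

section retract

open HomologicalComplex

theorem ι_d {C : Type*} [Category* C] [MonoidalCategory C] [Preadditive C] [MonoidalPreadditive C]
    (K L : CochainComplex C ℤ) [HomologicalComplex.HasTensor K L] (p q n : ℤ) (h : p + q = n) (m : ℤ) 
    (hm : n + 1 = m) :
    ιTensorObj K L p q n h ≫ (HomologicalComplex.tensorObj K L).d n m =
    ComplexShape.ε₁ (.up ℤ) (.up ℤ) (.up ℤ) (p, q) •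
      (K.d p (p + 1) ▷ L.X q ≫ ιTensorObj K L (p + 1) q m (by lia)) +
    ComplexShape.ε₂ (.up ℤ) (.up ℤ) (.up ℤ) (p, q) •
      (K.X p ◁ L.d q (q + 1) ≫ ιTensorObj K L p (q + 1) m (by lia)) := by
  rw [mapBifunctor.d_eq, Preadditive.comp_add, mapBifunctor.ι_D₁, mapBifunctor.ι_D₂,
    mapBifunctor.d₁_eq K L _ _ (show (ComplexShape.up ℤ).Rel p (p + 1) from rfl) q m
      (show p + 1 + q = m by lia), 
    mapBifunctor.d₂_eq K L _ _ p (show (ComplexShape.up ℤ).Rel q (q + 1) from rfl) m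
      (show p + (q + 1) = m by lia)]
  rfl

variable (k A) in
/-- The forgetful functor from complexes of `A`-modules to complexes of vector spaces. -/
abbrev UC : CochainComplex (AMod k A) ℤ ⥤ CochainComplex (ModuleCat.{u} k) ℤ :=
  (U k A).mapHomologicalComplex (.up ℤ)

instance (K L : CochainComplex (ModuleCat.{u} k) ℤ) : HomologicalComplex.HasTensor K L :=
  fun _ => inferInstance

variable {K L K' L' : CochainComplex (AMod k A) ℤ}

/-- The image under the forgetful functor of the cofan defining the tensor product of complexes is
a colimit. -/
def isColimitU (K L : CochainComplex (AMod k A) ℤ) (n : ℤ) : IsColimit ((U k A).mapCocone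
    (GradedObject.cofanMapObj (HomologicalComplex₂.toGradedObject
      ((((curriedTensor (AMod k A)).mapBifunctorHomologicalComplex (.up ℤ) (.up ℤ)).obj K).obj L))
      (ComplexShape.π (.up ℤ) (.up ℤ) (.up ℤ)) n)) :=
  isColimitOfPreserves (U k A) (GradedObject.isColimitCofanMapObj _ _ _)

theorem U_hom_ext {n : ℤ} {Z : ModuleCat.{u} k}
    {f g : (U k A).obj ((HomologicalComplex.tensorObj K L).X n) ⟶ Z}
    (h : ∀ (p q : ℤ) (h : p + q = n), (U k A).map (ιTensorObj K L p q n h) ≫ f =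
      (U k A).map (ιTensorObj K L p q n h) ≫ g) : f = g :=
  (isColimitU K L n).hom_ext fun ⟨⟨p, q⟩, h'⟩ => h p q h'

theorem U_exists_desc {n : ℤ} {Z : ModuleCat.{u} k}
    (φ : ∀ (p q : ℤ) (_ : p + q = n), (U k A).obj (K.X p ⊗ L.X q) ⟶ Z) :
    ∃ f : (U k A).obj ((HomologicalComplex.tensorObj K L).X n) ⟶ Z, ∀ p q h,
      (U k A).map (ιTensorObj K L p q n h) ≫ f = φ p q h :=
  ⟨(isColimitU K L n).desc ⟨Z, Discrete.natTrans fun ⟨⟨⟨p, q⟩, h⟩⟩ => φ p q h⟩, fun p q h =>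
    (isColimitU K L n).fac ⟨Z, Discrete.natTrans fun ⟨⟨⟨p, q⟩, h⟩⟩ => φ p q h⟩ ⟨⟨⟨p, q⟩, h⟩⟩⟩

variable (K L) in
/-- The tensor product of the complexes of vector spaces underlying two complexes of modules. -/
def tensV : CochainComplex (ModuleCat.{u} k) ℤ :=
  HomologicalComplex.tensorObj ((UC k A).obj K) ((UC k A).obj L)

variable (K L) in
/-- The complex of vector spaces underlying the tensor product of two complexes of modules. -/
def tensU : CochainComplex (ModuleCat.{u} k) ℤ :=
  (UC k A).obj (HomologicalComplex.tensorObj K L)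

variable (K L) in
/-- The inclusion of a summand of `tensV`. -/
def ιV (p q n : ℤ) (h : p + q = n) : (U k A).obj (K.X p) ⊗ (U k A).obj (L.X q) ⟶ (tensV K L).X n :=
  ιTensorObj ((UC k A).obj K) ((UC k A).obj L) p q n h

variable (K L) in
/-- The inclusion of a summand of `tensU`. -/
def ιU (p q n : ℤ) (h : p + q = n) : (U k A).obj (K.X p ⊗ L.X q) ⟶ (tensU K L).X n :=
  (U k A).map (ιTensorObj K L p q n h)

theorem ιV_d (p q n : ℤ) (h : p + q = n) (m : ℤ) (hm : n + 1 = m) :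
    ιV K L p q n h ≫ (tensV K L).d n m =
    ComplexShape.ε₁ (.up ℤ) (.up ℤ) (.up ℤ) (p, q) •
      ((U k A).map (K.d p (p + 1)) ▷ (U k A).obj (L.X q) ≫ ιV K L (p + 1) q m (by lia)) +
    ComplexShape.ε₂ (.up ℤ) (.up ℤ) (.up ℤ) (p, q) •
      ((U k A).obj (K.X p) ◁ (U k A).map (L.d q (q + 1)) ≫ ιV K L p (q + 1) m (by lia)) :=
  ι_d ((UC k A).obj K) ((UC k A).obj L) p q n h m hm

theorem ιU_d (p q n : ℤ) (h : p + q = n) (m : ℤ) (hm : n + 1 = m) :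
    ιU K L p q n h ≫ (tensU K L).d n m =
    ComplexShape.ε₁ (.up ℤ) (.up ℤ) (.up ℤ) (p, q) •
      ((U k A).map (K.d p (p + 1) ▷ L.X q) ≫ ιU K L (p + 1) q m (by lia)) +
    ComplexShape.ε₂ (.up ℤ) (.up ℤ) (.up ℤ) (p, q) •
      ((U k A).map (K.X p ◁ L.d q (q + 1)) ≫ ιU K L p (q + 1) m (by lia)) := by
  refine ((U k A).map_comp _ _).symm.trans ?_
  rw [ι_d K L p q n h m hm, Functor.map_add, Functor.map_units_smul, Functor.map_units_smul,
    Functor.map_comp, Functor.map_comp]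
  rfl

theorem ιV_hom_ext {n : ℤ} {Z : ModuleCat.{u} k} {f g : (tensV K L).X n ⟶ Z}
    (h : ∀ (p q : ℤ) (h : p + q = n), ιV K L p q n h ≫ f = ιV K L p q n h ≫ g) : f = g :=
  mapBifunctor.hom_ext h

theorem ιU_hom_ext {n : ℤ} {Z : ModuleCat.{u} k} {f g : (tensU K L).X n ⟶ Z}
    (h : ∀ (p q : ℤ) (h : p + q = n), ιU K L p q n h ≫ f = ιU K L p q n h ≫ g) : f = g :=
  U_hom_ext h

/-- Functoriality of `tensV`. -/
def tensVMap (f : K ⟶ K') (g : L ⟶ L') : tensV K L ⟶ tensV K' L' :=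
  HomologicalComplex.tensorHom ((UC k A).map f) ((UC k A).map g)

/-- Functoriality of `tensU`. -/
def tensUMap (f : K ⟶ K') (g : L ⟶ L') : tensU K L ⟶ tensU K' L' :=
  (UC k A).map (HomologicalComplex.tensorHom f g)

theorem ιV_tensVMap (f : K ⟶ K') (g : L ⟶ L') (p q n : ℤ) (h : p + q = n) :
    ιV K L p q n h ≫ (tensVMap f g).f n =
      ((U k A).map (f.f p) ⊗ₘ (U k A).map (g.f q)) ≫ ιV K' L' p q n h := by
  refine (ι_mapBifunctorMap ((UC k A).map f) ((UC k A).map g) _ _ p q n h).trans ?_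
  rw [MonoidalCategory.tensorHom_def, Category.assoc]
  rfl

theorem ιU_tensUMap (f : K ⟶ K') (g : L ⟶ L') (p q n : ℤ) (h : p + q = n) :
    ιU K L p q n h ≫ (tensUMap f g).f n =
      (U k A).map (f.f p ⊗ₘ g.f q) ≫ ιU K' L' p q n h := by
  refine ((U k A).map_comp _ _).symm.trans ?_
  rw [ι_mapBifunctorMap, MonoidalCategory.tensorHom_def, ← Category.assoc, (U k A).map_comp]
  rfl

variable (K L) in
/-- The components of `retI`. -/
def retIX (n : ℤ) : (tensU K L).X n ⟶ (tensV K L).X n :=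
  (U_exists_desc fun p q h => incHom (K.X p) (L.X q) ≫ ιV K L p q n h).choose

theorem ι_retIX (p q n : ℤ) (h : p + q = n) : ιU K L p q n h ≫ retIX K L n =
    incHom (K.X p) (L.X q) ≫ ιV K L p q n h :=
  (U_exists_desc fun p q h => incHom (K.X p) (L.X q) ≫ ιV K L p q n h).choose_spec p q h

variable (K L) in
/-- The tensor product of complexes of modules, as a direct summand of the tensor product of
complexes of vector spaces. -/
def retI : tensU K L ⟶ tensV K L where
  f := retIX K L
  comm' n m hm := ιU_hom_ext fun p q h => by
    rw [reassoc_of% ι_retIX, ιV_d _ _ _ _ _ hm, reassoc_of% ιU_d p q n h _ hm]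
    simp only [Preadditive.add_comp, Preadditive.comp_add,
      Linear.units_smul_comp, Linear.comp_units_smul, Category.assoc, ι_retIX]
    rw [← reassoc_of% U_whiskerLeft, ← reassoc_of% U_whiskerRight]

variable (K L) in
/-- The components of `retP`. -/
def retPX (n : ℤ) : (tensV K L).X n ⟶ (tensU K L).X n :=
  mapBifunctorDesc fun p q h => prHom (K.X p) (L.X q) ≫ ιU K L p q n h

theorem ι_retPX (p q n : ℤ) (h : p + q = n) :
    ιV K L p q n h ≫ retPX K L n = prHom (K.X p) (L.X q) ≫ ιU K L p q n h :=
  ι_mapBifunctorDesc _ _ _ _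

theorem U_whiskerLeft_pr (M : AMod k A) {N N' : AMod k A} (f : N ⟶ N') :
    prHom M N ≫ (U k A).map (M ◁ f) = ((U k A).obj M ◁ (U k A).map f) ≫ prHom M N' := by
  have := prHom_naturality (𝟙 M) f
  rwa [(U k A).map_id, id_tensorHom, id_tensorHom] at this

theorem U_whiskerRight_pr (M : AMod k A) {N N' : AMod k A} (f : N ⟶ N') :
    prHom N M ≫ (U k A).map (f ▷ M) = ((U k A).map f ▷ (U k A).obj M) ≫ prHom N' M := by
  have := prHom_naturality f (𝟙 M)
  rwa [(U k A).map_id, tensorHom_id, tensorHom_id] at this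

variable (K L) in
/-- The projection corresponding to `retI`. -/
def retP : tensV K L ⟶ tensU K L where
  f := retPX K L
  comm' n m hm := ιV_hom_ext fun p q h => by
    rw [reassoc_of% ι_retPX, ιU_d _ _ _ _ _ hm, reassoc_of% ιV_d p q n h _ hm]
    simp only [Preadditive.add_comp, Preadditive.comp_add,
      Linear.units_smul_comp, Linear.comp_units_smul, Category.assoc, ι_retPX]
    rw [reassoc_of% U_whiskerLeft_pr, reassoc_of% U_whiskerRight_pr]

theorem retI_retP : retI K L ≫ retP K L = 𝟙 _ := by
  ext1 n
  refine ιU_hom_ext fun p q h => ?_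
  rw [HomologicalComplex.comp_f, HomologicalComplex.id_f, Category.comp_id]
  change _ ≫ retIX K L n ≫ retPX K L n = _
  rw [reassoc_of% ι_retIX, ι_retPX, ← Category.assoc, inc_pr_hom, Category.id_comp]

theorem retI_naturality (f : K ⟶ K') (g : L ⟶ L') :
    tensUMap f g ≫ retI K' L' = retI K L ≫ tensVMap f g := by
  ext1 n
  refine ιU_hom_ext fun p q h => ?_
  rw [HomologicalComplex.comp_f, HomologicalComplex.comp_f]
  change _ ≫ _ ≫ retIX K' L' n = _ ≫ retIX K L n ≫ _
  rw [reassoc_of% ιU_tensUMap, reassoc_of% ι_retIX, ι_retIX, ιV_tensVMap,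
    reassoc_of% incHom_naturality]

theorem retP_naturality (f : K ⟶ K') (g : L ⟶ L') :
    retP K L ≫ tensUMap f g = tensVMap f g ≫ retP K' L' := by
  ext1 n
  refine ιV_hom_ext fun p q h => ?_
  rw [HomologicalComplex.comp_f, HomologicalComplex.comp_f]
  change _ ≫ retPX K L n ≫ _ = _ ≫ _ ≫ retPX K' L' n
  rw [reassoc_of% ιV_tensVMap, reassoc_of% ι_retPX, ι_retPX, ιU_tensUMap,
    reassoc_of% prHom_naturality]

/-- `tensUMap f g` is a retract of `tensVMap f g`. -/
def retractArrow (f : K ⟶ K') (g : L ⟶ L') : RetractArrow (tensUMap f g) (tensVMap f g) where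
  i := Arrow.homMk (retI K L) (retI K' L') (retI_naturality f g).symm
  r := Arrow.homMk (retP K L) (retP K' L') (retP_naturality f g)
  retract := by
    ext : 1
    · exact retI_retP
    · exact retI_retP

end retract

end WeakBialgebra

namespace WeakBialgebra

variable {k A : Type u} [Field k] [Ring A] [Algebra k A] [WeakBialgebra k A]

section quasiIso

open HomologicalComplex

variable {K L K' L' : CochainComplex (AMod k A) ℤ}

instance (V : ModuleCat.{u} k) : Injective V :=
  have : Module.Injective k V := Module.injective_of_isSemisimpleRing k V
  Module.injective_object_of_injective_module k V

theorem homotopyEquiv_of_quasiIso {V W : CochainComplex (ModuleCat.{u} k) ℤ} (f : V ⟶ W)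
    (a b : ℤ) [V.IsStrictlyGE a] [W.IsStrictlyGE b] (hf : QuasiIso f) :
    homotopyEquivalences _ (.up ℤ) f := by
  have := CochainComplex.isKInjective_of_injective V a
  have := CochainComplex.isKInjective_of_injective W b
  exact (CochainComplex.IsKInjective.quasiIso_iff f).1 hf

theorem tensVMap_comp {K'' L'' : CochainComplex (AMod k A) ℤ} (f : K ⟶ K') (g : L ⟶ L')
    (f' : K' ⟶ K'') (g' : L' ⟶ L'') : tensVMap (f ≫ f') (g ≫ g') =
      tensVMap f g ≫ tensVMap f' g' := by
  ext1 n
  refine ιV_hom_ext fun p q h => ?_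
  rw [HomologicalComplex.comp_f, ιV_tensVMap, reassoc_of% ιV_tensVMap, ιV_tensVMap]
  simp

/-- The tensor product with a complex preserves homotopy equivalences. -/
theorem quasiIso_tensorHom_left {V V' W : CochainComplex (ModuleCat.{u} k) ℤ} (f : V ⟶ V')
    (hf : homotopyEquivalences _ (.up ℤ) f) : QuasiIso (HomologicalComplex.tensorHom f (𝟙 W)) := by
  obtain ⟨e, rfl⟩ := hf
  have hid (V : CochainComplex (ModuleCat.{u} k) ℤ) : HomologicalComplex.tensorHom (𝟙 V) (𝟙 W) =
      𝟙 (HomologicalComplex.tensorObj V W) := by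
    ext1 n
    refine mapBifunctor.hom_ext fun p q h => ?_
    rw [ι_mapBifunctorMap]
    simp
  have hcomp {V₁ V₂ V₃ : CochainComplex (ModuleCat.{u} k) ℤ} (f : V₁ ⟶ V₂) (g : V₂ ⟶ V₃) :
      HomologicalComplex.tensorHom (f ≫ g) (𝟙 W) =
        HomologicalComplex.tensorHom f (𝟙 W) ≫ HomologicalComplex.tensorHom g (𝟙 W) := by
    ext1 n
    refine mapBifunctor.hom_ext fun p q h => ?_
    rw [ι_mapBifunctorMap]
    simp
  exact HomotopyEquiv.quasiIso_hom
    { hom := HomologicalComplex.tensorHom e.hom (𝟙 W)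
      inv := HomologicalComplex.tensorHom e.inv (𝟙 W)
      homotopyHomInvId := ((Homotopy.ofEq (hcomp _ _).symm).trans
        (mapBifunctorMapHomotopy₁ e.homotopyHomInvId (𝟙 W) _ _)).trans (Homotopy.ofEq (hid _))
      homotopyInvHomId := ((Homotopy.ofEq (hcomp _ _).symm).trans
        (mapBifunctorMapHomotopy₁ e.homotopyInvHomId (𝟙 W) _ _)).trans (Homotopy.ofEq (hid _)) }

theorem quasiIso_tensorHom_right {V V' W : CochainComplex (ModuleCat.{u} k) ℤ} (f : V ⟶ V')
    (hf : homotopyEquivalences _ (.up ℤ) f) : QuasiIso (HomologicalComplex.tensorHom (𝟙 W) f) := by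
  obtain ⟨e, rfl⟩ := hf
  have hid (V : CochainComplex (ModuleCat.{u} k) ℤ) : HomologicalComplex.tensorHom (𝟙 W) (𝟙 V) =
      𝟙 (HomologicalComplex.tensorObj W V) := by
    ext1 n
    refine mapBifunctor.hom_ext fun p q h => ?_
    rw [ι_mapBifunctorMap]
    simp
  have hcomp {V₁ V₂ V₃ : CochainComplex (ModuleCat.{u} k) ℤ} (f : V₁ ⟶ V₂) (g : V₂ ⟶ V₃) :
      HomologicalComplex.tensorHom (𝟙 W) (f ≫ g) =
        HomologicalComplex.tensorHom (𝟙 W) f ≫ HomologicalComplex.tensorHom (𝟙 W) g := by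
    ext1 n
    refine mapBifunctor.hom_ext fun p q h => ?_
    rw [ι_mapBifunctorMap]
    simp
  exact HomotopyEquiv.quasiIso_hom
    { hom := HomologicalComplex.tensorHom (𝟙 W) e.hom
      inv := HomologicalComplex.tensorHom (𝟙 W) e.inv
      homotopyHomInvId := ((Homotopy.ofEq (hcomp _ _).symm).trans
        (mapBifunctorMapHomotopy₂ (𝟙 W) e.homotopyHomInvId _ _)).trans (Homotopy.ofEq (hid _))
      homotopyInvHomId := ((Homotopy.ofEq (hcomp _ _).symm).trans
        (mapBifunctorMapHomotopy₂ (𝟙 W) e.homotopyInvHomId _ _)).trans (Homotopy.ofEq (hid _)) }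

theorem quasiIso_tensorHom_of_tensVMap {f : K ⟶ K'} {g : L ⟶ L'} (h : QuasiIso (tensVMap f g)) :
    QuasiIso (HomologicalComplex.tensorHom f g) := by
  have h' : HomologicalComplex.quasiIso _ _ (tensUMap f g) :=
    MorphismProperty.of_retract (retractArrow f g) h
  exact (quasiIso_map_iff_of_preservesHomology _ (U k A)).1 h'

theorem quasiIso_tensor_left (f : K ⟶ K') (a b : ℤ) [K.IsStrictlyGE a] [K'.IsStrictlyGE b]
    [hf : QuasiIso f] : QuasiIso (HomologicalComplex.tensorHom f (𝟙 L)) := by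
  refine quasiIso_tensorHom_of_tensVMap ?_
  have : QuasiIso ((UC k A).map f) := (quasiIso_map_iff_of_preservesHomology f (U k A)).2 hf
  have := quasiIso_tensorHom_left (W := (UC k A).obj L) _ (homotopyEquiv_of_quasiIso
    ((UC k A).map f) a b this)
  rw [← (UC k A).map_id] at this
  exact this

theorem quasiIso_tensor_right (f : K ⟶ K') (a b : ℤ) [K.IsStrictlyGE a] [K'.IsStrictlyGE b]
    [hf : QuasiIso f] : QuasiIso (HomologicalComplex.tensorHom (𝟙 L) f) := by
  refine quasiIso_tensorHom_of_tensVMap ?_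
  have : QuasiIso ((UC k A).map f) := (quasiIso_map_iff_of_preservesHomology f (U k A)).2 hf
  have := quasiIso_tensorHom_right (W := (UC k A).obj L) _ (homotopyEquiv_of_quasiIso
    ((UC k A).map f) a b this)
  rw [← (UC k A).map_id] at this
  exact this

end quasiIso

section finite

variable (k A)

/-- Finite-dimensional modules. -/
def fd (k A : Type u) [Field k] [Ring A] [Algebra k A] : ObjectProperty (AMod k A) :=
  fun M => FiniteDimensional k ((U k A).obj M)

/-- Bounded complexes of finite-dimensional modules. -/
def boundedFd (k A : Type u) [Field k] [Ring A] [Algebra k A] :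
    ObjectProperty (CochainComplex (AMod k A) ℤ) := fun K =>
  (∀ n, fd k A (K.X n)) ∧ (∃ a, K.IsStrictlyGE a) ∧ ∃ b, K.IsStrictlyLE b

variable {k A}

theorem finite_tens (M N : ModuleCat.{u} A) [FiniteDimensional k M] [FiniteDimensional k N] :
    FiniteDimensional k (tens k M N) :=
  Module.Finite.of_surjective (pr k M N) fun x => ⟨inc k M N x, pr_inc x⟩

theorem fd_tensor {M N : AMod k A} (hM : fd k A M) (hN : fd k A N) : fd k A (M ⊗ N) :=
  @finite_tens k A _ _ _ _ M N hM hN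

theorem fd_of_isZero {k A : Type u} [Field k] [Ring A] [Algebra k A] {M : AMod k A}
    (hM : IsZero M) : fd k A M := by
  have := ModuleCat.subsingleton_of_isZero ((U k A).map_isZero hM)
  exact inferInstanceAs (Module.Finite k ((U k A).obj M))

theorem isZero_tensor_left {M N : AMod k A} (hM : IsZero M) : IsZero (M ⊗ N) :=
  (tensorRight N).map_isZero hM

theorem isZero_tensor_right {M N : AMod k A} (hN : IsZero N) : IsZero (M ⊗ N) :=
  (tensorLeft M).map_isZero hN

variable [Module.Finite k A]

theorem finite_iff {k A : Type u} [Field k] [Ring A] [Algebra k A] [Module.Finite k A]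
    (M : ModuleCat.{u} A) : Module.Finite k M ↔ Module.Finite A M :=
  ⟨fun _ => Module.Finite.of_restrictScalars_finite k A _,
    fun _ => Module.Finite.trans (R := k) A M⟩

theorem fd_unit : fd k A (𝟙_ (AMod k A)) :=
  (finite_iff (unitObj k A)).2 (inferInstanceAs (Module.Finite A (A ⧸ unitIdeal k A)))

theorem boundedFd_unit : boundedFd k A (𝟙_ _) := by
  refine ⟨fun n => ?_, ⟨0, ?_⟩, ⟨0, ?_⟩⟩
  · by_cases h : n = 0
    · subst h
      exact fd_unit
    · exact fd_of_isZero (HomologicalComplex.isZero_single_obj_X _ _ _ _ h)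
  · exact inferInstanceAs (CochainComplex.IsStrictlyGE ((HomologicalComplex.single (AMod k A) (.up ℤ) 0).obj _) 0)
  · exact inferInstanceAs (CochainComplex.IsStrictlyLE ((HomologicalComplex.single (AMod k A) (.up ℤ) 0).obj _) 0)

theorem finite_of_hom_ext {A : Type u} [Ring A] {ι : Type*} (X : ModuleCat.{u} A)
    (Y : ι → ModuleCat.{u} A) (f : ∀ i, Y i ⟶ X) (s : Finset ι)
    (hY : ∀ i, Module.Finite A (Y i))
    (h : ∀ (Q : ModuleCat.{u} A) (g : X ⟶ Q), (∀ i ∈ s, f i ≫ g = 0) → g = 0) :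
    Module.Finite A X := by
  let I : Submodule A X := ⨆ i ∈ s, LinearMap.range (f i).hom
  have hI : I = ⊤ := by
    have h' := h (ModuleCat.of A (X ⧸ I)) (ModuleCat.ofHom I.mkQ) fun i hi =>
      ModuleCat.hom_ext (LinearMap.ext fun x => (Submodule.Quotient.mk_eq_zero I).2
        (Submodule.mem_iSup_of_mem i (Submodule.mem_iSup_of_mem hi ⟨x, rfl⟩)))
    rw [← Submodule.ker_mkQ I]
    exact LinearMap.ker_eq_top.2 (congrArg ModuleCat.Hom.hom h')
  exact ⟨hI ▸ Submodule.fg_biSup _ _ fun i _ => Module.Finite.iff_fg.1 (Module.Finite.range _)⟩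

theorem boundedFd_tensor (K L : CochainComplex (AMod k A) ℤ) (hK : boundedFd k A K)
    (hL : boundedFd k A L) : boundedFd k A (K ⊗ L) := by
  obtain ⟨hK, ⟨a, ha⟩, ⟨b, hb⟩⟩ := hK
  obtain ⟨hL, ⟨c, hc⟩, ⟨d, hd⟩⟩ := hL
  refine ⟨fun n => ?_, ⟨a + c, ?_⟩, ⟨b + d, ?_⟩⟩
  · refine (finite_iff (k := k) (A := A) ((HomologicalComplex.tensorObj K L).X n)).2
      (finite_of_hom_ext _ (fun p => tens k (K.X p) (L.X (n - p)))
      (fun p => HomologicalComplex.ιTensorObj K L p (n - p) n (by lia)) (Finset.Icc a b)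
      (fun p => (finite_iff (k := k) (A := A) _).1 (fd_tensor (hK p) (hL (n - p)))) ?_)
    intro Q g hg
    refine HomologicalComplex.mapBifunctor.hom_ext (C₁ := AMod k A) (C₂ := AMod k A)
      (D := AMod k A) (f := g) (g := (0 : (HomologicalComplex.tensorObj K L).X n ⟶ _))
      fun p q h => ?_
    obtain rfl : q = n - p := by
      change p + q = n at h
      lia
    by_cases hp : p ∈ Finset.Icc a b
    · exact (hg p hp).trans comp_zero.symm
    · refine IsZero.eq_of_src (isZero_tensor_left ?_) _ _
      rw [Finset.mem_Icc, not_and_or, not_le, not_le] at hp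
      obtain hp | hp := hp
      · exact K.isZero_of_isStrictlyGE a p hp
      · exact K.isZero_of_isStrictlyLE b p hp
  · rw [CochainComplex.isStrictlyGE_iff]
    intro i hi
    rw [IsZero.iff_id_eq_zero]
    refine HomologicalComplex.mapBifunctor.hom_ext fun p q h => IsZero.eq_of_src ?_ _ _
    by_cases hp : p < a
    · exact isZero_tensor_left (K.isZero_of_isStrictlyGE a p hp)
    · exact isZero_tensor_right (L.isZero_of_isStrictlyGE c q (by 
        change p + q = i at h
        lia))
  · rw [CochainComplex.isStrictlyLE_iff]
    intro i hi
    rw [IsZero.iff_id_eq_zero]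
    refine HomologicalComplex.mapBifunctor.hom_ext fun p q h => IsZero.eq_of_src ?_ _ _
    by_cases hp : b < p
    · exact isZero_tensor_left (K.isZero_of_isStrictlyLE b p hp)
    · exact isZero_tensor_right (L.isZero_of_isStrictlyLE d q (by 
        change p + q = i at h
        lia))

instance : (boundedFd k A).IsMonoidal where
  prop_unit := boundedFd_unit
  prop_tensor := boundedFd_tensor

/-- The monoidal category of bounded complexes of finite-dimensional modules. -/
abbrev Cb (k A : Type u) [Field k] [Ring A] [Algebra k A] : Type (u + 1) :=
  (boundedFd k A).FullSubcategory

/-- The quasi-isomorphisms in `Cb`. -/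
def qis (k A : Type u) [Field k] [Ring A] [Algebra k A] : MorphismProperty (Cb k A) :=
  (HomologicalComplex.quasiIso (AMod k A) (.up ℤ)).inverseImage (boundedFd k A).ι

instance : (qis k A).IsMonoidal where
  whiskerLeft X Y₁ Y₂ g hg := by
    obtain ⟨a, _⟩ := Y₁.2.2.1
    obtain ⟨b, _⟩ := Y₂.2.2.1
    have : QuasiIso g.hom := hg
    exact quasiIso_tensor_right (L := X.1) g.hom a b
  whiskerRight {Y₁ Y₂} g hg X := by
    obtain ⟨a, _⟩ := Y₁.2.2.1
    obtain ⟨b, _⟩ := Y₂.2.2.1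
    have : QuasiIso g.hom := hg
    exact quasiIso_tensor_left (L := X.1) g.hom a b
  id_mem X := inferInstanceAs (QuasiIso (𝟙 X.1))
  comp_mem f g hf hg := by
    have : QuasiIso f.hom := hf
    have : QuasiIso g.hom := hg
    exact inferInstanceAs (QuasiIso (f.hom ≫ g.hom))

instance : (fd k A).IsMonoidal where
  prop_unit := fd_unit
  prop_tensor _ _ := fd_tensor

end finite

end WeakBialgebra

namespace WeakBialgebra

section bounded

open Pretriangulated HomotopicalAlgebra HomologicalComplex ZeroObject

variable (C : Type*) [Category* C] [Abelian C]

/-- Bounded cochain complexes. -/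
def bdd (C : Type*) [Category* C] [Abelian C] : ObjectProperty (CochainComplex C ℤ) := fun K =>
  (∃ a, K.IsStrictlyGE a) ∧ ∃ b, K.IsStrictlyLE b

/-- The bounded complexes among the bounded below complexes up to homotopy. -/
def kb (C : Type*) [Category* C] [Abelian C] : ObjectProperty (HomotopyCategory.Plus C) := fun K =>
  ∃ L, bdd C L ∧ Nonempty ((HomotopyCategory.quotient C (.up ℤ)).obj L ≅ K.obj)

variable {C}

theorem bdd.le {K : CochainComplex C ℤ} (hK : bdd C K) :
    CochainComplex.plus C K := hK.1

/-- A bounded complex, up to homotopy. -/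
def plusMk (K : CochainComplex C ℤ) (hK : bdd C K) : HomotopyCategory.Plus C :=
  ⟨(HomotopyCategory.quotient _ _).obj K, (HomotopyCategory.plus_quotient_obj_iff _).2 hK.1⟩

theorem kb_plusMk (K : CochainComplex C ℤ) (hK : bdd C K) : kb C (plusMk K hK) :=
  ⟨K, hK, ⟨Iso.refl _⟩⟩

theorem kb_iff {K : HomotopyCategory.Plus C} (hK : kb C K) :
    ∃ L hL, Nonempty (plusMk L hL ≅ K) := by
  obtain ⟨L, hL, ⟨e⟩⟩ := hK
  exact ⟨L, hL, ⟨(HomotopyCategory.Plus.ι C).preimageIso e⟩⟩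

instance : (kb C).IsClosedUnderIsomorphisms where
  of_iso e := by
    rintro ⟨L, hL, ⟨e'⟩⟩
    exact ⟨L, hL, ⟨e' ≪≫ (HomotopyCategory.Plus.ι C).mapIso e⟩⟩

theorem bdd_cylinder (K : CochainComplex C ℤ) (hK : bdd C K) : bdd C (cylinder K) := by
  refine ⟨CochainComplex.plus_cylinder K hK.1, ?_⟩
  obtain ⟨n, hn⟩ := hK.2
  refine ⟨n, ?_⟩
  rw [CochainComplex.isStrictlyLE_iff]
  intro i hi
  refine homotopyCofiber.isZero_X (biprod.lift (𝟙 K) (-𝟙 K)) i ?_ (fun j hj ↦ ?_)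
  · refine IsZero.of_iso ?_ ((HomologicalComplex.eval C (.up ℤ) i).mapBiprod _ _)
    exact (biprod_isZero_iff _ _).2 ⟨K.isZero_of_isStrictlyLE n i hi, K.isZero_of_isStrictlyLE n i hi⟩
  · simp only [ComplexShape.up_Rel] at hj
    exact K.isZero_of_isStrictlyLE n _ (by lia)

theorem bdd_mappingCone {K L : CochainComplex C ℤ} (f : K ⟶ L) (hK : bdd C K) (hL : bdd C L) :
    bdd C (CochainComplex.mappingCone f) := by
  obtain ⟨⟨m₁, _⟩, ⟨n₁, _⟩⟩ := hK
  obtain ⟨⟨m₂, _⟩, ⟨n₂, _⟩⟩ := hL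
  refine ⟨⟨min (m₁ - 1) m₂, CochainComplex.isStrictlyGE_mappingCone f m₁ m₂ _
        (by simp) (by simp)⟩, ⟨max (n₁ - 1) n₂, ?_⟩⟩
  rw [CochainComplex.isStrictlyLE_iff]
  intro i hi
  rw [CochainComplex.mappingCone.isZero_X_iff]
  exact ⟨K.isZero_of_isStrictlyLE n₁ _, L.isZero_of_isStrictlyLE n₂ _⟩

theorem bdd_truncLE {K : CochainComplex C ℤ} (a b : ℤ) [K.IsStrictlyGE a] :
    bdd C (K.truncLE b) := by
  refine ⟨⟨a, ?_⟩, ⟨b, inferInstance⟩⟩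
  rw [CochainComplex.isStrictlyGE_iff]
  intro i hi
  have : Mono ((K.ιTruncLE b).f i) := inferInstanceAs (Mono
    ((HomologicalComplex.ιTruncLE K (ComplexShape.embeddingUpIntLE b)).f i))
  exact IsZero.of_mono ((K.ιTruncLE b).f i) (K.isZero_of_isStrictlyGE a i hi)

theorem isZero_quotient_zero :
    IsZero ((HomotopyCategory.quotient C (.up ℤ)).obj (0 : CochainComplex C ℤ)) :=
  Functor.map_isZero (HomotopyCategory.quotient C (.up ℤ)) (isZero_zero (CochainComplex C ℤ))

theorem bdd_zero : bdd C (0 : CochainComplex C ℤ) := ⟨⟨0, inferInstance⟩, ⟨0, inferInstance⟩⟩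

instance : (kb C).ContainsZero where
  exists_zero := ⟨plusMk 0 bdd_zero,
    IsZero.of_full_of_faithful_of_isZero (HomotopyCategory.Plus.ι C) _ isZero_quotient_zero,
    kb_plusMk _ _⟩

instance : (kb C).IsStableUnderShift ℤ where
  isStableUnderShiftBy n :=
    { le_shift K hK := by
        obtain ⟨L, ⟨⟨a, _⟩, ⟨b, _⟩⟩, ⟨e⟩⟩ := hK
        exact ⟨(shiftFunctor (CochainComplex C ℤ) n).obj L,
          ⟨⟨a - n, L.isStrictlyGE_shift a n (a - n) (by lia)⟩,
            ⟨b - n, L.isStrictlyLE_shift b n (b - n) (by lia)⟩⟩,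
          ⟨((HomotopyCategory.quotient C (.up ℤ)).commShiftIso n).app L ≪≫
            (shiftFunctor _ n).mapIso e ≪≫
            (((HomotopyCategory.Plus.ι C).commShiftIso n).app K).symm⟩⟩ }

instance : (kb C).IsTriangulatedClosed₃ where
  ext₃' T hT h₁ h₂ := by
    obtain ⟨K, hK, ⟨e₁⟩⟩ := h₁
    obtain ⟨L, hL, ⟨e₂⟩⟩ := h₂
    let T' := (HomotopyCategory.Plus.ι C).mapTriangle.obj T
    have hT' : T' ∈ distTriang _ := (HomotopyCategory.Plus.ι C).map_distinguished _ hT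
    obtain ⟨f : K ⟶ L, hf⟩ :=
      (HomotopyCategory.quotient _ _).map_surjective (e₁.hom ≫ T.mor₁.hom ≫ e₂.inv)
    refine (kb C).le_isoClosure _ ⟨CochainComplex.mappingCone f, bdd_mappingCone f hK hL,
      ⟨(Triangle.π₃.mapIso (isoTriangleOfIso₁₂ T'
        (CochainComplex.mappingCone.triangleh f) hT'
        (HomotopyCategory.mappingCone_triangleh_distinguished f)
        e₁.symm e₂.symm ?_)).symm⟩⟩
    change T.mor₁.hom ≫ e₂.inv = e₁.inv ≫ (HomotopyCategory.quotient _ _).map f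
    rw [hf, Iso.inv_hom_id_assoc]

instance : (kb C).IsTriangulated where
  toIsTriangulatedClosed₂ := .of_isTriangulatedClosed₃

instance : (kb C).IsVerdierLeftLocalizing (HomotopyCategory.Plus.subcategoryAcyclic C) where
  fac {K L} φ hK hL := by
    obtain ⟨K', ⟨_, ⟨b, _⟩⟩, ⟨e⟩⟩ := hK
    obtain ⟨a, _⟩ := (HomotopyCategory.plus_quotient_obj_iff L.obj.as).1 L.property
    let L' : CochainComplex C ℤ := L.obj.as
    have : L'.IsStrictlyGE a := by assumption
    obtain ⟨f : K' ⟶ L', hf⟩ := (HomotopyCategory.quotient _ _).map_surjective (e.hom ≫ φ.hom)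
    have hL : L'.Acyclic :=
      (HomotopyCategory.quotient_obj_mem_subcategoryAcyclic_iff_acyclic L').1 hL
    refine ⟨plusMk (L'.truncLE b) (bdd_truncLE a b),
      ObjectProperty.homMk (e.inv ≫ (HomotopyCategory.quotient _ _).map
        (inv (K'.ιTruncLE b) ≫ CochainComplex.truncLEMap f b)),
      ObjectProperty.homMk ((HomotopyCategory.quotient _ _).map (L'.ιTruncLE b)),
      kb_plusMk _ _, ?_, ?_⟩
    · refine (HomotopyCategory.quotient_obj_mem_subcategoryAcyclic_iff_acyclic (L'.truncLE b)).2 ?_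
      rw [CochainComplex.acyclic_truncLE_iff L' b (b + 1), CochainComplex.isGE_iff]
      exact fun i _ => hL i
    · refine (HomotopyCategory.Plus.ι C).map_injective ?_
      refine (Category.assoc _ _ _).trans ((congrArg (e.inv ≫ ·)
        (((HomotopyCategory.quotient _ _).map_comp _ _).symm.trans
          (Eq.trans ?_ hf))).trans (Iso.inv_hom_id_assoc e _))
      congr 1
      rw [Category.assoc, CochainComplex.ιTruncLE_naturality, IsIso.inv_hom_id_assoc]

open DerivedCategory.TStructure

/-- The functor from bounded complexes to bounded complexes up to homotopy. -/
def quotB (C : Type*) [Category* C] [Abelian C] :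
    (bdd C).FullSubcategory ⥤ (kb C).FullSubcategory :=
  (kb C).lift ((HomotopyCategory.plus C).lift
    ((bdd C).ι ⋙ HomotopyCategory.quotient C (.up ℤ))
      fun K => (HomotopyCategory.plus_quotient_obj_iff _).2 K.property.1)
    fun K => kb_plusMk K.obj K.property

instance : (quotB C).EssSurj where
  mem_essImage K := by
    obtain ⟨L, hL, ⟨e⟩⟩ := kb_iff K.property
    exact ⟨⟨L, hL⟩, ⟨(kb C).ι.preimageIso e⟩⟩

instance : (quotB C).Full where
  map_surjective f := by
    obtain ⟨g, hg⟩ := (HomotopyCategory.quotient C (.up ℤ)).map_surjective f.hom.hom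
    exact ⟨ObjectProperty.homMk g, ((kb C).ι ⋙ HomotopyCategory.Plus.ι C).map_injective hg⟩

instance : (quotB C).IsLocalization
    ((homotopyEquivalences C (.up ℤ)).inverseImage (bdd C).ι) :=
  Functor.isLocalization_of_essSurj_of_full_of_exists_cylinders _ _
    (fun _ _ f hf ↦ by
      have h : IsIso ((HomotopyCategory.quotient C (.up ℤ)).map f.hom) := by
        have h' := hf
        change homotopyEquivalences C (.up ℤ) f.hom at h'
        rw [← HomotopyCategory.inverseImage_quotient_isomorphisms] at h'
        exact h'
      have h' : IsIso (((kb C).ι ⋙ HomotopyCategory.Plus.ι C).map ((quotB C).map f)) := h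
      exact isIso_of_reflects_iso _ ((kb C).ι ⋙ HomotopyCategory.Plus.ι C)) (by
    rintro K L f₀ f₁ hf
    obtain ⟨f₀, rfl⟩ := ObjectProperty.homMk_surjective f₀
    obtain ⟨f₁, rfl⟩ := ObjectProperty.homMk_surjective f₁
    replace hf := HomotopyCategory.homotopyOfEq f₀ f₁
      (((kb C).ι ⋙ HomotopyCategory.Plus.ι C).congr_map hf)
    exact ⟨K.obj.precylinder.toFullSubcategory (bdd_cylinder K.obj K.property),
      Precylinder.LeftHomotopy.fullSubcategoryEquiv.symm
      { h := cylinder.desc _ _ hf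
        h₀ := cylinder.ι₀_desc _ _ hf
        h₁ := cylinder.ι₁_desc _ _ hf }, ⟨cylinder.homotopyEquiv _ (fun n ↦ ⟨n - 1, by simp⟩), rfl⟩⟩)

variable [HasDerivedCategory C]

variable (C) in
/-- The functor from bounded complexes up to homotopy to the bounded derived category. -/
def QhB : (kb C).FullSubcategory ⥤ DerivedCategory.Bounded C :=
  t.bounded.lift ((kb C).ι ⋙ HomotopyCategory.Plus.ι C ⋙ DerivedCategory.Qh) fun K =>
    ⟨(DerivedCategory.Plus.Qh.obj K.obj).property, by
      obtain ⟨L, ⟨_, ⟨n, hn⟩⟩, ⟨e⟩⟩ := K.property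
      exact ⟨n, ⟨L, DerivedCategory.Qh.mapIso e.symm ≪≫ (DerivedCategory.quotientCompQhIso C).app L,
        hn⟩⟩⟩

instance : (QhB C).EssSurj where
  mem_essImage := by
    rintro ⟨X, ⟨a, ha⟩, ⟨b, hb⟩⟩
    obtain ⟨K, hK, hK', ⟨e⟩⟩ := X.exists_iso_Q_obj_of_isGE_of_isLE a b
    exact ⟨⟨plusMk K ⟨⟨a, hK⟩, ⟨b, hK'⟩⟩, kb_plusMk _ _⟩,
      ⟨DerivedCategory.Bounded.ι.preimageIso
        ((DerivedCategory.quotientCompQhIso C).app K ≪≫ e.symm)⟩⟩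

/-- The inclusion of the bounded derived category in the bounded below one. -/
def boundedToPlus : DerivedCategory.Bounded C ⥤ DerivedCategory.Plus C :=
  ObjectProperty.ιOfLE inf_le_left

instance : (boundedToPlus (C := C)).Full := ObjectProperty.full_ιOfLE _
instance : (boundedToPlus (C := C)).Faithful := ObjectProperty.faithful_ιOfLE _

instance : (QhB C).IsLocalization ((HomotopyCategory.Plus.subcategoryAcyclic C).inverseImage
    (kb C).ι).trW :=
  ((kb C).triangulatedLocalizerMorphism
    (HomotopyCategory.Plus.subcategoryAcyclic C)).isLocalization_of_isLocalizedFullyFaithful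
      (L₂ := DerivedCategory.Plus.Qh) (L₁ := QhB C) (F := boundedToPlus) (Iso.refl _)

variable (C) in
/-- The functor from bounded complexes to the bounded derived category. -/
def QB : (bdd C).FullSubcategory ⥤ DerivedCategory.Bounded C :=
  quotB C ⋙ QhB C

variable (C) in
/-- The quasi-isomorphisms between bounded complexes. -/
def qisB : MorphismProperty (bdd C).FullSubcategory :=
  (HomologicalComplex.quasiIso C (.up ℤ)).inverseImage (bdd C).ι

theorem isIso_QB_map_iff {K L : (bdd C).FullSubcategory} (f : K ⟶ L) :
    IsIso ((QB C).map f) ↔ qisB C f := by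
  rw [← isIso_iff_of_reflects_iso _ DerivedCategory.Bounded.ι]
  exact ((MorphismProperty.isomorphisms _).arrow_mk_iso_iff
    (Arrow.isoOfNatIso (DerivedCategory.quotientCompQhIso C) f.hom)).trans
    (DerivedCategory.isIso_Q_map_iff_quasiIso C f.hom)

instance : (QB C).IsLocalization (qisB C) := by
  refine Functor.IsLocalization.comp (quotB C) (QhB C)
    ((homotopyEquivalences C (.up ℤ)).inverseImage (bdd C).ι)
    ((HomotopyCategory.Plus.subcategoryAcyclic C).inverseImage (kb C).ι).trW (qisB C)
    (fun K L f hf => (isIso_QB_map_iff f).2 hf) ?_ ?_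
  · intro K L f hf
    obtain ⟨e, he : e.hom = f.hom⟩ := hf
    change QuasiIso f.hom
    rw [← he]
    exact e.quasiIso_hom
  · intro K L f hf
    let e := (quotB C).objObjPreimageIso K
    let e' := (quotB C).objObjPreimageIso L
    obtain ⟨g, hg⟩ := (quotB C).map_surjective (e.hom ≫ f ≫ e'.inv)
    have hg' : (quotB C).map g ≫ e'.hom = e.hom ≫ f := by
      rw [hg, Category.assoc, Category.assoc, Iso.inv_hom_id, Category.comp_id]
    refine ⟨_, _, g, (isIso_QB_map_iff g).1 ?_, ⟨Arrow.isoMk e e' hg'.symm⟩⟩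
    have : IsIso ((QhB C).map f) := Localization.inverts (QhB C) _ f hf
    change IsIso ((QhB C).map ((quotB C).map g))
    rw [hg, Functor.map_comp, Functor.map_comp]
    infer_instance

end bounded

end WeakBialgebra

namespace WeakBialgebra

variable {k A : Type u} [Field k] [Ring A] [Algebra k A]

section derived

theorem fd_of_mono {M N : AMod k A} (f : M ⟶ N) [Mono f] (hN : fd k A N) : fd k A M := by
  have : FiniteDimensional k ((U k A).obj N) := hN
  exact FiniteDimensional.of_injective ((U k A).map f).hom
    ((ModuleCat.mono_iff_injective _).1 inferInstance)

theorem fd_of_epi {M N : AMod k A} (f : M ⟶ N) [Epi f] (hM : fd k A M) : fd k A N := by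
  have : FiniteDimensional k ((U k A).obj M) := hM
  exact FiniteDimensional.of_surjective ((U k A).map f).hom
    ((ModuleCat.epi_iff_surjective _).1 inferInstance)

instance : (fd k A).IsClosedUnderIsomorphisms where
  of_iso e h := fd_of_epi e.hom h

instance : (fd k A).ContainsZero where
  exists_zero := by
    obtain ⟨Z, hZ⟩ := HasZeroObject.zero (C := AMod k A)
    exact ⟨Z, hZ, fd_of_isZero hZ⟩

instance : (fd k A).IsClosedUnderSubobjects where
  prop_of_mono f _ h := fd_of_mono f h

instance : (fd k A).IsClosedUnderQuotients where
  prop_of_epi f _ h := fd_of_epi f h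

instance : (fd k A).IsClosedUnderFiniteProducts where
  isClosedUnderLimitsOfShape J _ :=
    { limitsOfShape_le := by
        rintro X ⟨p⟩
        have hfd (j : J) : FiniteDimensional k ((U k A).obj (p.diag.obj ⟨j⟩)) :=
          p.prop_diag_obj ⟨j⟩
        have h := isLimitOfPreserves (U k A) p.isLimit
        let φ : (U k A).obj X →ₗ[k] ∀ j : J, (U k A).obj (p.diag.obj ⟨j⟩) :=
          LinearMap.pi fun j : J => ((U k A).map (p.π.app ⟨j⟩)).hom
        exact FiniteDimensional.of_injective φ
          fun x y hxy => Concrete.isLimit_ext _ h x y fun ⟨j⟩ =>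
            show φ x j = φ y j from congrFun hxy j }

/-- The category of finite-dimensional left modules. -/
abbrev FDMod (k A : Type u) [Field k] [Ring A] [Algebra k A] : Type (u + 1) :=
  (fd k A).FullSubcategory

instance : HasDerivedCategory (FDMod k A) := HasDerivedCategory.standard _

/-- The bounded derived category of the category of finite-dimensional left modules. -/
abbrev Db (k A : Type u) [Field k] [Ring A] [Algebra k A] : Type (u + 1) :=
  DerivedCategory.Bounded (FDMod k A)

/-- A bounded complex of finite-dimensional modules, as a complex in `FDMod`. -/
def liftFd (k A : Type u) [Field k] [Ring A] [Algebra k A] :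
    Cb k A ⥤ (bdd (FDMod k A)).FullSubcategory :=
  (bdd (FDMod k A)).lift
    (HomologicalComplex.liftFunctorObjectProperty (fd k A) (boundedFd k A).ι fun K => K.property.1)
    fun K => by
      obtain ⟨_, ⟨a, ha⟩, ⟨b, hb⟩⟩ := K.property
      refine ⟨⟨a, (CochainComplex.isStrictlyGE_iff _ _).2 fun i hi => ?_⟩,
        ⟨b, (CochainComplex.isStrictlyLE_iff _ _).2 fun i hi => ?_⟩⟩
      · exact IsZero.of_full_of_faithful_of_isZero (fd k A).ι _
          (K.obj.isZero_of_isStrictlyGE a i hi)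
      · exact IsZero.of_full_of_faithful_of_isZero (fd k A).ι _
          (K.obj.isZero_of_isStrictlyLE b i hi)

/-- A bounded complex in `FDMod`, as a bounded complex of finite-dimensional modules. -/
def unliftFd (k A : Type u) [Field k] [Ring A] [Algebra k A] :
    (bdd (FDMod k A)).FullSubcategory ⥤ Cb k A :=
  (boundedFd k A).lift ((bdd (FDMod k A)).ι ⋙ (fd k A).ι.mapHomologicalComplex (.up ℤ)) fun K => by
    obtain ⟨⟨a, ha⟩, ⟨b, hb⟩⟩ := K.property
    refine ⟨fun n => (K.obj.X n).property,
      ⟨a, (CochainComplex.isStrictlyGE_iff _ _).2 fun i hi => ?_⟩,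
      ⟨b, (CochainComplex.isStrictlyLE_iff _ _).2 fun i hi => ?_⟩⟩
    · exact (fd k A).ι.map_isZero (K.obj.isZero_of_isStrictlyGE a i hi)
    · exact (fd k A).ι.map_isZero (K.obj.isZero_of_isStrictlyLE b i hi)

/-- Bounded complexes of finite-dimensional modules are the bounded complexes in `FDMod`. -/
def liftFdEquiv (k A : Type u) [Field k] [Ring A] [Algebra k A] :
    (bdd (FDMod k A)).FullSubcategory ≌ Cb k A where
  functor := unliftFd k A
  inverse := liftFd k A
  unitIso := Iso.refl _
  counitIso := Iso.refl _
  functor_unitIso_comp _ := Category.comp_id _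

instance : (fd k A).ι.PreservesHomology where
  preservesKernels _ _ f := (fd k A).preservesKernels_ι f
  preservesCokernels _ _ f := (fd k A).preservesCokernels_ι f

theorem quasiIso_fd_iff {K L : CochainComplex (FDMod k A) ℤ} (f : K ⟶ L) :
    QuasiIso (((fd k A).ι.mapHomologicalComplex (.up ℤ)).map f) ↔ QuasiIso f :=
  HomologicalComplex.quasiIso_map_iff_of_preservesHomology f (fd k A).ι

/-- The canonical functor from bounded complexes to the bounded derived category. -/
def toDb (k A : Type u) [Field k] [Ring A] [Algebra k A] : Cb k A ⥤ Db k A :=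
  liftFd k A ⋙ QB (FDMod k A)

instance : (toDb k A).IsLocalization (qis k A) := by
  refine Functor.IsLocalization.of_equivalence_source (QB (FDMod k A)) (qisB (FDMod k A))
    (toDb k A) (qis k A) (liftFdEquiv k A) ?_ ?_ (Iso.refl _)
  · intro K L f hf
    exact (qis k A).le_isoClosure _ ((quasiIso_fd_iff f.hom).2 hf)
  · intro K L f hf
    exact (isIso_QB_map_iff ((liftFd k A).map f)).2 ((quasiIso_fd_iff _).1 hf)

variable [WeakBialgebra k A] [Module.Finite k A]

instance : MonoidalCategory (Db k A) :=
  inferInstanceAs (MonoidalCategory (LocalizedMonoidal (toDb k A) (qis k A) (Iso.refl _)))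

end derived

end WeakBialgebra

namespace WeakBialgebra

variable {k A : Type u} [Field k] [Ring A] [Algebra k A]

section tstructure

open Triangulated DerivedCategory.TStructure

/-- The standard embedding of finite-dimensional modules in the bounded derived category, as
complexes concentrated in degree zero. -/
def emb (k A : Type u) [Field k] [Ring A] [Algebra k A] : FDMod k A ⥤ Db k A :=
  t.bounded.lift (DerivedCategory.singleFunctor (FDMod k A) 0)
    fun _ => ⟨⟨0, inferInstance⟩, ⟨0, inferInstance⟩⟩

/-- The canonical t-structure on the bounded derived category. -/
def canonical (k A : Type u) [Field k] [Ring A] [Algebra k A] : TStructure (Db k A) :=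
  t.onBounded

variable {T : Type*} [Category* T] [Preadditive T] [HasZeroObject T] [HasShift T ℤ]
  [∀ n : ℤ, (shiftFunctor T n).Additive] [Pretriangulated T]

/-- A t-structure is hereditary if it is bounded and `Hom(X, Y[n]) = 0` for all `X`, `Y` in the
heart and all `n ≥ 2`. -/
structure IsHereditary (t : TStructure T) : Prop where
  bounded (X : T) : ∃ m n : ℤ, m ≤ n ∧ t.le n X ∧ t.ge m X
  hom_eq_zero (X Y : T) (hX : t.heart X) (hY : t.heart Y) (n : ℤ) (hn : 2 ≤ n) (f : X ⟶ Y⟦n⟧) :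
    f = 0

variable [MonoidalCategory T]

/-- `T^{≥ D} ⊗ T^{≥ D} ⊆ T^{≥ D}` -/
def TensorGE (t : TStructure T) (D : ℕ) : Prop :=
  ∀ X Y : T, t.ge D X → t.ge D Y → t.ge D (X ⊗ Y)

/-- An mtt-structure: a t-structure suitably compatible with the tensor product. -/
structure IsMtt (t : TStructure T) : Prop where
  tensor_le (X Y : T) (hX : t.le 0 X) (hY : t.le 0 Y) : t.le 0 (X ⊗ Y)
  not_tensor_le : ¬ ∀ X Y : T, t.le 0 X → t.le 0 Y → t.le (-1) (X ⊗ Y)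
  le_summand : (t.le 0).IsStableUnderRetracts
  ge_summand : (t.ge 0).IsStableUnderRetracts
  exists_tensorGE : ∃ D : ℕ, TensorGE t D

/-- The deviation of an mtt-structure is `D`, the least natural number with
`T^{≥ D} ⊗ T^{≥ D} ⊆ T^{≥ D}`. -/
def HasDeviation (t : TStructure T) (D : ℕ) : Prop :=
  IsLeast {D : ℕ | TensorGE t D} D

/-- Hereditary mtt-structures of deviation zero. -/
structure IsHereditaryMttZero (t : TStructure T) : Prop where
  hereditary : IsHereditary t
  mtt : IsMtt t
  deviation : HasDeviation t 0

end tstructure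

section curvature

open scoped ENNReal

variable (k) {C : Type*} [Category* C] [Preadditive C] [Linear k C]

/-- A finite brick set: the endomorphism rings are `k`, and there are no nonzero morphisms
between distinct members. -/
structure IsBrickSet {n : ℕ} (X : Fin n → C) : Prop where
  brick (i : Fin n) : Function.Bijective fun c : k => c • 𝟙 (X i)
  hom_eq_zero (i j : Fin n) (h : i ≠ j) (f : X i ⟶ X j) : f = 0

/-- The adjacency matrix, with entries `dim Hom(X i, σ (X j))`. -/
def adjMatrix {n : ℕ} (X : Fin n → C) (σ : C → C) : Matrix (Fin n) (Fin n) ℂ :=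
  Matrix.of fun i j => (Module.finrank k (X i ⟶ σ (X j)) : ℂ)

/-- The Frobenius-Perron curvature of an endofunctor: the supremum, over all finite brick sets,
of `limsup ρ(A(X, σⁿ)) ^ (1 / n)`, where `ρ` is the spectral radius. -/
def fpv (σ : C ⥤ C) : ℝ≥0∞ :=
  ⨆ (n : ℕ) (X : Fin n → C) (_ : IsBrickSet k X),
    Filter.limsup (fun m : ℕ => spectralRadius ℂ (adjMatrix k X σ.obj^[m]) ^ (1 / m : ℝ))
      Filter.atTop

variable (C)

/-- Hom-finite, all objects have finite length, finitely many simple objects up to isomorphism. -/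
structure IsFiniteLength : Prop where
  hom_finite (M N : C) : FiniteDimensional k (M ⟶ N)
  finite_length (M : C) : IsArtinianObject M ∧ IsNoetherianObject M
  finite_simple : ∃ (n : ℕ) (S : Fin n → C), (∀ i, Simple (S i)) ∧
    ∀ M : C, Simple M → ∃ i, Nonempty (M ≅ S i)

variable [MonoidalCategory C]

/-- Discrete monoidal categories. -/
structure IsDiscreteMonoidal : Prop extends IsFiniteLength k C where
  tensor_iso (S S' : C) [Simple S] [Simple S'] (h : Nonempty (S ≅ S')) : Nonempty (S ⊗ S' ≅ S)
  tensor_zero (S S' : C) [Simple S] [Simple S'] (h : ¬ Nonempty (S ≅ S')) : IsZero (S ⊗ S')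

/-- Monoidal categories in which every nonzero object has positive Frobenius-Perron curvature. -/
structure IsFpvPositive : Prop extends IsFiniteLength k C where
  fpv_pos (M : C) (hM : ¬ IsZero M) : 0 < fpv k (tensorLeft M)

end curvature

/-- A (left) hereditary ring: all left ideals are projective. -/
def IsHereditaryRing (A : Type*) [Ring A] : Prop :=
  ∀ I : Ideal A, Module.Projective A I

end WeakBialgebra

end

open WeakBialgebra

/-! Call an object pure of degree n for a t-structure t if it lies in T^{≤n} ∩ T^{≥n}. Three facts
carry the uniqueness. If t is hereditary, an object with no nontrivial idempotents is zero or pure: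
the connecting morphism of its top truncation triangle lies in a group killed by heredity, so the
triangle splits (`IsHereditary.exists_pure`). If t is also an mtt-structure of deviation zero,
degrees add under ⊗, since the heart is closed under ⊗ and ⊗ commutes with shifts
(`IsHereditaryMttZero.tensor_pure`, `tensorShift_Db`). Finally, a bounded t-structure equals any
t-structure whose heart contains its own (`eq_of_heart_le`).

Let S be a simple module, pure of degree d for t. In the discrete case S ⊗ S ≅ S forces 2d = d. In
the fpv-positive case suppose d ≠ 0. Members of a brick set are pure as well, so the degree of (S ⊗
-)^m X_j tends to infinity or minus infinity with m. Nonzero morphisms between pure objects lower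
the degree by 0 or 1 only, so the adjacency matrices vanish for large m and fpv(S) = 0, a
contradiction (`fpv_eq_zero_of_pure`). Hence every simple module, and by extensions every module,
lies in the heart of t. The canonical t-structure is bounded and its heart is the category of
modules, so t is canonical (`IsHereditaryMttZero.eq_canonical`).

For existence, the tensor product of bounded complexes already computes the derived one, and there
degrees visibly add; the unit is a nonzero module, so tensor products do not all fall into T^{≤-1}.
Heredity holds because a simple module is A modulo a left ideal, which gives projective dimension at
most one for all modules (`hasProjectiveDimensionLT_two`).

For a monoidal triangulated equivalence F, the canonical t-structure of the target pulls back to a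
hereditary mtt-structure of deviation zero on the source, hence to the canonical one; uniqueness is
needed for A only. So F identifies the two hearts, and since `emb` is fully faithful, linear and
monoidal, the restriction of F inherits linearity and a monoidal structure. -/

namespace WeakBialgebra

/-! ### Bounded and hereditary t-structures. -/

open Triangulated Pretriangulated

variable {T : Type*} [Category* T] [Preadditive T] [HasZeroObject T] [HasShift T ℤ]
  [∀ n : ℤ, (shiftFunctor T n).Additive] [Pretriangulated T]

theorem heart_shift_iff (t : TStructure T) (X : T) (n : ℤ) :
    t.heart (X⟦n⟧) ↔ t.IsLE X n ∧ t.IsGE X n := by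
  rw [t.mem_heart_iff, t.isLE_shift_iff X n n 0, t.isGE_shift_iff X n n 0]

/-- All T^{≤n} and T^{≥n} are shifts of those for n = 0, and the other fields of a t-structure are
propositions. -/
theorem eq_of_le_zero {t₁ t₂ : TStructure T} (hle : t₁.le 0 = t₂.le 0) (hge : t₁.ge 0 = t₂.ge 0) :
    t₁ = t₂ := by
  have h₁ : t₁.le = t₂.le := funext fun n => by
    rw [← t₁.shift_le n 0 n (add_zero n), ← t₂.shift_le n 0 n (add_zero n), hle]
  have h₂ : t₁.ge = t₂.ge := funext fun n => by
    rw [← t₁.shift_ge n 0 n (add_zero n), ← t₂.shift_ge n 0 n (add_zero n), hge]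
  cases t₁
  cases t₂
  cases h₁
  cases h₂
  rfl

/-- Bounded objects are iterated extensions of objects concentrated in a single degree. -/
theorem bounded_induction (t : TStructure T) (P : T → Prop) (m n : ℤ)
    (hP₀ : ∀ X, IsZero X → P X)
    (hP₁ : ∀ X i, m ≤ i → i ≤ n → t.IsLE X i → t.IsGE X i → P X)
    (hP₂ : ∀ S ∈ distTriang T, P S.obj₁ → P S.obj₃ → P S.obj₂)
    (X : T) (hn : t.IsLE X n) (hm : t.IsGE X m) : P X := by
  suffices h : ∀ (N : ℕ) (b : ℤ) (Y : T), b < m + N → b ≤ n → t.IsLE Y b → t.IsGE Y m → P Y from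
    -- N bounds the number of degrees in [m, b]: for N = 0 the interval is empty and Y is zero, and
    -- each step removes the top degree b.
    h (n - m + 1).toNat n X (by lia) le_rfl hn hm
  intro N
  induction N with
  | zero =>
    intro b Y hb hb' _ _
    exact hP₀ _ (t.isZero Y b m (by simpa using hb))
  | succ N ih =>
    intro b Y hb hb' hY hY'
    by_cases hbm : b < m
    · exact hP₀ _ (t.isZero Y b m hbm)
    obtain ⟨X₁, X₃, h₁, h₃, f, g, δ, hT⟩ := t.exists_triangle Y (b - 1) b (by lia)
    rw [t.le_iff_isLE] at h₁
    rw [t.ge_iff_isGE] at h₃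
    -- Both truncations inherit the bounds of Y: X₃ lies between Y and X₁[1] ∈ T^{≤b-2}, and X₁ lies
    -- between X₃[-1] ∈ T^{≥b+1} and Y.
    have hX₃ : t.IsLE X₃ b := t.isLE₂ _ (rot_of_distTriang _ hT) b hY (by
      have := t.isLE_shift X₁ (b - 1) 1 (b - 2)
      exact t.isLE_of_le (X₁⟦(1 : ℤ)⟧) (b - 2) b)
    have hX₁ : t.IsGE X₁ m := t.isGE₂ _ (inv_rot_of_distTriang _ hT) m (by
      have := t.isGE_shift X₃ b (-1) (b + 1)
      exact t.isGE_of_ge (X₃⟦(-1 : ℤ)⟧) m (b + 1)) hY'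
    exact hP₂ _ hT (ih (b - 1) X₁ (by push_cast at hb; lia) (by lia) h₁ hX₁)
      (hP₁ X₃ b (by lia) hb' hX₃ h₃)

/-- A bounded t-structure is determined by its heart, and even by a lower bound for it. -/
theorem eq_of_heart_le {t₁ t₂ : TStructure T} (hb : ∀ X, ∃ m n : ℤ, t₁.IsLE X n ∧ t₁.IsGE X m)
    (h : t₁.heart ≤ t₂.heart) : t₁ = t₂ := by
  -- By dévissage it suffices to treat objects pure for t₁, where the inclusion of hearts applies
  -- after a shift.
  have key (m n : ℤ) (X : T) (h₁ : t₁.IsLE X n) (h₂ : t₁.IsGE X m) :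
      t₂.IsLE X n ∧ t₂.IsGE X m := by
    refine bounded_induction t₁ (fun X => t₂.IsLE X n ∧ t₂.IsGE X m) m n
      (fun X hX => ⟨t₂.isLE_of_isZero hX _, t₂.isGE_of_isZero hX _⟩) ?_ ?_ X h₁ h₂
    · intro X i hi hi' hX hX'
      obtain ⟨_, _⟩ := (heart_shift_iff t₂ X i).1 (h _ ((heart_shift_iff t₁ X i).2 ⟨hX, hX'⟩))
      exact ⟨t₂.isLE_of_le X i n, t₂.isGE_of_ge X m i⟩
    · exact fun S hS h₁ h₃ => ⟨t₂.isLE₂ S hS n h₁.1 h₃.1, t₂.isGE₂ S hS m h₁.2 h₃.2⟩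
  have hle (n : ℤ) (X : T) (hX : t₁.IsLE X n) : t₂.IsLE X n := by
    obtain ⟨m, _, _, hm⟩ := hb X
    exact (key m n X hX hm).1
  have hge (n : ℤ) (X : T) (hX : t₁.IsGE X n) : t₂.IsGE X n := by
    obtain ⟨_, m, hm, _⟩ := hb X
    exact (key n m X hm hX).2
  refine eq_of_le_zero ?_ ?_
  · ext X
    rw [t₁.le_iff_isLE, t₂.le_iff_isLE]
    -- For the converse, T^{≤0} is the left orthogonal of T^{≥1}, and passing to orthogonals
    -- reverses the inclusion `hge`. Boundedness of t₂ is thus not required.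
    refine ⟨hle 0 X, fun hX => (t₁.isLE_iff_orthogonal 0 1 rfl X).2 fun Y f hY => ?_⟩
    exact (t₂.isLE_iff_orthogonal 0 1 rfl X).1 hX Y f (hge 1 Y hY)
  · ext X
    rw [t₁.ge_iff_isGE, t₂.ge_iff_isGE]
    refine ⟨hge 0 X, fun hX => (t₁.isGE_iff_orthogonal (-1) 0 rfl X).2 fun Y f hY => ?_⟩
    exact (t₂.isGE_iff_orthogonal (-1) 0 rfl X).1 hX Y f (hle (-1) Y hY)

/-- For i < j this is the orthogonality of the t-structure. For i ≥ j + 2, shifting by i turns the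
map into one from the heart to the heart shifted by i - j ≥ 2. What remains possible are maps
lowering the degree by 0 or 1. -/
theorem IsHereditary.eq_zero_of_pure {t : TStructure T} (ht : IsHereditary t) {X Y : T} {i j : ℤ}
    (hX : t.IsLE X i) (hX' : t.IsGE X i) (hY : t.IsLE Y j) (hY' : t.IsGE Y j)
    (hij : i < j ∨ j + 2 ≤ i) (f : X ⟶ Y) : f = 0 := by
  obtain hij | hij := hij
  · exact t.zero f i j hij
  · let e : Y⟦i⟧ ≅ Y⟦j⟧⟦i - j⟧ := (shiftFunctorAdd' T j (i - j) i (by lia)).app Y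
    have h := ht.hom_eq_zero _ _ ((heart_shift_iff t X i).2 ⟨hX, hX'⟩)
      ((heart_shift_iff t Y j).2 ⟨hY, hY'⟩) (i - j) (by lia) (f⟦i⟧' ≫ e.hom)
    refine (shiftFunctor T i).map_injective ?_
    rw [← cancel_mono e.hom, h, Functor.map_zero, zero_comp]

/-- With respect to a hereditary t-structure, an object with no nontrivial idempotents is
concentrated in a single degree. -/
theorem IsHereditary.exists_pure {t : TStructure T} (ht : IsHereditary t) {X : T} (hX : ¬ IsZero X)
    (hid : ∀ e : X ⟶ X, e ≫ e = e → e = 0 ∨ e = 𝟙 X) : ∃ n : ℤ, t.IsLE X n ∧ t.IsGE X n := by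
  obtain ⟨m, n₀, _, hn₀, hm⟩ := ht.bounded X
  rw [t.le_iff_isLE] at hn₀
  rw [t.ge_iff_isGE] at hm
  -- Let n be the top degree of X; it exists because a nonzero X in T^{≥m} cannot lie in T^{≤z} with
  -- z < m.
  obtain ⟨n, hn, hmin⟩ := Int.exists_least_of_bdd (P := fun n => t.IsLE X n)
    ⟨m, fun z hz => not_lt.1 fun h => hX (t.isZero X z m h)⟩ ⟨n₀, hn₀⟩
  refine ⟨n, hn, ?_⟩
  obtain ⟨X₁, X₃, h₁, h₃, f, g, δ, hT⟩ := t.exists_triangle X (n - 1) n (by lia)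
  rw [t.le_iff_isLE] at h₁
  rw [t.ge_iff_isGE] at h₃
  have h₁' := t.isLE_shift X₁ (n - 1) 1 (n - 2)
  have hX₃ : t.IsLE X₃ n := t.isLE₂ _ (rot_of_distTriang _ hT) n hn
    (t.isLE_of_le (X₁⟦(1 : ℤ)⟧) (n - 2) n)
  obtain ⟨a, ha⟩ : ∃ a : ℤ, t.IsGE (X₁⟦(1 : ℤ)⟧) a := by
    obtain ⟨a, _, _, _, ha⟩ := ht.bounded (X₁⟦(1 : ℤ)⟧)
    exact ⟨a, ⟨ha⟩⟩
  -- The source X₃ is pure of degree n and X₁[1] is an iterated extension of pure objects of degrees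
  -- at most n - 2, so heredity kills every such map, in particular δ.
  have hδ : ∀ φ : X₃ ⟶ X₁⟦(1 : ℤ)⟧, φ = 0 := by
    refine bounded_induction t (fun W => ∀ φ : X₃ ⟶ W, φ = 0) a (n - 2)
      (fun W hW φ => hW.eq_of_tgt _ _) (fun W i _ hi hW hW' φ =>
        ht.eq_zero_of_pure hX₃ h₃ hW hW' (Or.inr (by lia)) φ) ?_ _ h₁' ha
    intro S hS hS₁ hS₃ φ
    obtain ⟨ψ, rfl⟩ := Triangle.coyoneda_exact₂ S hS φ (hS₃ _)
    rw [hS₁ ψ, zero_comp]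
  obtain ⟨s, hs⟩ : ∃ s : X₃ ⟶ X, 𝟙 X₃ = s ≫ g :=
    Triangle.coyoneda_exact₃ _ hT (𝟙 X₃) (hδ _)
  -- The splitting makes g ≫ s idempotent. If it is zero, then X₃ = 0 and X lies in T^{≤n-1},
  -- against the minimality of n; if it is the identity, then X ≅ X₃ is pure.
  obtain he | he := hid (g ≫ s) (by rw [Category.assoc, ← Category.assoc s, ← hs, Category.id_comp])
  · have hzero : IsZero X₃ := (IsZero.iff_id_eq_zero _).2 (by
      rw [← Category.comp_id (𝟙 X₃), hs, Category.assoc, ← Category.assoc g, he, zero_comp,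
        comp_zero])
    have := hmin (n - 1) (t.isLE₂ _ hT (n - 1) h₁ (t.isLE_of_isZero hzero _))
    lia
  · exact t.isGE_of_iso (⟨s, g, hs.symm, he⟩ : X₃ ≅ X) n

section tensor

variable [MonoidalCategory T]

/-- The tensor product commutes with shifts up to (unspecified) isomorphism. -/
structure TensorShift (T : Type*) [Category* T] [HasShift T ℤ] [MonoidalCategory T] : Prop where
  left (X Y : T) (n : ℤ) : Nonempty (X⟦n⟧ ⊗ Y ≅ (X ⊗ Y)⟦n⟧)
  right (X Y : T) (n : ℤ) : Nonempty (X ⊗ Y⟦n⟧ ≅ (X ⊗ Y)⟦n⟧)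

/-- Condition (a) gives the upper bound; the lower bound is exactly deviation zero. -/
theorem IsHereditaryMttZero.tensor_heart {t : TStructure T} (ht : IsHereditaryMttZero t) {X Y : T}
    (hX : t.heart X) (hY : t.heart Y) : t.heart (X ⊗ Y) :=
  ⟨ht.mtt.tensor_le X Y hX.1 hY.1, ht.deviation.1 X Y hX.2 hY.2⟩

/-- Degrees add: shift both factors into the heart, tensor there, and take the shifts out again. -/
theorem IsHereditaryMttZero.tensor_pure (hs : TensorShift T) {t : TStructure T}
    (ht : IsHereditaryMttZero t) {X Y : T} {i j l : ℤ} (hl : i + j = l)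
    (hX : t.IsLE X i ∧ t.IsGE X i) (hY : t.IsLE Y j ∧ t.IsGE Y j) :
    t.IsLE (X ⊗ Y) l ∧ t.IsGE (X ⊗ Y) l := by
  rw [← heart_shift_iff] at *
  obtain ⟨e⟩ := hs.left X (Y⟦j⟧) i
  obtain ⟨e'⟩ := hs.right X Y j
  exact t.heart.prop_of_iso (e ≪≫ (shiftFunctor T i).mapIso e' ≪≫
    ((shiftFunctorAdd' T j i l (by lia)).app (X ⊗ Y)).symm) (ht.tensor_heart hX hY)

end tensor

end WeakBialgebra

/-! ### Lifting monoidal structures along fully faithful functors. -/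

namespace CategoryTheory.Functor

/-- A monoidal structure on a composition with a fully faithful monoidal functor lifts. -/
@[reducible]
noncomputable def monoidalOfComp {C D E : Type*} [Category* C] [Category* D] [Category* E]
    [MonoidalCategory C] [MonoidalCategory D] [MonoidalCategory E] (F : C ⥤ D) (G : D ⥤ E)
    [G.Full] [G.Faithful] [G.Monoidal] [(F ⋙ G).Monoidal] : F.Monoidal :=
  CoreMonoidal.toMonoidal
    -- Fullness of G supplies the structure isomorphisms, and faithfulness reduces each coherence
    -- law to the corresponding law for F ⋙ G.
    { εIso := G.preimageIso ((Monoidal.εIso G).symm ≪≫ Monoidal.εIso (F ⋙ G))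
      μIso X Y := G.preimageIso ((Monoidal.μIso G _ _).symm ≪≫ Monoidal.μIso (F ⋙ G) X Y)
      μIso_hom_natural_left f X' := G.map_injective (by
        have := LaxMonoidal.μ_natural_left (F ⋙ G) f X'
        simp at this ⊢
        simp [← this])
      μIso_hom_natural_right X' f := G.map_injective (by
        have := LaxMonoidal.μ_natural_right (F ⋙ G) X' f
        simp at this ⊢
        simp [← this])
      associativity X Y Z := G.map_injective (by
        have := LaxMonoidal.associativity (F ⋙ G) X Y Z
        simp at this ⊢
        rw [Monoidal.map_whiskerRight, Monoidal.map_whiskerLeft, Monoidal.map_associator G]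
        simp [-LaxMonoidal.μ_natural_left, -LaxMonoidal.μ_natural_right, this])
      left_unitality X := G.map_injective (by
        have := LaxMonoidal.left_unitality (F ⋙ G) X
        simp at this ⊢
        simp [Monoidal.map_whiskerRight, ← this])
      right_unitality X := G.map_injective (by
        have := LaxMonoidal.right_unitality (F ⋙ G) X
        simp at this ⊢
        simp [Monoidal.map_whiskerLeft, ← this]) }

end CategoryTheory.Functor

/-! ### The embedding of objects as complexes in degree zero is monoidal. -/

namespace HomologicalComplex

variable {C : Type*} [Category* C] [MonoidalCategory C] [Preadditive C] [HasZeroObject C]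
  [MonoidalPreadditive C]
  [∀ (X₁ X₂ : GradedObject ℤ C), GradedObject.HasTensor X₁ X₂]
  [∀ X₁, PreservesColimit (Functor.empty.{0} C) ((curriedTensor C).obj X₁)]
  [∀ X₂, PreservesColimit (Functor.empty.{0} C) ((curriedTensor C).flip.obj X₂)]
  [∀ (X₁ X₂ X₃ X₄ : GradedObject ℤ C), GradedObject.HasTensor₄ObjExt X₁ X₂ X₃ X₄]
  [∀ (X₁ X₂ X₃ : GradedObject ℤ C), GradedObject.HasGoodTensor₁₂Tensor X₁ X₂ X₃]
  [∀ (X₁ X₂ X₃ : GradedObject ℤ C), GradedObject.HasGoodTensorTensor₂₃ X₁ X₂ X₃]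

variable (C) in
/-- The functor which sends an object to the complex concentrated in degree zero. -/
noncomputable abbrev single₀ : C ⥤ CochainComplex C ℤ := single C (ComplexShape.up ℤ) 0

/-- The term of degree zero of a complex concentrated in degree zero. -/
noncomputable abbrev single₀X (X : C) : ((single₀ C).obj X).X 0 ≅ X :=
  singleObjXSelf (ComplexShape.up ℤ) 0 X

/-- If p + q = i ≠ 0, then p or q is nonzero, so each summand has a zero factor. -/
theorem isZero_tensorObj_single (X Y : C) (i : ℤ) (hi : i ≠ 0) :
    IsZero (((single₀ C).obj X ⊗ (single₀ C).obj Y).X i) := by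
  rw [IsZero.iff_id_eq_zero]
  refine mapBifunctor.hom_ext fun p q h => IsZero.eq_of_src ?_ _ _
  by_cases hp : p = 0
  · exact (tensorLeft _).map_isZero (isZero_single_obj_X _ _ _ _ (by
      change p + q = i at h
      lia))
  · exact (tensorRight _).map_isZero (isZero_single_obj_X _ _ _ _ hp)

/-- The comparison of `single (X ⊗ Y)` and `single X ⊗ single Y`. -/
noncomputable def singleδ (X Y : C) :
    (single₀ C).obj (X ⊗ Y) ⟶ (single₀ C).obj X ⊗ (single₀ C).obj Y :=
  mkHomFromSingle (((single₀X X).inv ⊗ₘ (single₀X Y).inv) ≫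
      ιTensorObj ((single₀ C).obj X) ((single₀ C).obj Y) 0 0 0 (add_zero 0))
    -- Compatibility with the differential is automatic, as the target vanishes in degree 1.
    (fun i hi => (isZero_tensorObj_single X Y i fun h => by
      have : (0 : ℤ) + 1 = i := hi
      lia).eq_of_tgt _ _)

theorem singleδ_f (X Y : C) : (single₀X (X ⊗ Y)).inv ≫ (singleδ X Y).f 0 =
    ((single₀X X).inv ⊗ₘ (single₀X Y).inv) ≫
      ιTensorObj ((single₀ C).obj X) ((single₀ C).obj Y) 0 0 0 (add_zero 0) := by
  rw [singleδ, mkHomFromSingle_f, Iso.inv_hom_id_assoc]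

theorem ιTensorObj_tensorHom_f {K K' L L' : CochainComplex C ℤ} (f : K ⟶ K') (g : L ⟶ L')
    (p q n : ℤ) (h : p + q = n) :
    ιTensorObj K L p q n h ≫ (f ⊗ₘ g).f n = (f.f p ⊗ₘ g.f q) ≫ ιTensorObj K' L' p q n h :=
  GradedObject.Monoidal.ι_tensorHom ((forget C (.up ℤ)).map f) ((forget C (.up ℤ)).map g) p q n h

theorem ιTensorObj_whiskerRight_f {K K' : CochainComplex C ℤ} (f : K ⟶ K')
    (L : CochainComplex C ℤ) (p q n : ℤ) (h : p + q = n) :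
    ιTensorObj K L p q n h ≫ (f ▷ L).f n = (f.f p ▷ L.X q) ≫ ιTensorObj K' L p q n h := by
  rw [← tensorHom_id, ιTensorObj_tensorHom_f, id_f, tensorHom_id]

theorem ιTensorObj_whiskerLeft_f {L L' : CochainComplex C ℤ} (K : CochainComplex C ℤ)
    (g : L ⟶ L') (p q n : ℤ) (h : p + q = n) :
    ιTensorObj K L p q n h ≫ (K ◁ g).f n = (K.X p ◁ g.f q) ≫ ιTensorObj K L' p q n h := by
  rw [← id_tensorHom, ιTensorObj_tensorHom_f, id_f, id_tensorHom]

/-- The associator of complexes is given summand by summand by that of C. Only the summand of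
tridegree (0, 0, 0) is recorded, since it alone survives for objects in degree zero. -/
theorem ιTensorObj_associator_f (K L M : CochainComplex C ℤ) :
    ιTensorObj K L 0 0 0 (add_zero 0) ▷ M.X 0 ≫ ιTensorObj (K ⊗ L) M 0 0 0 (add_zero 0) ≫
      (α_ K L M).hom.f 0 =
    (α_ (K.X 0) (L.X 0) (M.X 0)).hom ≫ K.X 0 ◁ ιTensorObj L M 0 0 0 (add_zero 0) ≫
      ιTensorObj K (L ⊗ M) 0 0 0 (add_zero 0) := by
  have h := GradedObject.Monoidal.ιTensorObj₃'_associator_hom K.X L.X M.X 0 0 0 0 (by simp)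
  rw [GradedObject.Monoidal.ιTensorObj₃'_eq _ _ _ 0 0 0 0 _ 0 (by simp),
    GradedObject.Monoidal.ιTensorObj₃_eq _ _ _ 0 0 0 0 _ 0 (by simp), Category.assoc] at h
  exact h

theorem leftUnitor_inv_f (K : CochainComplex C ℤ) : (λ_ K).inv.f 0 =
    (λ_ (K.X 0)).inv ≫ (single₀X (𝟙_ C)).inv ▷ K.X 0 ≫
      ιTensorObj (𝟙_ (CochainComplex C ℤ)) K 0 0 0 (add_zero 0) :=
  leftUnitor'_inv K 0

theorem rightUnitor_inv_f (K : CochainComplex C ℤ) : (ρ_ K).inv.f 0 =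
    (ρ_ (K.X 0)).inv ≫ K.X 0 ◁ (single₀X (𝟙_ C)).inv ≫
      ιTensorObj K (𝟙_ (CochainComplex C ℤ)) 0 0 0 (add_zero 0) :=
  rightUnitor'_inv K 0

theorem single_map_f {X Y : C} (f : X ⟶ Y) :
    (single₀X X).inv ≫ ((single₀ C).map f).f 0 = f ≫ (single₀X Y).inv := by
  simp [single_map_f_self]

/-- Reduces the coherence laws to degree zero; composing with the inverse of `single₀X` puts them in
the form to which `singleδ_f` and `single_map_f` apply. -/
theorem single_hom_ext {X : C} {K : CochainComplex C ℤ} {f g : (single₀ C).obj X ⟶ K}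
    (h : (single₀X X).inv ≫ f.f 0 = (single₀X X).inv ≫ g.f 0) : f = g :=
  from_single_hom_ext ((cancel_epi _).1 h)

/-- The projection to the term of degree zero. -/
noncomputable def single₀π (X : C) (i : ℤ) : ((single₀ C).obj X).X i ⟶ X :=
  if hi : i = 0 then (singleObjXIsoOfEq (.up ℤ) 0 X i hi).hom else 0

theorem single₀π_zero (X : C) : single₀π X 0 = (single₀X X).hom := dif_pos rfl

instance (X Y : C) :
    IsIso (ιTensorObj ((single₀ C).obj X) ((single₀ C).obj Y) 0 0 0 (add_zero 0)) := by
  have : IsSplitMono (ιTensorObj ((single₀ C).obj X) ((single₀ C).obj Y) 0 0 0 (add_zero 0)) :=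
    ⟨⟨mapBifunctorDesc (fun p q _ => single₀π X p ⊗ₘ single₀π Y q) ≫
      ((single₀X X).inv ⊗ₘ (single₀X Y).inv), by
      rw [ι_mapBifunctorDesc_assoc, single₀π_zero, single₀π_zero, tensorHom_comp_tensorHom]
      simp⟩⟩
  -- All other summands in total degree zero vanish, so maps out are determined on the summand (0,
  -- 0).
  have : Epi (ιTensorObj ((single₀ C).obj X) ((single₀ C).obj Y) 0 0 0 (add_zero 0)) :=
    ⟨fun g h hgh => mapBifunctor.hom_ext fun p q hpq => by
      change p + q = 0 at hpq
      by_cases hp : p = 0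
      · obtain rfl : q = 0 := by lia
        subst hp
        exact hgh
      · exact ((tensorRight _).map_isZero (isZero_single_obj_X _ _ _ _ hp)).eq_of_src _ _⟩
  exact isIso_of_epi_of_isSplitMono _

instance (X Y : C) : IsIso (singleδ X Y) := by
  have (i : ℤ) : IsIso ((singleδ X Y).f i) := by
    by_cases hi : i = 0
    · subst hi
      have h := singleδ_f X Y
      rw [Iso.inv_comp_eq] at h
      rw [h]
      infer_instance
    · exact (isZero_single_obj_X _ _ _ _ hi).isIso (isZero_tensorObj_single X Y i hi) _
  exact Hom.isIso_of_components _

/-- The oplax direction is the convenient one, because its structure maps start at complexes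
concentrated in degree zero and `single_hom_ext` applies. The unit complex is by definition the unit
object in degree zero, so `η` is an identity. -/
noncomputable instance : (single₀ C).OplaxMonoidal where
  η := 𝟙 _
  δ X Y := singleδ X Y
  δ_natural_left f X' := single_hom_ext (by
    rw [comp_f, comp_f, reassoc_of% singleδ_f, reassoc_of% single_map_f, singleδ_f, ιTensorObj_whiskerRight_f,
      ← tensorHom_id, ← tensorHom_id, tensorHom_comp_tensorHom_assoc, tensorHom_comp_tensorHom_assoc,
      single_map_f, Category.comp_id, Category.id_comp])
  δ_natural_right X' f := single_hom_ext (by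
    rw [comp_f, comp_f, reassoc_of% singleδ_f, reassoc_of% single_map_f, singleδ_f, ιTensorObj_whiskerLeft_f,
      ← id_tensorHom, ← id_tensorHom, tensorHom_comp_tensorHom_assoc, tensorHom_comp_tensorHom_assoc,
      single_map_f, Category.comp_id, Category.id_comp])
  oplax_associativity X Y Z := single_hom_ext (by
    simp only [comp_f]
    rw [reassoc_of% singleδ_f, reassoc_of% single_map_f, reassoc_of% singleδ_f,
      reassoc_of% ιTensorObj_whiskerRight_f,
      ιTensorObj_whiskerLeft_f, ← tensorHom_id, tensorHom_comp_tensorHom_assoc, singleδ_f,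
      ← id_tensorHom, tensorHom_comp_tensorHom_assoc, singleδ_f, Category.comp_id, Category.comp_id,
      ← tensorHom_comp_whiskerRight_assoc, ιTensorObj_associator_f, associator_naturality_assoc,
      ← tensorHom_comp_whiskerLeft_assoc])
  oplax_left_unitality X := single_hom_ext (by
    rw [id_whiskerRight, Category.comp_id, comp_f, reassoc_of% single_map_f, singleδ_f, leftUnitor_inv_f,
      tensorHom_def', leftUnitor_inv_naturality_assoc]
    rw [Category.assoc]
    rfl)
  oplax_right_unitality X := single_hom_ext (by
    rw [whiskerLeft_id, Category.comp_id, comp_f, reassoc_of% single_map_f, singleδ_f, rightUnitor_inv_f,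
      MonoidalCategory.tensorHom_def, rightUnitor_inv_naturality_assoc]
    rw [Category.assoc]
    rfl)

noncomputable instance : (single₀ C).Monoidal :=
  have : IsIso (Functor.OplaxMonoidal.η (single₀ C)) := inferInstanceAs (IsIso (𝟙 _))
  have (X Y : C) : IsIso (Functor.OplaxMonoidal.δ (single₀ C) X Y) :=
    inferInstanceAs (IsIso (singleδ X Y))
  Functor.Monoidal.ofOplaxMonoidal (single₀ C)

end HomologicalComplex


/-! ### The monoidal embedding of modules in the bounded derived category. -/

namespace WeakBialgebra

variable {k A : Type u} [Field k] [Ring A] [Algebra k A]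

/-- Modules as bounded complexes concentrated in degree zero. -/
noncomputable def singleBdd (k A : Type u) [Field k] [Ring A] [Algebra k A] :
    FDMod k A ⥤ (bdd (FDMod k A)).FullSubcategory :=
  (bdd (FDMod k A)).lift (HomologicalComplex.single (FDMod k A) (.up ℤ) 0)
    fun _ => ⟨⟨0, inferInstance⟩, ⟨0, inferInstance⟩⟩

/-- Modules as bounded complexes of finite-dimensional modules concentrated in degree zero. -/
noncomputable def singleCb (k A : Type u) [Field k] [Ring A] [Algebra k A] : FDMod k A ⥤ Cb k A :=
  singleBdd k A ⋙ unliftFd k A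

/-- The embedding of modules in the bounded derived category factors through complexes. -/
noncomputable def embIso (k A : Type u) [Field k] [Ring A] [Algebra k A] :
    singleCb k A ⋙ toDb k A ≅ emb k A :=
  ((Functor.FullyFaithful.ofFullyFaithful
    (DerivedCategory.Bounded.ι (C := FDMod k A))).whiskeringRight _).preimageIso
    (Functor.isoWhiskerLeft (HomologicalComplex.single (FDMod k A) (.up ℤ) 0)
      (DerivedCategory.quotientCompQhIso (FDMod k A)) ≪≫
      (DerivedCategory.singleFunctorIsoCompQ (FDMod k A) 0).symm)

/-- Together with faithfulness, this lets idempotents, vanishing of objects, linearity and monoidal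
structures pass from the derived category to modules. -/
instance : (emb k A).Full :=
  have : (emb k A ⋙ DerivedCategory.Bounded.ι).Full :=
    inferInstanceAs (DerivedCategory.singleFunctor (FDMod k A) 0).Full
  Functor.Full.of_comp_faithful (emb k A) DerivedCategory.Bounded.ι

instance : (emb k A).Faithful :=
  have : (emb k A ⋙ DerivedCategory.Bounded.ι).Faithful :=
    inferInstanceAs (DerivedCategory.singleFunctor (FDMod k A) 0).Faithful
  Functor.Faithful.of_comp (emb k A) DerivedCategory.Bounded.ι

instance : (emb k A).Additive where
  map_add {_ _ f g} := DerivedCategory.Bounded.ι.map_injective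
    ((DerivedCategory.singleFunctor (FDMod k A) 0).map_add (f := f) (g := g))

instance : (emb k A).Linear k where
  map_smul f r := DerivedCategory.Bounded.ι.map_injective (by
    have h : (DerivedCategory.singleFunctor (FDMod k A) 0).map (r • f) =
        r • (DerivedCategory.singleFunctor (FDMod k A) 0).map f := Functor.map_smul _ _ _
    exact h.trans (Functor.map_smul DerivedCategory.Bounded.ι r ((emb k A).map f)).symm)

variable [WeakBialgebra k A] [Module.Finite k A]

/-- The two ways of placing a finite-dimensional module in degree zero agree. -/
noncomputable def singleCbιIso (k A : Type u) [Field k] [Ring A] [Algebra k A] :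
    singleCb k A ⋙ (boundedFd k A).ι ≅ (fd k A).ι ⋙ HomologicalComplex.single₀ (AMod k A) :=
  let e := HomologicalComplex.singleMapHomologicalComplex (fd k A).ι (.up ℤ) 0
  e

/-- Up to isomorphism, the composite with the full inclusion into all complexes is the monoidal
inclusion of finite-dimensional modules followed by the monoidal functor `single₀`. The structure is
transported to this composite and then lifted. -/
noncomputable instance : (singleCb k A).Monoidal :=
  letI : ((fd k A).ι ⋙ HomologicalComplex.single₀ (AMod k A)).Monoidal := inferInstance
  letI : (singleCb k A ⋙ (boundedFd k A).ι).Monoidal :=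
    Functor.Monoidal.transport (singleCbιIso k A).symm
  Functor.monoidalOfComp (singleCb k A) (boundedFd k A).ι

noncomputable instance : (toDb k A).Monoidal :=
  inferInstanceAs (Localization.Monoidal.toMonoidalCategory (toDb k A) (qis k A)
    (Iso.refl _)).Monoidal

/-- Up to `embIso`, the embedding is `singleCb` followed by the localization functor `toDb`, and
both are monoidal. -/
noncomputable instance : (emb k A).Monoidal :=
  Functor.Monoidal.transport (embIso k A)

end WeakBialgebra

/-! ### Shifts and tensor products in the bounded derived category. -/

namespace WeakBialgebra

open DerivedCategory.TStructure

section

variable {C : Type*} [Category* C] [Abelian C] [HasDerivedCategory C]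

/-- The image of a bounded complex in the derived category. -/
noncomputable def ιQBIso (K : (bdd C).FullSubcategory) :
    ((QB C).obj K).obj ≅ DerivedCategory.Q.obj K.obj :=
  (DerivedCategory.quotientCompQhIso C).app K.obj

theorem bdd_shift {K : CochainComplex C ℤ} (hK : bdd C K) (n : ℤ) : bdd C (K⟦n⟧) := by
  obtain ⟨⟨a, _⟩, ⟨b, _⟩⟩ := hK
  exact ⟨⟨a - n, K.isStrictlyGE_shift a n (a - n) (by lia)⟩,
    ⟨b - n, K.isStrictlyLE_shift b n (b - n) (by lia)⟩⟩

/-- The shift of a bounded complex in the derived category. -/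
noncomputable def QBShiftIso (K : (bdd C).FullSubcategory) (n : ℤ) :
    (QB C).obj ⟨K.obj⟦n⟧, bdd_shift K.property n⟩ ≅ ((QB C).obj K)⟦n⟧ :=
  DerivedCategory.Bounded.ι.preimageIso (ιQBIso _ ≪≫ (DerivedCategory.Q.commShiftIso n).app K.obj ≪≫
    (shiftFunctor _ n).mapIso (ιQBIso K).symm ≪≫
      ((DerivedCategory.Bounded.ι.commShiftIso n).app ((QB C).obj K)).symm)

end

variable {k A : Type u} [Field k] [Ring A] [Algebra k A]

theorem boundedFd_shift {K : CochainComplex (AMod k A) ℤ} (h : boundedFd k A K) (n : ℤ) :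
    boundedFd k A (K⟦n⟧) := by
  obtain ⟨h, ⟨a, _⟩, ⟨b, _⟩⟩ := h
  exact ⟨fun i => h (i + n), ⟨a - n, K.isStrictlyGE_shift a n (a - n) (by lia)⟩,
    ⟨b - n, K.isStrictlyLE_shift b n (b - n) (by lia)⟩⟩

/-- The shift of a bounded complex of finite-dimensional modules. -/
noncomputable def shiftCb (K : Cb k A) (n : ℤ) : Cb k A := ⟨K.obj⟦n⟧, boundedFd_shift K.property n⟩

/-- The shift of bounded complexes of finite-dimensional modules is computed degreewise. -/
noncomputable def unliftFdShiftIso (L : (bdd (FDMod k A)).FullSubcategory) (n : ℤ) :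
    (unliftFd k A).obj ⟨L.obj⟦n⟧, bdd_shift L.property n⟩ ≅ shiftCb ((unliftFd k A).obj L) n :=
  (boundedFd k A).ι.preimageIso
    ((((fd k A).ι.mapHomologicalComplex (.up ℤ)).commShiftIso n).app L.obj)

/-- The localization functor commutes with shifts. -/
noncomputable def toDbShiftIso (K : Cb k A) (n : ℤ) :
    (toDb k A).obj (shiftCb K n) ≅ ((toDb k A).obj K)⟦n⟧ :=
  (toDb k A).mapIso (unliftFdShiftIso ((liftFd k A).obj K) n).symm ≪≫
    QBShiftIso ((liftFd k A).obj K) n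

variable [WeakBialgebra k A] [Module.Finite k A]

/-- The tensor product of complexes commutes with shifts in the first variable. -/
noncomputable def shiftCbTensorIso (K L : Cb k A) (n : ℤ) :
    shiftCb K n ⊗ L ≅ shiftCb (K ⊗ L) n :=
  (boundedFd k A).ι.preimageIso
    (CochainComplex.mapBifunctorShift₁Iso K.obj L.obj (curriedTensor (AMod k A)) n)

/-- The tensor product of complexes commutes with shifts in the second variable. -/
noncomputable def tensorShiftCbIso (K L : Cb k A) (n : ℤ) :
    K ⊗ shiftCb L n ≅ shiftCb (K ⊗ L) n :=
  (boundedFd k A).ι.preimageIso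
    (CochainComplex.mapBifunctorShift₂Iso K.obj L.obj (curriedTensor (AMod k A)) n)

theorem exists_toDb_iso (X : Db k A) : ∃ K : Cb k A, Nonempty ((toDb k A).obj K ≅ X) :=
  have := Localization.essSurj (toDb k A) (qis k A)
  ⟨_, ⟨(toDb k A).objObjPreimageIso X⟩⟩

/-- Every object comes from a bounded complex, and `toDb` is monoidal and commutes with shifts, so
the isomorphisms of complexes descend. Naturality is not needed, as only membership in
isomorphism-closed subcategories is transported along them. -/
theorem tensorShift_Db : TensorShift (Db k A) where
  left X Y n := by
    obtain ⟨K, ⟨e⟩⟩ := exists_toDb_iso X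
    obtain ⟨L, ⟨e'⟩⟩ := exists_toDb_iso Y
    exact ⟨(((shiftFunctor _ n).mapIso e.symm ≪≫ (toDbShiftIso K n).symm) ⊗ᵢ e'.symm) ≪≫
      Functor.Monoidal.μIso (toDb k A) _ _ ≪≫ (toDb k A).mapIso (shiftCbTensorIso K L n) ≪≫
      toDbShiftIso _ n ≪≫ (shiftFunctor _ n).mapIso
        ((Functor.Monoidal.μIso (toDb k A) _ _).symm ≪≫ (e ⊗ᵢ e'))⟩
  right X Y n := by
    obtain ⟨K, ⟨e⟩⟩ := exists_toDb_iso X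
    obtain ⟨L, ⟨e'⟩⟩ := exists_toDb_iso Y
    exact ⟨(e.symm ⊗ᵢ ((shiftFunctor _ n).mapIso e'.symm ≪≫ (toDbShiftIso L n).symm)) ≪≫
      Functor.Monoidal.μIso (toDb k A) _ _ ≪≫ (toDb k A).mapIso (tensorShiftCbIso K L n) ≪≫
      toDbShiftIso _ n ≪≫ (shiftFunctor _ n).mapIso
        ((Functor.Monoidal.μIso (toDb k A) _ _).symm ≪≫ (e ⊗ᵢ e'))⟩

end WeakBialgebra

/-! ### Stability under direct summands. -/

namespace CategoryTheory.Triangulated.TStructure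

variable {T : Type*} [Category* T] [Preadditive T] [HasZeroObject T] [HasShift T ℤ]
  [∀ n : ℤ, (shiftFunctor T n).Additive] [Pretriangulated T] (t : TStructure T)

/-- Condition (b) of an mtt-structure is automatic: T^{≤n} is the left orthogonal of T^{≥n+1}, and
orthogonals are stable under retracts. The dual argument serves for T^{≥n}. -/
instance (n : ℤ) : (t.le n).IsStableUnderRetracts where
  of_retract {X Y} r hY := by
    rw [t.le_iff_isLE] at *
    rw [t.isLE_iff_orthogonal n (n + 1) rfl]
    intro Z f hZ
    rw [← Category.id_comp f, ← r.retract, Category.assoc, t.zero (r.r ≫ f) n (n + 1), comp_zero]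

instance (n : ℤ) : (t.ge n).IsStableUnderRetracts where
  of_retract {X Y} r hY := by
    rw [t.ge_iff_isGE] at *
    rw [t.isGE_iff_orthogonal (n - 1) n (by lia)]
    intro Z f hZ
    rw [← Category.comp_id f, ← r.retract, ← Category.assoc, t.zero (f ≫ r.i) (n - 1) n, zero_comp]

end CategoryTheory.Triangulated.TStructure

/-! ### The canonical t-structure is an mtt-structure of deviation zero. -/

namespace WeakBialgebra

open DerivedCategory.TStructure Triangulated

variable {k A : Type u} [Field k] [Ring A] [Algebra k A]

theorem canonical_isLE_iff (X : Db k A) (n : ℤ) :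
    (canonical k A).IsLE X n ↔ DerivedCategory.IsLE X.obj n :=
  ⟨fun h => ⟨h.le⟩, fun h => ⟨h.le⟩⟩

theorem canonical_isGE_iff (X : Db k A) (n : ℤ) :
    (canonical k A).IsGE X n ↔ DerivedCategory.IsGE X.obj n :=
  ⟨fun h => ⟨h.ge⟩, fun h => ⟨h.ge⟩⟩

theorem canonical_bounded (X : Db k A) :
    ∃ m n : ℤ, (canonical k A).IsLE X n ∧ (canonical k A).IsGE X m := by
  obtain ⟨⟨a, ha⟩, ⟨b, hb⟩⟩ := X.property
  exact ⟨a, b, (canonical_isLE_iff X b).2 hb, (canonical_isGE_iff X a).2 ha⟩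

/-- Cohomological bounds become bounds on the terms of a representing complex, so degrees of tensor
products can be read off from complexes. -/
theorem exists_toDb_iso_of_isGE_of_isLE (X : Db k A) (a b : ℤ) (ha : (canonical k A).IsGE X a)
    (hb : (canonical k A).IsLE X b) :
    ∃ K : Cb k A, K.obj.IsStrictlyGE a ∧ K.obj.IsStrictlyLE b ∧
      Nonempty ((toDb k A).obj K ≅ X) := by
  rw [canonical_isGE_iff] at ha
  rw [canonical_isLE_iff] at hb
  obtain ⟨K, _, _, ⟨e⟩⟩ := X.obj.exists_iso_Q_obj_of_isGE_of_isLE a b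
  let K' : (bdd (FDMod k A)).FullSubcategory := ⟨K, ⟨a, inferInstance⟩, ⟨b, inferInstance⟩⟩
  refine ⟨(unliftFd k A).obj K', ?_, ?_, ⟨DerivedCategory.Bounded.ι.preimageIso
    (ιQBIso K' ≪≫ e.symm)⟩⟩
  · exact (CochainComplex.isStrictlyGE_iff _ _).2 fun i hi =>
      (fd k A).ι.map_isZero (K.isZero_of_isStrictlyGE a i hi)
  · exact (CochainComplex.isStrictlyLE_iff _ _).2 fun i hi =>
      (fd k A).ι.map_isZero (K.isZero_of_isStrictlyLE b i hi)

theorem canonical_isLE_toDb (K : Cb k A) (n : ℤ) (hK : K.obj.IsStrictlyLE n) :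
    (canonical k A).IsLE ((toDb k A).obj K) n :=
  ⟨⟨((liftFd k A).obj K).obj, ιQBIso ((liftFd k A).obj K),
    (CochainComplex.isStrictlyLE_iff _ _).2 fun i hi =>
      IsZero.of_full_of_faithful_of_isZero (fd k A).ι _ (K.obj.isZero_of_isStrictlyLE n i hi)⟩⟩

theorem canonical_isGE_toDb (K : Cb k A) (n : ℤ) (hK : K.obj.IsStrictlyGE n) :
    (canonical k A).IsGE ((toDb k A).obj K) n :=
  ⟨⟨((liftFd k A).obj K).obj, ιQBIso ((liftFd k A).obj K),
    (CochainComplex.isStrictlyGE_iff _ _).2 fun i hi =>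
      IsZero.of_full_of_faithful_of_isZero (fd k A).ι _ (K.obj.isZero_of_isStrictlyGE n i hi)⟩⟩

/-- The heart of the canonical t-structure consists of the modules in degree zero. -/
theorem canonical_heart : (canonical k A).heart = (emb k A).essImage := by
  ext X
  constructor
  · rintro ⟨h, h'⟩
    have : X.obj.IsLE 0 := ⟨h⟩
    have : X.obj.IsGE 0 := ⟨h'⟩
    obtain ⟨Y, ⟨e⟩⟩ := X.obj.exists_iso_singleFunctor_obj_of_isGE_of_isLE 0
    exact ⟨Y, ⟨DerivedCategory.Bounded.ι.preimageIso e.symm⟩⟩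
  · rintro ⟨Y, ⟨e⟩⟩
    refine (canonical k A).heart.prop_of_iso e ⟨?_, ?_⟩
    · exact t.le_of_isLE ((DerivedCategory.singleFunctor (FDMod k A) 0).obj Y) 0
    · exact t.ge_of_isGE ((DerivedCategory.singleFunctor (FDMod k A) 0).obj Y) 0

/-- The regular module. -/
noncomputable def regular (k A : Type u) [Field k] [Ring A] [Algebra k A] [Module.Finite k A] :
    FDMod k A :=
  ⟨ModuleCat.of A A, (finite_iff (k := k) (A := A) (ModuleCat.of A A)).2
    (inferInstanceAs (Module.Finite A A))⟩

variable [WeakBialgebra k A] [Module.Finite k A]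

/-- If p + q > a + b, then p > a or q > b, so every summand in that degree has a zero factor. -/
theorem isStrictlyLE_tensor (K L : CochainComplex (AMod k A) ℤ) (a b : ℤ) [K.IsStrictlyLE a]
    [L.IsStrictlyLE b] : (K ⊗ L).IsStrictlyLE (a + b) := by
  rw [CochainComplex.isStrictlyLE_iff]
  intro i hi
  rw [IsZero.iff_id_eq_zero]
  refine HomologicalComplex.mapBifunctor.hom_ext fun p q h => IsZero.eq_of_src ?_ _ _
  change p + q = i at h
  by_cases hp : a < p
  · exact isZero_tensor_left (K.isZero_of_isStrictlyLE a p hp)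
  · exact isZero_tensor_right (L.isZero_of_isStrictlyLE b q (by lia))

theorem isStrictlyGE_tensor (K L : CochainComplex (AMod k A) ℤ) (a b : ℤ) [K.IsStrictlyGE a]
    [L.IsStrictlyGE b] : (K ⊗ L).IsStrictlyGE (a + b) := by
  rw [CochainComplex.isStrictlyGE_iff]
  intro i hi
  rw [IsZero.iff_id_eq_zero]
  refine HomologicalComplex.mapBifunctor.hom_ext fun p q h => IsZero.eq_of_src ?_ _ _
  change p + q = i at h
  by_cases hp : p < a
  · exact isZero_tensor_left (K.isZero_of_isStrictlyGE a p hp)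
  · exact isZero_tensor_right (L.isZero_of_isStrictlyGE b q (by lia))

/-- Monoidality of `toDb` means that the tensor product needs no resolutions, so X and Y may be
replaced by complexes in nonpositive degrees. The same argument in nonnegative degrees gives
deviation zero. -/
theorem canonical_tensor_le (X Y : Db k A) (hX : (canonical k A).le 0 X)
    (hY : (canonical k A).le 0 Y) : (canonical k A).le 0 (X ⊗ Y) := by
  obtain ⟨a, _, _, ha⟩ := canonical_bounded X
  obtain ⟨b, _, _, hb⟩ := canonical_bounded Y
  obtain ⟨K, _, hK, ⟨e⟩⟩ := exists_toDb_iso_of_isGE_of_isLE X a 0 ha ⟨hX⟩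
  obtain ⟨L, _, hL, ⟨e'⟩⟩ := exists_toDb_iso_of_isGE_of_isLE Y b 0 hb ⟨hY⟩
  exact ((canonical k A).le 0).prop_of_iso ((Functor.Monoidal.μIso (toDb k A) K L).symm ≪≫ (e ⊗ᵢ e'))
    (canonical_isLE_toDb (K ⊗ L) 0 (isStrictlyLE_tensor K.obj L.obj 0 0)).le

theorem canonical_tensorGE : TensorGE (canonical k A) 0 := by
  intro X Y hX hY
  obtain ⟨_, a, ha, _⟩ := canonical_bounded X
  obtain ⟨_, b, hb, _⟩ := canonical_bounded Y
  obtain ⟨K, hK, _, ⟨e⟩⟩ := exists_toDb_iso_of_isGE_of_isLE X 0 a ⟨hX⟩ ha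
  obtain ⟨L, hL, _, ⟨e'⟩⟩ := exists_toDb_iso_of_isGE_of_isLE Y 0 b ⟨hY⟩ hb
  exact ((canonical k A).ge 0).prop_of_iso ((Functor.Monoidal.μIso (toDb k A) K L).symm ≪≫ (e ⊗ᵢ e'))
    (canonical_isGE_toDb (K ⊗ L) 0 (isStrictlyGE_tensor K.obj L.obj 0 0)).ge

theorem canonical_heart_unit : (canonical k A).heart (𝟙_ (Db k A)) := by
  rw [canonical_heart]
  exact ⟨_, ⟨(Functor.Monoidal.εIso (emb k A)).symm⟩⟩

theorem canonical_isMtt (h : ¬ IsZero (𝟙_ (Db k A))) : IsMtt (canonical k A) where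
  tensor_le := canonical_tensor_le
  -- The unit lies in the heart and is its own tensor square; if that square were in T^{≤-1}, the
  -- unit would be zero.
  not_tensor_le hle := by
    obtain ⟨h₁, h₂⟩ := canonical_heart_unit (k := k) (A := A)
    have h₃ := ((canonical k A).le (-1)).prop_of_iso (λ_ (𝟙_ (Db k A))) (hle _ _ h₁ h₁)
    have : (canonical k A).IsLE (𝟙_ (Db k A)) (-1) := ⟨h₃⟩
    have : (canonical k A).IsGE (𝟙_ (Db k A)) 0 := ⟨h₂⟩
    exact h ((canonical k A).isZero (𝟙_ (Db k A)) (-1) 0)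
  le_summand := inferInstance
  ge_summand := inferInstance
  exists_tensorGE := ⟨0, canonical_tensorGE⟩

theorem canonical_hasDeviation : HasDeviation (canonical k A) 0 :=
  ⟨canonical_tensorGE, fun _ _ => Nat.zero_le _⟩

/-- A zero unit would annihilate every module, in particular the regular module A. -/
theorem not_isZero_unit [Nontrivial A] : ¬ IsZero (𝟙_ (Db k A)) := by
  intro h
  have h₁ : IsZero (𝟙_ (FDMod k A)) := IsZero.of_full_of_faithful_of_isZero (emb k A) _
    (h.of_iso (Functor.Monoidal.εIso (emb k A)).symm)
  have h₂ : IsZero ((fd k A).ι.obj (regular k A)) :=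
    (isZero_tensor_left ((fd k A).ι.map_isZero h₁)).of_iso ((fd k A).ι.mapIso (λ_ (regular k A)).symm)
  have := ModuleCat.subsingleton_of_isZero (R := A) h₂
  exact not_subsingleton A this

end WeakBialgebra

/-! ### Dévissage of modules and heredity of the canonical t-structure. -/

namespace WeakBialgebra

open Triangulated Pretriangulated

variable {k A : Type u} [Field k] [Ring A] [Algebra k A]

section

/-- With its dual, this supplies the decreasing dimension for induction over submodules and
quotients. -/
theorem finrank_lt_of_mono {X Y : FDMod k A} (f : X ⟶ Y) [Mono f] (hf : ¬ IsIso f) :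
    Module.finrank k ((U k A).obj X.obj) < Module.finrank k ((U k A).obj Y.obj) := by
  have : FiniteDimensional k ((U k A).obj X.obj) := X.property
  have : FiniteDimensional k ((U k A).obj Y.obj) := Y.property
  have hm : Mono ((U k A).map f.hom) := inferInstanceAs (Mono (((fd k A).ι ⋙ U k A).map f))
  have hinj : Function.Injective ((U k A).map f.hom).hom := (ModuleCat.mono_iff_injective _).1 hm
  refine lt_of_le_of_ne (LinearMap.finrank_le_finrank_of_injective hinj) fun h => hf ?_
  have he : Epi ((U k A).map f.hom) := (ModuleCat.epi_iff_surjective _).2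
    ((LinearMap.injective_iff_surjective_of_finrank_eq_finrank h).1 hinj)
  have : IsIso (((fd k A).ι ⋙ U k A).map f) := isIso_of_mono_of_epi ((U k A).map f.hom)
  exact isIso_of_reflects_iso f ((fd k A).ι ⋙ U k A)

theorem finrank_lt_of_epi {X Y : FDMod k A} (f : X ⟶ Y) [Epi f] (hf : ¬ IsIso f) :
    Module.finrank k ((U k A).obj Y.obj) < Module.finrank k ((U k A).obj X.obj) := by
  have : FiniteDimensional k ((U k A).obj X.obj) := X.property
  have : FiniteDimensional k ((U k A).obj Y.obj) := Y.property
  have hm : Epi ((U k A).map f.hom) := inferInstanceAs (Epi (((fd k A).ι ⋙ U k A).map f))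
  have hsurj : Function.Surjective ((U k A).map f.hom).hom :=
    (ModuleCat.epi_iff_surjective _).1 hm
  refine lt_of_le_of_ne (LinearMap.finrank_le_finrank_of_surjective hsurj) fun h => hf ?_
  have he : Mono ((U k A).map f.hom) := (ModuleCat.mono_iff_injective _).2
    ((LinearMap.injective_iff_surjective_of_finrank_eq_finrank h.symm).2 hsurj)
  have : IsIso (((fd k A).ι ⋙ U k A).map f) := isIso_of_mono_of_epi ((U k A).map f.hom)
  exact isIso_of_reflects_iso f ((fd k A).ι ⋙ U k A)

/-- Finite-dimensional modules are iterated extensions of simple modules. -/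
theorem fdMod_induction (P : FDMod k A → Prop) (zero : ∀ X, IsZero X → P X)
    (simple : ∀ X, Simple X → P X)
    (ext : ∀ S : ShortComplex (FDMod k A), S.ShortExact → P S.X₁ → P S.X₃ → P S.X₂)
    (X : FDMod k A) : P X := by
  induction h : Module.finrank k ((U k A).obj X.obj) using Nat.strong_induction_on generalizing X
    with | _ d ih
  by_cases hX : IsZero X
  · exact zero X hX
  by_cases hs : ∀ (Y : FDMod k A) (f : Y ⟶ X), Mono f → f ≠ 0 → IsIso f
  · refine simple X ⟨fun {Y} f _ => ⟨fun _ hf => hX ?_, hs Y f inferInstance⟩⟩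
    exact (IsZero.iff_id_eq_zero X).2 ((IsIso.inv_hom_id f).symm.trans
      ((congrArg (inv f ≫ ·) hf).trans comp_zero))
  · push Not at hs
    obtain ⟨Y, f, _, hf, hf'⟩ := hs
    -- A module that is not simple has a nonzero proper submodule; this submodule and its quotient
    -- both have smaller dimension.
    have hS : (ShortComplex.mk f (cokernel.π f) (cokernel.condition f)).ShortExact :=
      { exact := ShortComplex.exact_cokernel f }
    refine ext _ hS (ih _ (h ▸ finrank_lt_of_mono f hf') Y rfl)
      (ih _ (h ▸ finrank_lt_of_epi (cokernel.π f) fun _ => hf ?_) _ rfl)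
    rw [← cancel_mono (cokernel.π f), cokernel.condition, zero_comp]

end

/-- The module underlying an object of the category of finite-dimensional modules. -/
abbrev toMod (X : FDMod k A) : ModuleCat.{u} A := X.obj

/-- The inclusion into all modules preserves epimorphisms and is full, so a lift found among all
modules is already a lift in `FDMod`. -/
theorem projective_of_module_projective (X : FDMod k A)
    (h : Module.Projective A (toMod X)) : Projective X where
  factors {E Y} f e _ := by
    have : Projective ((fd k A).ι.obj X) :=
      (IsProjective.iff_projective (R := A) (toMod X)).1 h
    exact ⟨(fd k A).ι.preimage (Projective.factorThru ((fd k A).ι.map f) ((fd k A).ι.map e)),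
      (fd k A).ι.map_injective (by
        rw [Functor.map_comp, Functor.map_preimage, Projective.factorThru_comp])⟩

/-- A subobject of the regular module is isomorphic to its image, a left ideal, which is projective
by hypothesis. -/
theorem projective_of_mono_regular [Module.Finite k A] (hA : IsHereditaryRing A) {X : FDMod k A}
    (f : X ⟶ regular k A) [Mono f] : Projective X := by
  refine projective_of_module_projective X ?_
  let g : toMod X →ₗ[A] A := ModuleCat.Hom.hom (R := A) f.hom
  have hm : Mono ((fd k A).ι.map f) := inferInstance
  have hg : Function.Injective g :=
    (ModuleCat.mono_iff_injective (R := A) (X := toMod X) ((fd k A).ι.map f)).1 hm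
  have : Module.Projective A (LinearMap.range g) := hA _
  exact Module.Projective.of_equiv (LinearEquiv.ofInjective g hg).symm

theorem exists_hom_ne_zero {A : Type u} [Ring A] {M : ModuleCat.{u} A} (hM : ¬ IsZero M) :
    ∃ f : ModuleCat.of A A ⟶ M, f ≠ 0 := by
  contrapose! hM
  have : Subsingleton M := subsingleton_of_forall_eq 0 fun x => by
    have h := congrArg ModuleCat.Hom.hom (hM (ModuleCat.ofHom (LinearMap.toSpanSingleton A M x)))
    rw [ModuleCat.hom_ofHom, ModuleCat.hom_zero] at h
    rw [← LinearMap.toSpanSingleton_apply_one A M x, h, LinearMap.zero_apply]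
  exact ModuleCat.isZero_of_subsingleton M

/-- The bound is stable under extensions, so simple modules suffice. A simple module is a quotient
of A by a left ideal, which is a projective resolution of length one; submodules of general
projectives never enter. -/
theorem hasProjectiveDimensionLT_two [Module.Finite k A] (hA : IsHereditaryRing A)
    (X : FDMod k A) : HasProjectiveDimensionLT X 2 := by
  refine fdMod_induction (fun X => HasProjectiveDimensionLT X 2) (fun X hX => ?_) (fun X hX => ?_)
    (fun S hS h₁ h₃ => hS.hasProjectiveDimensionLT_X₂ 2 h₁ h₃) X
  · have := hX.hasProjectiveDimensionLT_zero
    exact hasProjectiveDimensionLT_of_ge X 0 2 (by lia)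
  · obtain ⟨φ, hφ⟩ := exists_hom_ne_zero (M := toMod X) fun h =>
      Simple.not_isZero X (IsZero.of_full_of_faithful_of_isZero (fd k A).ι X h)
    let f : regular k A ⟶ X := ObjectProperty.homMk φ
    have hf : f ≠ 0 := fun h => hφ (congrArg (fun φ : regular k A ⟶ X => φ.hom) h)
    have : Epi f := epi_of_nonzero_to_simple hf
    have hS : (ShortComplex.mk (kernel.ι f) f (kernel.condition f)).ShortExact :=
      { exact := ShortComplex.exact_kernel f }
    have h₁ : Projective (kernel f) := projective_of_mono_regular hA (kernel.ι f)
    have h₂ : Projective (regular k A) := projective_of_mono_regular hA (𝟙 _)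
    exact hS.hasProjectiveDimensionLT_X₃ 1 inferInstance inferInstance

/-- The group in question is Ext^n(X, Y), which vanishes beyond the projective dimension of X. -/
theorem emb_hom_eq_zero [Module.Finite k A] (hA : IsHereditaryRing A) (X Y : FDMod k A) (n : ℤ)
    (hn : 2 ≤ n) (f : (emb k A).obj X ⟶ ((emb k A).obj Y)⟦n⟧) : f = 0 := by
  have := hasExt_of_hasDerivedCategory (FDMod k A)
  have := hasProjectiveDimensionLT_two hA X
  obtain ⟨n, rfl⟩ := Int.eq_ofNat_of_zero_le (by lia : 0 ≤ n)
  have hs := HasProjectiveDimensionLT.subsingleton X 2 n (by lia) Y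
  refine DerivedCategory.Bounded.ι.map_injective ?_
  rw [← cancel_mono ((DerivedCategory.Bounded.ι.commShiftIso (n : ℤ)).hom.app _)]
  exact (Abelian.Ext.homEquiv (X := X) (Y := Y) (n := n)).symm.injective (hs.elim _ _)

theorem canonical_isHereditary [Module.Finite k A] (hA : IsHereditaryRing A) :
    IsHereditary (canonical k A) where
  bounded X := by
    obtain ⟨m, n, _, hm⟩ := canonical_bounded X
    -- `IsHereditary` asks for m ≤ n, which the bounds obtained may violate when X is zero; the
    -- upper one is therefore enlarged.
    exact ⟨m, max m n, le_max_left _ _, ((canonical k A).isLE_of_le X n (max m n)).le, hm.ge⟩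
  hom_eq_zero X Y hX hY n hn f := by
    rw [canonical_heart] at hX hY
    obtain ⟨M, ⟨e⟩⟩ := hX
    obtain ⟨N, ⟨e'⟩⟩ := hY
    rw [← cancel_epi e.hom, ← cancel_mono (e'.inv⟦n⟧'), comp_zero, zero_comp]
    exact emb_hom_eq_zero hA M N n hn _

theorem canonical_isHereditaryMttZero [WeakBialgebra k A] [Module.Finite k A]
    (hA : IsHereditaryRing A) (h : ¬ IsZero (𝟙_ (Db k A))) :
    IsHereditaryMttZero (canonical k A) where
  hereditary := canonical_isHereditary hA
  mtt := canonical_isMtt h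
  deviation := canonical_hasDeviation

/-- Hearts are closed under extensions of modules. -/
theorem heart_emb_of_shortExact (t : TStructure (Db k A)) {S : ShortComplex (FDMod k A)}
    (hS : S.ShortExact) (h₁ : t.heart ((emb k A).obj S.X₁)) (h₃ : t.heart ((emb k A).obj S.X₃)) :
    t.heart ((emb k A).obj S.X₂) := by
  -- The triangle of a short exact sequence is available in the full derived category; its
  -- connecting morphism is brought back to the bounded one through the commutation of the inclusion
  -- with shifts.
  let σ : DerivedCategory.Bounded.ι.obj ((emb k A).obj S.X₃) ⟶
      (DerivedCategory.Bounded.ι.obj ((emb k A).obj S.X₁))⟦(1 : ℤ)⟧ := hS.singleδ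
  let δ : (emb k A).obj S.X₃ ⟶ ((emb k A).obj S.X₁)⟦(1 : ℤ)⟧ :=
    DerivedCategory.Bounded.ι.preimage (σ ≫
      (DerivedCategory.Bounded.ι.commShiftIso (1 : ℤ)).inv.app ((emb k A).obj S.X₁))
  have hδ : DerivedCategory.Bounded.ι.map δ ≫
      (DerivedCategory.Bounded.ι.commShiftIso (1 : ℤ)).hom.app ((emb k A).obj S.X₁) = σ := by
    rw [Functor.map_preimage, Category.assoc, Iso.inv_hom_id_app]
    exact Category.comp_id _
  have hT : Triangle.mk ((emb k A).map S.f) ((emb k A).map S.g) δ ∈ distTriang (Db k A) :=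
    isomorphic_distinguished _ hS.singleTriangle_distinguished _
      (Triangle.isoMk _ _ (Iso.refl _) (Iso.refl _) (Iso.refl _)
        ((Category.comp_id _).trans (Category.id_comp _).symm)
        ((Category.comp_id _).trans (Category.id_comp _).symm) (
          ((congrArg _ (CategoryTheory.Functor.map_id _ _)).trans (Category.comp_id _)).trans
            (hδ.trans (Category.id_comp _).symm)))
  rw [t.mem_heart_iff] at *
  exact ⟨t.isLE₂ _ hT 0 h₁.1 h₃.1, t.isGE₂ _ hT 0 h₁.2 h₃.2⟩

end WeakBialgebra

/-! ### Uniqueness: degrees of modules for a hereditary mtt-structure of deviation zero. -/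

namespace WeakBialgebra

open Triangulated

variable {k A : Type u} [Field k] [Ring A] [Algebra k A] [WeakBialgebra k A] [Module.Finite k A]
  {t : TStructure (Db k A)}

theorem not_isZero_emb {X : FDMod k A} (hX : ¬ IsZero X) : ¬ IsZero ((emb k A).obj X) :=
  fun h => hX (IsZero.of_full_of_faithful_of_isZero (emb k A) X h)

theorem exists_pure_emb (ht : IsHereditary t) {X : FDMod k A} (hX : ¬ IsZero X)
    (hid : ∀ e : X ⟶ X, e ≫ e = e → e = 0 ∨ e = 𝟙 X) :
    ∃ n : ℤ, t.IsLE ((emb k A).obj X) n ∧ t.IsGE ((emb k A).obj X) n := by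
  refine ht.exists_pure (not_isZero_emb hX) fun e he => ?_
  obtain ⟨e, rfl⟩ := (emb k A).map_surjective e
  obtain rfl | rfl := hid e ((emb k A).map_injective (by rw [Functor.map_comp, he]))
  · exact Or.inl (Functor.map_zero _ _ _)
  · exact Or.inr (CategoryTheory.Functor.map_id _ _)

/-- By Schur's lemma a nonzero idempotent of a simple object is invertible, hence the identity. -/
theorem exists_pure_emb_of_simple (ht : IsHereditary t) (S : FDMod k A) [Simple S] :
    ∃ n : ℤ, t.IsLE ((emb k A).obj S) n ∧ t.IsGE ((emb k A).obj S) n :=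
  exists_pure_emb ht (Simple.not_isZero S) fun e he => by
    by_cases h : e = 0
    · exact Or.inl h
    · have := isIso_of_hom_simple h
      exact Or.inr ((cancel_epi e).1 (he.trans (Category.comp_id e).symm))

/-- Endomorphisms of a brick are scalars, and the only idempotents of a field are 0 and 1. -/
theorem IsBrickSet.exists_pure_emb (ht : IsHereditary t) {n : ℕ} {X : Fin n → FDMod k A}
    (hX : IsBrickSet k X) (i : Fin n) :
    ∃ d : ℤ, t.IsLE ((emb k A).obj (X i)) d ∧ t.IsGE ((emb k A).obj (X i)) d := by
  have hne : 𝟙 (X i) ≠ 0 := fun h => one_ne_zero (α := k) ((hX.brick i).1 (by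
    simp only [h, smul_zero]))
  refine WeakBialgebra.exists_pure_emb ht (fun h => hne ((IsZero.iff_id_eq_zero _).1 h))
    fun e he => ?_
  obtain ⟨c, rfl⟩ := (hX.brick i).2 e
  simp only [Linear.comp_smul, Category.comp_id, smul_smul] at he
  obtain rfl | rfl := IsIdempotentElem.iff_eq_zero_or_one.1 ((hX.brick i).1 he : c * c = c)
  · exact Or.inl (zero_smul _ _)
  · exact Or.inr (one_smul _ _)

theorem tensor_pure_emb (ht : IsHereditaryMttZero t) {X Y : FDMod k A} {i j l : ℤ}
    (hl : i + j = l)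
    (hX : t.IsLE ((emb k A).obj X) i ∧ t.IsGE ((emb k A).obj X) i)
    (hY : t.IsLE ((emb k A).obj Y) j ∧ t.IsGE ((emb k A).obj Y) j) :
    t.IsLE ((emb k A).obj (X ⊗ Y)) l ∧ t.IsGE ((emb k A).obj (X ⊗ Y)) l := by
  obtain ⟨_, _⟩ := ht.tensor_pure tensorShift_Db hl hX hY
  exact ⟨t.isLE_of_iso (Functor.Monoidal.μIso (emb k A) X Y) l,
    t.isGE_of_iso (Functor.Monoidal.μIso (emb k A) X Y) l⟩

theorem iterate_tensor_pure_emb (ht : IsHereditaryMttZero t) {M X : FDMod k A} {d j : ℤ}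
    (hM : t.IsLE ((emb k A).obj M) d ∧ t.IsGE ((emb k A).obj M) d)
    (hX : t.IsLE ((emb k A).obj X) j ∧ t.IsGE ((emb k A).obj X) j) (m : ℕ) :
    t.IsLE ((emb k A).obj ((tensorLeft M).obj^[m] X)) (m * d + j) ∧
      t.IsGE ((emb k A).obj ((tensorLeft M).obj^[m] X)) (m * d + j) := by
  induction m with
  | zero => simpa using hX
  | succ m ih =>
    rw [Function.iterate_succ_apply']
    exact tensor_pure_emb ht (by push_cast; ring) hM ih

/-- The curvature of an object of nonzero degree vanishes. -/
theorem fpv_eq_zero_of_pure (ht : IsHereditaryMttZero t) {M : FDMod k A} {d : ℤ} (hd : d ≠ 0)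
    (hM : t.IsLE ((emb k A).obj M) d ∧ t.IsGE ((emb k A).obj M) d) :
    fpv k (tensorLeft M) = 0 := by
  simp only [fpv, ENNReal.iSup_eq_zero]
  intro n X hX
  choose e he using hX.exists_pure_emb ht.hereditary
  obtain ⟨b, hb⟩ := Set.Finite.bddAbove (Set.finite_range fun i => |e i|)
  have hb' (i : Fin n) : |e i| ≤ b := hb ⟨i, rfl⟩
  have key : ∀ᶠ m : ℕ in Filter.atTop,
      spectralRadius ℂ (adjMatrix k X (tensorLeft M).obj^[m]) ^ (1 / m : ℝ) = 0 := by
    -- All degrees of the bricks lie in [-b, b], and tensoring m times moves the degree by |m d| ≥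
    -- m. Once m > 2b + 2, target and source degrees differ by more than 2.
    filter_upwards [Filter.eventually_ge_atTop ((2 * b + 2).toNat + 1)] with m hm
    have hm' : 2 * b + 2 < m := by lia
    have hzero : adjMatrix k X (tensorLeft M).obj^[m] = 0 := by
      ext i j
      have hi := abs_le.1 (hb' i)
      have hj := abs_le.1 (hb' j)
      obtain ⟨h₁, h₂⟩ := iterate_tensor_pure_emb ht hM (he j) m
      have hs : Subsingleton (X i ⟶ (tensorLeft M).obj^[m] (X j)) :=
        subsingleton_of_forall_eq 0 fun f => (emb k A).map_injective (by
          rw [Functor.map_zero]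
          refine ht.hereditary.eq_zero_of_pure (he i).1 (he i).2 h₁ h₂ ?_ _
          -- For d < 0 the target lies at least two degrees below the source, where heredity
          -- applies; for d > 0 it lies above, where orthogonality applies.
          obtain hd | hd := lt_or_gt_of_ne hd
          · have : (m : ℤ) * d ≤ m * (-1) := mul_le_mul_of_nonneg_left (by lia) (by lia)
            lia
          · have : (m : ℤ) * 1 ≤ m * d := mul_le_mul_of_nonneg_left (by lia) (by lia)
            lia)
      have := Module.finrank_zero_of_subsingleton (R := k) (M := X i ⟶ (tensorLeft M).obj^[m] (X j))
      simp [adjMatrix, this]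
    rw [hzero, spectrum.spectralRadius_zero]
    -- The exponent must be positive: for m = 0 it would be 1 / 0 = 0 and the power would equal 1.
    -- The `+ 1` in the threshold guarantees m > 0.
    exact ENNReal.zero_rpow_of_pos (one_div_pos.2 (Nat.cast_pos.2 (by lia)))
  rw [Filter.limsup_congr key, Filter.limsup_const]

theorem heart_emb_of_simple (ht : IsHereditaryMttZero t)
    (h : IsDiscreteMonoidal k (FDMod k A) ∨ IsFpvPositive k (FDMod k A)) (S : FDMod k A)
    [Simple S] : t.heart ((emb k A).obj S) := by
  obtain ⟨d, hd⟩ := exists_pure_emb_of_simple ht.hereditary S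
  obtain rfl : d = 0 := by
    obtain h | h := h
    · obtain ⟨e⟩ := h.tensor_iso S S ⟨Iso.refl S⟩
      obtain ⟨_, _⟩ := tensor_pure_emb ht rfl hd hd
      have h₁ := t.isLE_of_iso ((emb k A).mapIso e) (d + d)
      have h₂ := t.isGE_of_iso ((emb k A).mapIso e) (d + d)
      obtain ⟨_, _⟩ := hd
      have hS := not_isZero_emb (Simple.not_isZero S)
      by_contra hd
      obtain hd | hd := lt_or_gt_of_ne hd
      · exact hS (t.isZero _ (d + d) d)
      · exact hS (t.isZero _ d (d + d))
    · by_contra hd'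
      exact (h.fpv_pos S (Simple.not_isZero S)).ne' (fpv_eq_zero_of_pure ht hd' hd)
  rwa [t.mem_heart_iff]

/-- A hereditary mtt-structure of deviation zero is the canonical t-structure. -/
theorem IsHereditaryMttZero.eq_canonical (ht : IsHereditaryMttZero t)
    (h : IsDiscreteMonoidal k (FDMod k A) ∨ IsFpvPositive k (FDMod k A)) :
    t = canonical k A := by
  -- It is enough that every module lies in the heart of t; dévissage reduces this to simple
  -- modules.
  refine (eq_of_heart_le canonical_bounded ?_).symm
  rw [canonical_heart]
  rintro X ⟨M, ⟨e⟩⟩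
  refine t.heart.prop_of_iso e (fdMod_induction (fun M => t.heart ((emb k A).obj M))
    (fun M hM => ?_) (fun S _ => heart_emb_of_simple ht h S)
    (fun S hS h₁ h₃ => heart_emb_of_shortExact t hS h₁ h₃) M)
  have := (emb k A).map_isZero hM
  rw [t.mem_heart_iff]
  exact ⟨t.isLE_of_isZero this 0, t.isGE_of_isZero this 0⟩

end WeakBialgebra

/-! ### Transport of t-structures along equivalences. -/

namespace CategoryTheory.Triangulated.TStructure

open Pretriangulated

variable {T T' : Type*} [Category* T] [Preadditive T] [HasZeroObject T] [HasShift T ℤ]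
  [∀ n : ℤ, (shiftFunctor T n).Additive] [Pretriangulated T]
  [Category* T'] [Preadditive T'] [HasZeroObject T'] [HasShift T' ℤ]
  [∀ n : ℤ, (shiftFunctor T' n).Additive] [Pretriangulated T']

/-- The inverse image of a t-structure by a triangulated equivalence. -/
def inverseImage (t : TStructure T') (F : T ⥤ T') [F.CommShift ℤ] [F.IsTriangulated]
    [F.IsEquivalence] : TStructure T where
  le n := (t.le n).inverseImage F
  ge n := (t.ge n).inverseImage F
  le_shift n a n' h X hX :=
    (t.le n').prop_of_iso ((F.commShiftIso a).app X).symm (t.le_shift n a n' h _ hX)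
  ge_shift n a n' h X hX :=
    (t.ge n').prop_of_iso ((F.commShiftIso a).app X).symm (t.ge_shift n a n' h _ hX)
  zero' X Y f hX hY := F.map_injective ((t.zero' (F.map f) hX hY).trans (F.map_zero X Y).symm)
  le_zero_le X hX := t.le_zero_le _ hX
  ge_one_le X hX := t.ge_one_le _ hX
  exists_triangle_zero_one X := by
    -- The truncation triangle of the image lifts through essential surjectivity and fullness; the
    -- lift is distinguished because F reflects distinguished triangles.
    obtain ⟨X₁, X₃, h₁, h₃, f, g, h, hT⟩ := t.exists_triangle_zero_one (F.obj X)
    let e₁ := F.objObjPreimageIso X₁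
    let e₃ := F.objObjPreimageIso X₃
    refine ⟨F.objPreimage X₁, F.objPreimage X₃, (t.le 0).prop_of_iso e₁.symm h₁,
      (t.ge 1).prop_of_iso e₃.symm h₃, F.preimage (e₁.hom ≫ f), F.preimage (g ≫ e₃.inv),
      F.preimage (e₃.hom ≫ h ≫ e₁.inv⟦(1 : ℤ)⟧' ≫ (F.commShiftIso (1 : ℤ)).inv.app _),
      (F.map_distinguished_iff _).1 (isomorphic_distinguished _ hT _
        (Triangle.isoMk _ _ e₁ (Iso.refl _) e₃ ?_ ?_ ?_))⟩
    · change F.map (F.preimage _) ≫ 𝟙 _ = e₁.hom ≫ f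
      simp
    · change F.map (F.preimage _) ≫ e₃.hom = 𝟙 _ ≫ g
      simp
    · change (F.map (F.preimage _) ≫ (F.commShiftIso (1 : ℤ)).hom.app _) ≫ e₁.hom⟦(1 : ℤ)⟧' =
        e₃.hom ≫ h
      rw [Functor.map_preimage]
      simp only [Category.assoc, Iso.inv_hom_id_app_assoc]
      rw [← CategoryTheory.Functor.map_comp, Iso.inv_hom_id, CategoryTheory.Functor.map_id,
        Category.comp_id]

end CategoryTheory.Triangulated.TStructure

namespace WeakBialgebra

open Triangulated

section

variable {T T' : Type*} [Category* T] [Preadditive T] [HasZeroObject T] [HasShift T ℤ]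
  [∀ n : ℤ, (shiftFunctor T n).Additive] [Pretriangulated T]
  [Category* T'] [Preadditive T'] [HasZeroObject T'] [HasShift T' ℤ]
  [∀ n : ℤ, (shiftFunctor T' n).Additive] [Pretriangulated T']

theorem IsHereditary.inverseImage {t : TStructure T'} (ht : IsHereditary t) (F : T ⥤ T')
    [F.CommShift ℤ] [F.IsTriangulated] [F.IsEquivalence] : IsHereditary (t.inverseImage F) where
  bounded X := ht.bounded (F.obj X)
  hom_eq_zero X Y hX hY n hn f := F.map_injective (by
    rw [← cancel_mono ((F.commShiftIso n).hom.app Y), Functor.map_zero, zero_comp]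
    exact ht.hom_eq_zero _ _ hX hY n hn _)

variable [MonoidalCategory T] [MonoidalCategory T']

theorem tensorGE_inverseImage {t : TStructure T'} {D : ℕ} (ht : TensorGE t D) (F : T ⥤ T')
    [F.CommShift ℤ] [F.IsTriangulated] [F.IsEquivalence] [F.Monoidal] :
    TensorGE (t.inverseImage F) D :=
  fun X Y hX hY => (t.ge D).prop_of_iso (Functor.Monoidal.μIso F X Y) (ht _ _ hX hY)

theorem IsMtt.inverseImage {t : TStructure T'} (ht : IsMtt t) (F : T ⥤ T')
    [F.CommShift ℤ] [F.IsTriangulated] [F.IsEquivalence] [F.Monoidal] :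
    IsMtt (t.inverseImage F) where
  tensor_le X Y hX hY :=
    (t.le 0).prop_of_iso (Functor.Monoidal.μIso F X Y) (ht.tensor_le _ _ hX hY)
  -- Essential surjectivity is what matters here: arbitrary objects of the target must be tested on
  -- preimages.
  not_tensor_le h := ht.not_tensor_le fun X Y hX hY => by
    let e := F.objObjPreimageIso X
    let e' := F.objObjPreimageIso Y
    exact (t.le (-1)).prop_of_iso ((Functor.Monoidal.μIso F _ _).symm ≪≫ (e ⊗ᵢ e'))
      (h _ _ ((t.le 0).prop_of_iso e.symm hX) ((t.le 0).prop_of_iso e'.symm hY))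
  le_summand := inferInstance
  ge_summand := inferInstance
  exists_tensorGE := by
    obtain ⟨D, hD⟩ := ht.exists_tensorGE
    exact ⟨D, tensorGE_inverseImage hD F⟩

theorem IsHereditaryMttZero.inverseImage {t : TStructure T'} (ht : IsHereditaryMttZero t)
    (F : T ⥤ T') [F.CommShift ℤ] [F.IsTriangulated] [F.IsEquivalence] [F.Monoidal] :
    IsHereditaryMttZero (t.inverseImage F) where
  hereditary := ht.hereditary.inverseImage F
  mtt := ht.mtt.inverseImage F
  deviation := ⟨tensorGE_inverseImage ht.deviation.1 F, fun _ _ => Nat.zero_le _⟩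

end

/-! ### Restriction of a derived equivalence to modules. -/

section

variable {k A B : Type u} [Field k] [Ring A] [Algebra k A] [Ring B] [Algebra k B]

/-- An equivalence of bounded derived categories which preserves the canonical t-structures
restricts to an equivalence of the categories of modules. -/
theorem exists_equivalence_of_inverseImage_canonical (F : Db k A ⥤ Db k B) [F.CommShift ℤ]
    [F.IsTriangulated] [F.IsEquivalence] (hF : (canonical k B).inverseImage F = canonical k A) :
    ∃ Φ : FDMod k A ⥤ FDMod k B, Φ.IsEquivalence ∧ Nonempty (Φ ⋙ emb k B ≅ emb k A ⋙ F) := by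
  -- Both essential images are canonical hearts, so the equality of t-structures gives an
  -- equivalence: one direction defines Φ, the other shows that Φ is essentially surjective.
  have key (X : Db k A) : (emb k B).essImage (F.obj X) ↔ (emb k A).essImage X := by
    rw [← canonical_heart, ← canonical_heart, ← hF]
    rfl
  have hmem (M : FDMod k A) : (emb k B).essImage ((emb k A ⋙ F).obj M) :=
    (key _).2 ((emb k A).obj_mem_essImage M)
  let Φ := Functor.essImage.liftFunctor (emb k A ⋙ F) (emb k B) hmem
  let e : Φ ⋙ emb k B ≅ emb k A ⋙ F := Functor.essImage.liftFunctorCompIso _ _ hmem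
  refine ⟨Φ, ?_, ⟨e⟩⟩
  have : (Φ ⋙ emb k B).Full := Functor.Full.of_iso e.symm
  have : (Φ ⋙ emb k B).Faithful := Functor.Faithful.of_iso e.symm
  have : Φ.Full := Functor.Full.of_comp_faithful Φ (emb k B)
  have : Φ.Faithful := Functor.Faithful.of_comp Φ (emb k B)
  have : Φ.EssSurj :=
    { mem_essImage := fun N => by
        let e₁ := F.objObjPreimageIso ((emb k B).obj N)
        obtain ⟨M, ⟨e₂⟩⟩ := (key _).1
          ((emb k B).essImage.prop_of_iso e₁.symm ((emb k B).obj_mem_essImage N))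
        exact ⟨M, ⟨(emb k B).preimageIso (e.app M ≪≫ F.mapIso e₂ ≪≫ e₁)⟩⟩ }
  exact { }

/-- After `emb`, the action of Φ on morphisms is that of F conjugated by e, and conjugation is
linear. -/
theorem linear_of_comp_emb_iso {F : Db k A ⥤ Db k B} (hF : F.Linear k)
    {Φ : FDMod k A ⥤ FDMod k B} (e : Φ ⋙ emb k B ≅ emb k A ⋙ F) : Φ.Linear k where
  map_smul {X Y} f r := (emb k B).map_injective (by
    have h (g : X ⟶ Y) : (emb k B).map (Φ.map g) =
        e.hom.app X ≫ F.map ((emb k A).map g) ≫ e.inv.app Y := by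
      have := e.hom.naturality g
      simp only [Functor.comp_map] at this
      rw [← Category.assoc, ← this, Category.assoc, Iso.hom_inv_id_app]
      exact (Category.comp_id _).symm
    rw [h, Functor.map_smul, hF.map_smul, Linear.smul_comp, Linear.comp_smul, ← h,
      Functor.map_smul])

/-- A functor between categories of modules induced by a monoidal functor between bounded derived
categories is monoidal. -/
@[reducible]
noncomputable def monoidalOfCompEmbIso [WeakBialgebra k A] [Module.Finite k A] [WeakBialgebra k B]
    [Module.Finite k B] {F : Db k A ⥤ Db k B} [F.Monoidal] {Φ : FDMod k A ⥤ FDMod k B}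
    (e : Φ ⋙ emb k B ≅ emb k A ⋙ F) : Φ.Monoidal :=
  -- The composite `emb k A ⋙ F` is monoidal; its structure moves along e and then lifts through the
  -- fully faithful monoidal functor `emb k B`.
  letI : (Φ ⋙ emb k B).Monoidal := Functor.Monoidal.transport e.symm
  Functor.monoidalOfComp Φ (emb k B)

end

end WeakBialgebra

/-! ### The main theorem. -/

theorem theorem0p7 {k : Type u} [Field k] [IsAlgClosed k]
    {A : Type u} [Ring A] [Nontrivial A] [Algebra k A] [WeakBialgebra k A] [Module.Finite k A]
    (hA : IsHereditaryRing A)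
    (h : IsDiscreteMonoidal k (FDMod k A) ∨ IsFpvPositive k (FDMod k A)) :
    (∃! t : Triangulated.TStructure (Db k A), IsHereditaryMttZero t) ∧
    IsHereditaryMttZero (canonical k A) ∧
    (∀ t : Triangulated.TStructure (Db k A), IsHereditaryMttZero t →
      t.heart = (emb k A).essImage) ∧
    ∀ (B : Type u) [Ring B] [Algebra k B] [WeakBialgebra k B] [Module.Finite k B],
      IsHereditaryRing B →
      ∀ (F : Db k A ⥤ Db k B) [F.CommShift ℤ], F.IsEquivalence → F.Linear k → F.IsTriangulated →
        Nonempty F.Monoidal →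
        ∃ Φ : FDMod k A ⥤ FDMod k B, Φ.IsEquivalence ∧ Φ.Linear k ∧ Nonempty Φ.Monoidal ∧
          Nonempty (emb k A ⋙ F ≅ Φ ⋙ emb k B) := by
  have hcan := canonical_isHereditaryMttZero hA (not_isZero_unit (k := k) (A := A))
  refine ⟨⟨canonical k A, hcan, fun t ht => ht.eq_canonical h⟩, hcan, fun t ht => ?_, ?_⟩
  · rw [ht.eq_canonical h, canonical_heart]
  · intro B _ _ _ _ hB F _ _ hlin _ hmon
    obtain ⟨_⟩ := hmon
    -- B is not assumed nontrivial; its unit is nonzero because it is isomorphic to the image of the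
    -- unit of A under an equivalence.
    have hunit : ¬ IsZero (𝟙_ (Db k B)) := fun hz => not_isZero_unit (k := k) (A := A)
      (IsZero.of_full_of_faithful_of_isZero F _ (hz.of_iso (Functor.Monoidal.εIso F).symm))
    -- Uniqueness on the side of A identifies the pulled-back t-structure; neither discreteness nor
    -- fpv-positivity is needed for B.
    obtain ⟨Φ, hΦ, ⟨e⟩⟩ := exists_equivalence_of_inverseImage_canonical F
      (((canonical_isHereditaryMttZero hB hunit).inverseImage F).eq_canonical h)
    exact ⟨Φ, hΦ, linear_of_comp_emb_iso hlin e, ⟨monoidalOfCompEmbIso e⟩, ⟨e.symm⟩⟩
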